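/- Let $d\in\mathbb N$, $\kappa>0$, $\sigma>0$, and let $\gamma$ be one of the following kernels on $\mathbb R^d$: (White) $\gamma=\sigma^2\delta_0$, with $\omega:=d$; (Riesz) $\gamma(x)=\sigma^2|x|^{-\omega}$ with $0<\omega<d$; (Fractional) $\gamma(x)=\sigma^2\prod_{i=1}^d|x_i|^{-\omega_i}$ with $\omega_i\in(0,1)$ for all $i$, and $\omega:=\sum_{i=1}^d\omega_i$. Suppose that $0<\omega<2$. For $\varepsilon>0$ let $p_\varepsilon(x)=(2\pi\varepsilon^2)^{-d/2}e^{-|x|^2/(2\varepsilon^2)}$ and $\gamma_\varepsilon:=\gamma*p_\varepsilon$. For $p,\mathfrak c>0$ define $$\mathbf M:=\sup_{f\in H^1(\mathbb R^d),\ \|f\|_2=1}\left(\frac12\iint_{(\mathbb R^d)^2}f(x)^2\gamma(x-y)f(y)^2\,dx\,dy-\kappa\int_{\mathbb R^d}|\nabla f(x)|^2\,dx\right),$$ $$\mathbf M_{\mathfrak c,p}:=\sup_{f\in H^1(\mathbb R^d),\ \|f\|_2=1}\left(\frac12\iint_{(\mathbb R^d)^2}f(x)^2\gamma_{p^{1/(2-\omega)}\mathfrak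 c}(x-y)f(y)^2\,dx\,dy-\kappa\int_{\mathbb R^d}|\nabla f(x)|^2\,dx\right),$$ where the functions $f$ are real-valued and, for white noise, $\iint f(x)^2\gamma(x-y)f(y)^2\,dx\,dy=\sigma^2\int f(x)^4\,dx$. A maximizer is an $f\in H^1(\mathbb R^d)$ with $\|f\|_2=1$ which attains the supremum. Then: 1. For every $p,\mathfrak c>0$, the constant $\mathbf M_{\mathfrak c,p}$ is finite and positive, and it has maximizers. 2. The constant $\mathbf M$ is finite, and for every fixed $p>0$, $\displaystyle\lim_{\mathfrak c\to0}\mathbf M_{\mathfrak c,p}=\mathbf M$. 3. Let $p>0$ be fixed, and let $(f_\star^{(\mathfrak c)})_{\mathfrak c>0}$ be such that $f_\star^{(\mathfrak c)}$ is a maximizer of $\mathbf M_{\mathfrak c,p}$ for all $\mathfrak c>0$. Then every sequence of positive numbers $\mathfrak c$ that converges to $0$ has a subsequence $(\mathfrak c_n)_{n\in\mathbb N}$ along which $$\lim_{n\to\infty}\big\|f_\star^{(\mathfrak c_n)}(\cdot-z_n)-f_\star\big\|_{H^1(\mathbb R^d)}=0$$ for some $z_n\in\mathbb R^d$ and some maximizer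 $f_\star$ of $\mathbf M$. -/

import Mathlib

open MeasureTheory Filter Topology
open scoped ENNReal ContDiff

namespace PAM

noncomputable section

/-- `ℝᵈ` with the Euclidean norm and Lebesgue measure. -/
abbrev Space (d : ℕ) : Type := EuclideanSpace ℝ (Fin d)

/-! ### The Sobolev space `H¹(ℝᵈ)` -/

/-- `g` is the weak gradient of `f`: `∫ f ∂ᵥφ = - ∫ ⟨g, v⟩ φ` for all test functions
`φ ∈ C_c^∞(ℝᵈ)` and all directions `v`. -/
def IsWeakGradient {d : ℕ} (f : Space d → ℝ) (g : Space d → Space d) : Prop :=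
  LocallyIntegrable f volume ∧ LocallyIntegrable g volume ∧
    ∀ φ : Space d → ℝ, ContDiff ℝ ∞ φ → HasCompactSupport φ →
      ∀ v : Space d, ∫ x, f x * fderiv ℝ φ x v = - ∫ x, inner ℝ (g x) v * φ x

/-- `f ∈ H¹(ℝᵈ)`: `f` is in `L²` and has a weak gradient in `L²`. -/
def MemH1 {d : ℕ} (f : Space d → ℝ) : Prop :=
  MemLp f 2 volume ∧ ∃ g : Space d → Space d, MemLp g 2 volume ∧ IsWeakGradient f g

open Classical in
/-- The weak gradient of `f` (unique up to null sets), and `0` if `f` has no weak gradient. -/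
def weakGrad {d : ℕ} (f : Space d → ℝ) : Space d → Space d :=
  if h : ∃ g : Space d → Space d, IsWeakGradient f g then h.choose else 0

/-- The norm of `H¹(ℝᵈ)`, `(‖f‖₂² + ‖∇f‖₂²)^{1/2}` for `f ∈ H¹(ℝᵈ)`. -/
def h1Norm {d : ℕ} (f : Space d → ℝ) : ℝ :=
  Real.sqrt ((∫ x, f x ^ 2) + ∫ x, ‖weakGrad f x‖ ^ 2)

/-! ### The covariance kernels -/

/-- The three types of noise on `ℝᵈ`, together with their exponents. -/
inductive NoiseKernel (d : ℕ) : Type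
  | white : NoiseKernel d
  | riesz (a : ℝ) : NoiseKernel d
  | fractional (w : Fin d → ℝ) : NoiseKernel d

/-- The constraints on the exponents: `0 < a < d` for Riesz noise (with kernel `σ² |x|^{-a}`) and `ωᵢ ∈ (0,1)` for
fractional noise. -/
def NoiseKernel.Admissible {d : ℕ} : NoiseKernel d → Prop
  | .white => True
  | .riesz a => 0 < a ∧ a < d
  | .fractional w => ∀ i, 0 < w i ∧ w i < 1

/-- The scaling exponent `ω`, for which `γ(c x) = c^{-ω} γ(x)`. -/
def NoiseKernel.exponent {d : ℕ} : NoiseKernel d → ℝ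
  | .white => d
  | .riesz a => a
  | .fractional w => ∑ i, w i

/-- The covariance `γ`, as the measure `γ(x) dx`: `σ² δ₀` for white noise, `σ² |x|^{-a} dx` for
Riesz noise and `σ² ∏ᵢ |xᵢ|^{-ωᵢ} dx` for fractional noise. -/
def NoiseKernel.cov {d : ℕ} (σ : ℝ) : NoiseKernel d → Measure (Space d)
  | .white => ENNReal.ofReal (σ ^ 2) • Measure.dirac 0
  | .riesz a => volume.withDensity fun x => ENNReal.ofReal (σ ^ 2 * ‖x‖ ^ (-a))
  | .fractional w => volume.withDensity fun x => ENNReal.ofReal (σ ^ 2 * ∏ i, |x i| ^ (-w i))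

/-- The Gaussian density `p_ε(x) = e^{-|x|²/(2ε²)} / (2πε²)^{d/2}`. -/
def gaussianKernel (d : ℕ) (ε : ℝ) (x : Space d) : ℝ :=
  Real.exp (-‖x‖ ^ 2 / (2 * ε ^ 2)) / (2 * Real.pi * ε ^ 2) ^ ((d : ℝ) / 2)

/-- The function `γ_ε = γ * p_ε`, that is `γ_ε(x) = ∫ p_ε(x - y) γ(dy)`. -/
def mollifiedKernel {d : ℕ} (γ : Measure (Space d)) (ε : ℝ) (x : Space d) : ℝ≥0∞ :=
  ∫⁻ y, ENNReal.ofReal (gaussianKernel d ε (x - y)) ∂γ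

/-- The mollified covariance, as the measure `γ_ε(x) dx`. -/
def mollifiedCov {d : ℕ} (γ : Measure (Space d)) (ε : ℝ) : Measure (Space d) :=
  volume.withDensity (mollifiedKernel γ ε)

/-! ### The variational problems -/

/-- `½ ∬ f(x)² γ(x - y) f(y)² dx dy`, written as `½ ∫ f(x)² (∫ f(x - z)² γ(dz)) dx` so that it
makes sense for every measure `γ`; for `γ = σ² δ₀` it is `½ σ² ∫ f⁴`. -/
def interaction {d : ℕ} (γ : Measure (Space d)) (f : Space d → ℝ) : ℝ≥0∞ :=
  2⁻¹ * ∫⁻ x, ENNReal.ofReal (f x ^ 2) * ∫⁻ z, ENNReal.ofReal (f (x - z) ^ 2) ∂γ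

/-- `½ ∬ f(x)² γ(x - y) f(y)² dx dy - κ ∫ |∇f(x)|² dx`. It is extended-real-valued: nothing is
presupposed about the finiteness of the double integral. -/
def energy {d : ℕ} (κ : ℝ) (γ : Measure (Space d)) (f : Space d → ℝ) : EReal :=
  (interaction γ f : EReal) - ((κ * ∫ x, ‖weakGrad f x‖ ^ 2 : ℝ) : EReal)

/-- The supremum of the energy over `f ∈ H¹(ℝᵈ)` with `‖f‖₂ = 1`. -/
def varConst {d : ℕ} (κ : ℝ) (γ : Measure (Space d)) : EReal :=
  sSup {e : EReal | ∃ f : Space d → ℝ, MemH1 f ∧ eLpNorm f 2 volume = 1 ∧ e = energy κ γ f}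

/-- `f` attains the supremum `varConst κ γ`. -/
def IsMaximizer {d : ℕ} (κ : ℝ) (γ : Measure (Space d)) (f : Space d → ℝ) : Prop :=
  MemH1 f ∧ eLpNorm f 2 volume = 1 ∧ energy κ γ f = varConst κ γ

/-- The covariance `γ_{p^{1/(2-ω)} 𝔠}` which enters the definition of `M_{𝔠,p}`. -/
def NoiseKernel.covAt {d : ℕ} (k : NoiseKernel d) (σ p c : ℝ) : Measure (Space d) :=
  mollifiedCov (k.cov σ) (p ^ (1 / (2 - k.exponent)) * c)

end

end PAM

/-! All three kernels enter through one package, `RegularCov`: the mollified kernels satisfy `γ_ε ≤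
A ε^{-w}` with `0 < w < 2`, vanish at infinity for each fixed `ε`, and satisfy `γ_ε(0) ≥ a ε^{-w}`.
Homogeneity of `γ` reduces these bounds to `ε = 1`.

The analytic core is a Hölder estimate in the scale. The potential `(γ_ε * u²)(x)` is the square of
a weighted `L²` norm `N` of `u`, with weight `γ_ε(x - ·)`. Since `γ_{ε'} = γ_ε * p_δ` with `δ² = ε'²
- ε²`, the norm at scale `ε'` is the quadratic mean of the norms at scale `ε` of Gaussian translates
of `u`. Minkowski's inequality and `‖u(· + h) - u‖₂ ≤ |h| ‖∇u‖₂` bound the change of `N` between `ε`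
and `2ε` by a multiple of `ε^{1-w/2} ‖∇u‖₂`, uniformly in `x`. Because `w < 2`, these bounds sum
over dyadic scales (`abs_N_sub_le`). Two consequences follow. The interactions at all scales below
`r`, including `γ` itself, agree up to `O(r^{1-w/2})` on bounded sets of `H¹`
(`interaction_scaledCov_le`), and the interaction is dominated by an arbitrarily small multiple of
the kinetic energy plus a mass term, uniformly in the scale (`exists_interaction_scaledCov_le`).

Maximizers come from concentration compactness (`exists_maximizer_of_maximizing`), for measures
approximable by bounded kernels of compact support (`Tame`). The supremum `M` is positive, because
for a wide Gaussian of width `s` the interaction is at least of order `s^{-w}` and the kinetic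
energy at most of order `s^{-2}`. Positivity excludes vanishing, so suitable translates of a
maximizing sequence have a nonzero weak limit `u`. The energy splits between `u` and the remainder.
As the interaction has degree four and the kinetic energy degree two, a function of mass `m² < 1`
has energy strictly below `m² M` unless it is zero. Hence no mass is lost, and convergence is strong
in `H¹`.

Finally, near-optimal functions have gradients bounded uniformly in the scale, so the suprema
converge and maximizers at scales `ε_n → 0` form a maximizing sequence for `γ`. The compactness
theorem at scale zero then gives their convergence. -/

namespace PAM

noncomputable section

/-! ### Sobolev pairs in `L²` -/

/-- Real-valued `L²` functions on `ℝᵈ`. -/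
abbrev L2 (d : ℕ) : Type := Lp ℝ 2 (volume : Measure (Space d))

/-- Square-integrable vector fields on `ℝᵈ`. -/
abbrev V2 (d : ℕ) : Type := Lp (Space d) 2 (volume : Measure (Space d))

section Sobolev

variable {d : ℕ}

theorem inner_toLp_eq_integral {F : Type*} [NormedAddCommGroup F] [InnerProductSpace ℝ F]
    {f : Space d → F} (hf : MemLp f 2 volume) (u : Lp F 2 (volume : Measure (Space d))) :
    inner ℝ (hf.toLp f) u = ∫ x, inner ℝ (f x) (u x) := by
  rw [L2.inner_def]
  apply integral_congr_ae
  filter_upwards [hf.coeFn_toLp] with x hx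
  rw [hx]

theorem memLp_fderiv_apply {φ : Space d → ℝ} (hφ : ContDiff ℝ ∞ φ) (hc : HasCompactSupport φ)
    (v : Space d) : MemLp (fun x => fderiv ℝ φ x v) 2 volume := by
  have h1 : Continuous fun x => fderiv ℝ φ x v :=
    (hφ.continuous_fderiv (by simp)).clm_apply continuous_const
  exact h1.memLp_of_hasCompactSupport (hc.fderiv_apply ℝ v)

theorem memLp_smul_const {φ : Space d → ℝ} (hφ : ContDiff ℝ ∞ φ) (hc : HasCompactSupport φ)
    (v : Space d) : MemLp (fun x => φ x • v) 2 volume :=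
  (hφ.continuous.smul continuous_const).memLp_of_hasCompactSupport hc.smul_right

/-- `g` is the weak gradient of `u`, for elements of `L²`. -/
def HasGrad (u : L2 d) (g : V2 d) : Prop :=
  ∀ (φ : Space d → ℝ) (hφ : ContDiff ℝ ∞ φ) (hc : HasCompactSupport φ) (v : Space d),
    inner ℝ ((memLp_fderiv_apply hφ hc v).toLp _) u =
      - inner ℝ ((memLp_smul_const hφ hc v).toLp _) g

theorem hasGrad_iff_integral {u : L2 d} {g : V2 d} :
    HasGrad u g ↔ ∀ φ : Space d → ℝ, ContDiff ℝ ∞ φ → HasCompactSupport φ →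
      ∀ v : Space d, ∫ x, u x * fderiv ℝ φ x v = - ∫ x, inner ℝ (g x) v * φ x := by
  unfold HasGrad
  refine forall_congr' fun φ => forall_congr' fun hφ => forall_congr' fun hc =>
    forall_congr' fun v => ?_
  rw [inner_toLp_eq_integral, inner_toLp_eq_integral]
  simp only [RCLike.inner_apply, conj_trivial, inner_smul_left, real_inner_comm, mul_comm]

theorem HasGrad.isWeakGradient {u : L2 d} {g : V2 d} (h : HasGrad u g) :
    IsWeakGradient (u : Space d → ℝ) (g : Space d → Space d) :=
  ⟨(Lp.memLp u).locallyIntegrable (by norm_num), (Lp.memLp g).locallyIntegrable (by norm_num),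
    hasGrad_iff_integral.1 h⟩

theorem IsWeakGradient.hasGrad {f : Space d → ℝ} {g : Space d → Space d}
    (hf : MemLp f 2 volume) (hg : MemLp g 2 volume) (h : IsWeakGradient f g) :
    HasGrad (hf.toLp f) (hg.toLp g) := by
  rw [hasGrad_iff_integral]
  intro φ hφ hc v
  have h1 : ∫ x, (hf.toLp f) x * fderiv ℝ φ x v = ∫ x, f x * fderiv ℝ φ x v := by
    apply integral_congr_ae
    filter_upwards [hf.coeFn_toLp] with x hx
    rw [hx]
  have h2 : ∫ x, inner ℝ ((hg.toLp g) x) v * φ x = ∫ x, inner ℝ (g x) v * φ x := by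
    apply integral_congr_ae
    filter_upwards [hg.coeFn_toLp] with x hx
    rw [hx]
  rw [h1, h2]
  exact h.2.2 φ hφ hc v

/-- Testing in every direction `v` determines the vectors `∫ φ g`, and these determine a locally
integrable field almost everywhere. This makes the choice in `weakGrad` harmless. -/
theorem IsWeakGradient.ae_eq {f f' : Space d → ℝ} {g g' : Space d → Space d}
    (hff : f =ᵐ[volume] f') (h : IsWeakGradient f g) (h' : IsWeakGradient f' g') :
    g =ᵐ[volume] g' := by
  apply ae_eq_of_integral_contDiff_smul_eq h.2.1 h'.2.1
  intro φ hφ hc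
  have i1 : Integrable (fun x => φ x • g x) volume :=
    h.2.1.integrable_smul_left_of_hasCompactSupport hφ.continuous hc
  have i2 : Integrable (fun x => φ x • g' x) volume :=
    h'.2.1.integrable_smul_left_of_hasCompactSupport hφ.continuous hc
  apply ext_inner_right ℝ
  intro v
  have e1 : inner ℝ (∫ x, φ x • g x) v = ∫ x, inner ℝ (g x) v * φ x := by
    rw [real_inner_comm, ← integral_inner i1]
    congr 1; ext x
    rw [real_inner_comm, real_inner_smul_left, mul_comm]
  have e2 : inner ℝ (∫ x, φ x • g' x) v = ∫ x, inner ℝ (g' x) v * φ x := by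
    rw [real_inner_comm, ← integral_inner i2]
    congr 1; ext x
    rw [real_inner_comm, real_inner_smul_left, mul_comm]
  rw [e1, e2]
  have h3 := h.2.2 φ hφ hc v
  have h4 := h'.2.2 φ hφ hc v
  have h5 : ∫ x, f x * fderiv ℝ φ x v = ∫ x, f' x * fderiv ℝ φ x v := by
    apply integral_congr_ae
    filter_upwards [hff] with x hx
    rw [hx]
  linarith

theorem weakGrad_spec {f : Space d → ℝ} {g : Space d → Space d} (h : IsWeakGradient f g) :
    IsWeakGradient f (weakGrad f) := by
  have h' : ∃ g : Space d → Space d, IsWeakGradient f g := ⟨g, h⟩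
  unfold weakGrad
  rw [dif_pos h']
  exact h'.choose_spec

theorem weakGrad_ae_eq {f f' : Space d → ℝ} {g : Space d → Space d} (hff : f =ᵐ[volume] f')
    (h : IsWeakGradient f g) (h' : IsWeakGradient f' g) : weakGrad f =ᵐ[volume] g :=
  (weakGrad_spec h).ae_eq hff h'

theorem IsWeakGradient.congr {f f' : Space d → ℝ} {g g' : Space d → Space d}
    (hff : f =ᵐ[volume] f') (hgg : g =ᵐ[volume] g') (h : IsWeakGradient f g) :
    IsWeakGradient f' g' := by
  refine ⟨h.1.congr hff, h.2.1.congr hgg, fun φ hφ hc v => ?_⟩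
  have h1 : ∫ x, f x * fderiv ℝ φ x v = ∫ x, f' x * fderiv ℝ φ x v := by
    apply integral_congr_ae
    filter_upwards [hff] with x hx
    rw [hx]
  have h2 : ∫ x, inner ℝ (g x) v * φ x = ∫ x, inner ℝ (g' x) v * φ x := by
    apply integral_congr_ae
    filter_upwards [hgg] with x hx
    rw [hx]
  rw [← h1, ← h2]
  exact h.2.2 φ hφ hc v

theorem HasGrad.sub {u u' : L2 d} {g g' : V2 d} (h : HasGrad u g) (h' : HasGrad u' g') :
    HasGrad (u - u') (g - g') := by
  intro φ hφ hc v
  rw [inner_sub_right, inner_sub_right, h φ hφ hc v, h' φ hφ hc v]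
  ring

theorem HasGrad.smul {u : L2 d} {g : V2 d} (h : HasGrad u g) (c : ℝ) :
    HasGrad (c • u) (c • g) := by
  intro φ hφ hc v
  rw [inner_smul_right, inner_smul_right, h φ hφ hc v]
  ring

/-- The defining identities are weakly continuous in the pair, so the graph of the weak gradient is
weakly closed. -/
theorem HasGrad.of_tendsto {u : ℕ → L2 d} {g : ℕ → V2 d} {u₀ : L2 d} {g₀ : V2 d}
    (h : ∀ n, HasGrad (u n) (g n))
    (hu : ∀ w, Tendsto (fun n => inner ℝ w (u n)) atTop (𝓝 (inner ℝ w u₀)))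
    (hg : ∀ w, Tendsto (fun n => inner ℝ w (g n)) atTop (𝓝 (inner ℝ w g₀))) :
    HasGrad u₀ g₀ := by
  intro φ hφ hc v
  refine tendsto_nhds_unique (hu _) ?_
  simp_rw [fun n => h n φ hφ hc v]
  exact (hg _).neg

/-! ### Translations -/

/-- Translation `u ↦ u(· + h)` as an isometry of `L²`. -/
def trans {F : Type*} [NormedAddCommGroup F] [InnerProductSpace ℝ F] (h : Space d) :
    Lp F 2 (volume : Measure (Space d)) →ₗᵢ[ℝ] Lp F 2 (volume : Measure (Space d)) :=
  Lp.compMeasurePreservingₗᵢ ℝ (fun x => x + h) (measurePreserving_add_right volume h)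

theorem coeFn_trans {F : Type*} [NormedAddCommGroup F] [InnerProductSpace ℝ F] (h : Space d)
    (u : Lp F 2 (volume : Measure (Space d))) :
    trans h u =ᵐ[volume] fun x => u (x + h) :=
  Lp.coeFn_compMeasurePreserving u (measurePreserving_add_right volume h)

theorem ContDiff.comp_sub_right {φ : Space d → ℝ} (hφ : ContDiff ℝ ∞ φ) (h : Space d) :
    ContDiff ℝ ∞ fun x => φ (x - h) :=
  hφ.comp (contDiff_id.sub contDiff_const)

theorem HasCompactSupport.comp_sub_right {φ : Space d → ℝ} (hc : HasCompactSupport φ)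
    (h : Space d) : HasCompactSupport fun x => φ (x - h) :=
  hc.comp_homeomorph (Homeomorph.subRight h)

theorem HasGrad.trans {u : L2 d} {g : V2 d} (hu : HasGrad u g) (h : Space d) :
    HasGrad (trans h u) (trans h g) := by
  rw [hasGrad_iff_integral] at *
  intro φ hφ hc v
  have h1 : ∫ x, (PAM.trans h u) x * fderiv ℝ φ x v
      = ∫ x, u x * fderiv ℝ (fun y => φ (y - h)) x v := by
    rw [← integral_add_right_eq_self (fun x => u x * fderiv ℝ (fun y => φ (y - h)) x v) h]
    apply integral_congr_ae
    filter_upwards [coeFn_trans h u] with x hx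
    rw [hx, fderiv_comp_sub, add_sub_cancel_right]
  have h2 : ∫ x, inner ℝ ((PAM.trans h g) x) v * φ x = ∫ x, inner ℝ (g x) v * φ (x - h) := by
    rw [← integral_add_right_eq_self (fun x => inner ℝ (g x) v * φ (x - h)) h]
    apply integral_congr_ae
    filter_upwards [coeFn_trans h g] with x hx
    rw [hx, add_sub_cancel_right]
  rw [h1, h2]
  exact hu _ (ContDiff.comp_sub_right hφ h) (HasCompactSupport.comp_sub_right hc h) v

/-- The function of `s` is the convolution of `u` with the reflection of `φ`, evaluated at `s • h`.
The derivative falls on the smooth factor, and the weak gradient identity moves it onto `u`. -/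
theorem hasDerivAt_integral_mul_translate {u : L2 d} {g : V2 d} (hu : HasGrad u g)
    {φ : Space d → ℝ} (hφ : ContDiff ℝ ∞ φ) (hc : HasCompactSupport φ) (h : Space d) (s : ℝ) :
    HasDerivAt (fun s : ℝ => ∫ x, u x * φ (x - s • h))
      (∫ x, inner ℝ (g x) h * φ (x - s • h)) s := by
  have hloc : LocallyIntegrable (u : Space d → ℝ) volume :=
    (Lp.memLp u).locallyIntegrable (by norm_num)
  let ψ : Space d → ℝ := fun x => φ (-x)
  have hψ : ContDiff ℝ ∞ ψ := hφ.comp contDiff_neg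
  have hψc : HasCompactSupport ψ := hc.comp_homeomorph (Homeomorph.neg _)
  have key := HasCompactSupport.hasFDerivAt_convolution_right (ContinuousLinearMap.mul ℝ ℝ)
    (μ := volume) hψc hloc (hψ.of_le (by simp)) (s • h)
  have hd := key.comp_hasDerivAt s ((hasDerivAt_id s).smul_const h)
  have e1 : (fun s : ℝ => ∫ x, u x * φ (x - s • h)) =
      (convolution (u : Space d → ℝ) ψ (ContinuousLinearMap.mul ℝ ℝ) volume) ∘
        fun s : ℝ => id s • h := by
    ext s
    simp [convolution, ψ]
  rw [e1]
  convert! hd using 1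
  have hex := (HasCompactSupport.convolutionExists_right
    ((ContinuousLinearMap.mul ℝ ℝ).precompR (Space d)) (hψc.fderiv (𝕜 := ℝ)) hloc
    (hψ.continuous_fderiv (by simp))) (s • h)
  simp only [convolution, one_smul]
  rw [ContinuousLinearMap.integral_apply hex]
  have h3 := hasGrad_iff_integral.1 hu _ (ContDiff.comp_sub_right hφ (s • h))
    (HasCompactSupport.comp_sub_right hc (s • h)) h
  rw [← neg_eq_iff_eq_neg] at h3
  rw [← h3, ← integral_neg]
  congr 1
  ext x
  have : fderiv ℝ ψ (s • h - x) = - fderiv ℝ φ (x - s • h) := by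
    have hd1 : HasFDerivAt φ (fderiv ℝ φ (-(s • h - x))) (-(s • h - x)) :=
      (hφ.differentiable (by simp)).differentiableAt.hasFDerivAt
    have hd2 := hd1.comp (s • h - x) ((hasFDerivAt_id (𝕜 := ℝ) (s • h - x)).neg)
    have hd3 : HasFDerivAt ψ _ (s • h - x) := hd2
    rw [hd3.fderiv, neg_sub]
    ext y
    simp
  simp [ContinuousLinearMap.precompR_apply, this, fderiv_comp_sub]

/-- A function with a weak gradient in `L²` satisfies `‖u(· + h) - u‖₂ ≤ |h| ‖∇u‖₂`. -/
theorem HasGrad.norm_trans_sub_le {u : L2 d} {g : V2 d} (hu : HasGrad u g) (h : Space d) :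
    ‖PAM.trans h u - u‖ ≤ ‖h‖ * ‖g‖ := by
  -- Duality: paired with a test function, the difference is the increment over `[0, 1]` of the
  -- differentiable function above, and the mean value inequality applies. Density of test functions
  -- and the choice of `w` as the difference itself finish the proof.
  have key : ∀ φ : Space d → ℝ, ∀ hφ : ContDiff ℝ ∞ φ, ∀ hc : HasCompactSupport φ,
      |inner ℝ ((hφ.continuous.memLp_of_hasCompactSupport hc).toLp φ : L2 d) (PAM.trans h u - u)|
        ≤ ‖h‖ * ‖g‖ * ‖((hφ.continuous.memLp_of_hasCompactSupport hc).toLp φ : L2 d)‖ := by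
    intro φ hφ hc
    set w : L2 d := (hφ.continuous.memLp_of_hasCompactSupport hc).toLp φ with hw
    have e0 : inner ℝ w (PAM.trans h u - u)
        = (∫ x, u x * φ (x - (1 : ℝ) • h)) - ∫ x, u x * φ (x - (0 : ℝ) • h) := by
      rw [inner_sub_right, hw, inner_toLp_eq_integral, inner_toLp_eq_integral]
      congr 1
      · rw [← integral_add_right_eq_self (fun x => u x * φ (x - (1 : ℝ) • h)) h]
        apply integral_congr_ae
        filter_upwards [coeFn_trans h u] with x hx
        simp [hx]
      · congr 1; ext x; simp
    rw [e0]
    have bound : ∀ s : ℝ, ‖∫ x, inner ℝ (g x) h * φ (x - s • h)‖ ≤ ‖h‖ * ‖g‖ * ‖w‖ := by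
      intro s
      have hm := memLp_smul_const (ContDiff.comp_sub_right hφ (s • h))
        (HasCompactSupport.comp_sub_right hc (s • h)) h
      have e1 : ∫ x, inner ℝ (g x) h * φ (x - s • h) = inner ℝ (hm.toLp _) g := by
        rw [inner_toLp_eq_integral]
        congr 1; ext x
        rw [real_inner_smul_left, real_inner_comm, mul_comm]
      have e2 : ‖hm.toLp _‖ = ‖h‖ * ‖w‖ := by
        rw [Lp.norm_toLp, hw, Lp.norm_toLp]
        have : eLpNorm (fun x => φ (x - s • h) • h) 2 volume
            = ‖h‖ₑ * eLpNorm φ 2 volume := by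
          have e3 : eLpNorm (fun x => φ (x - s • h)) 2 volume = eLpNorm φ 2 volume :=
            eLpNorm_comp_measurePreserving hφ.continuous.aestronglyMeasurable
              (measurePreserving_sub_right volume (s • h))
          rw [← e3, ← enorm_norm h, ← Real.norm_of_nonneg (norm_nonneg h)]
          rw [← eLpNorm_const_smul]
          apply eLpNorm_congr_norm_ae
          filter_upwards with x
          simp [norm_smul, mul_comm]
        rw [this, ENNReal.toReal_mul, toReal_enorm]
      rw [e1]
      calc ‖inner ℝ (hm.toLp _) g‖ ≤ ‖hm.toLp _‖ * ‖g‖ := norm_inner_le_norm _ _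
        _ = ‖h‖ * ‖g‖ * ‖w‖ := by rw [e2]; ring
    have := Convex.norm_image_sub_le_of_norm_hasDerivWithin_le (s := Set.univ) (x := 0) (y := 1)
      (fun s _ => (hasDerivAt_integral_mul_translate hu hφ hc h s).hasDerivWithinAt)
      (fun s _ => bound s) convex_univ trivial trivial
    simpa using this
  have key2 : ∀ w : L2 d, |inner ℝ w (PAM.trans h u - u)| ≤ ‖h‖ * ‖g‖ * ‖w‖ := by
    intro w
    have hcl : IsClosed {w : L2 d | |inner ℝ w (PAM.trans h u - u)| ≤ ‖h‖ * ‖g‖ * ‖w‖} := by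
      apply isClosed_le
      · fun_prop
      · fun_prop
    have hd := Lp.dense_hasCompactSupport_contDiff (E := Space d) (F := ℝ) (μ := volume)
      (p := 2) (by norm_num)
    refine hcl.closure_subset_iff.2 ?_ (hd w)
    rintro w ⟨φ, hwφ, hc, hφ⟩
    have : w = (hφ.continuous.memLp_of_hasCompactSupport hc).toLp φ := by
      apply Lp.ext
      exact hwφ.trans (MemLp.coeFn_toLp _).symm
    rw [this]
    exact key φ hφ hc
  have h3 := key2 (PAM.trans h u - u)
  rw [real_inner_self_eq_norm_sq, abs_of_nonneg (by positivity)] at h3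
  rcases eq_or_lt_of_le (norm_nonneg (PAM.trans h u - u)) with h0 | h0
  · rw [← h0]; positivity
  · nlinarith

end Sobolev

/-! ### Gaussian densities -/

section Gaussian

variable {d : ℕ}

theorem gaussianKernel_nonneg (ε : ℝ) (x : Space d) : 0 ≤ gaussianKernel d ε x := by
  unfold gaussianKernel; positivity

theorem gaussianKernel_pos {ε : ℝ} (hε : 0 < ε) (x : Space d) : 0 < gaussianKernel d ε x := by
  unfold gaussianKernel; positivity

theorem continuous_gaussianKernel (ε : ℝ) : Continuous (gaussianKernel d ε) := by
  unfold gaussianKernel; fun_prop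

theorem gaussianKernel_neg (ε : ℝ) (x : Space d) :
    gaussianKernel d ε (-x) = gaussianKernel d ε x := by
  simp [gaussianKernel]

theorem gaussianKernel_le (ε : ℝ) (x : Space d) :
    gaussianKernel d ε x ≤ 1 / (2 * Real.pi * ε ^ 2) ^ ((d : ℝ) / 2) := by
  unfold gaussianKernel
  gcongr
  rw [Real.exp_le_one_iff, neg_div, neg_nonpos]
  positivity

theorem gaussianKernel_eq_const_mul (ε : ℝ) :
    gaussianKernel d ε = fun x => ((2 * Real.pi * ε ^ 2) ^ ((d : ℝ) / 2))⁻¹ *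
      Real.exp (-(1 / (2 * ε ^ 2)) * ‖x‖ ^ 2) := by
  ext x
  unfold gaussianKernel
  rw [div_eq_inv_mul]
  congr 2
  ring

theorem integrable_gaussianKernel {ε : ℝ} (hε : 0 < ε) : Integrable (gaussianKernel d ε) := by
  rw [gaussianKernel_eq_const_mul]
  apply Integrable.const_mul
  have := GaussianFourier.integrable_cexp_neg_mul_sq_norm_add (V := Space d)
    (b := ((1 / (2 * ε ^ 2) : ℝ) : ℂ)) (by rw [Complex.ofReal_re]; positivity) 0 0
  have h2 := this.norm
  refine h2.congr (ae_of_all _ fun x => ?_)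
  simp only [Complex.norm_exp]
  congr 1
  simp [← Complex.ofReal_pow, ← Complex.ofReal_mul]

theorem integral_gaussianKernel {ε : ℝ} (hε : 0 < ε) : ∫ x, gaussianKernel d ε x = 1 := by
  rw [gaussianKernel_eq_const_mul, integral_const_mul,
    GaussianFourier.integral_rexp_neg_mul_sq_norm (by positivity)]
  have : Real.pi / (1 / (2 * ε ^ 2)) = 2 * Real.pi * ε ^ 2 := by field_simp
  rw [this]
  simp only [finrank_euclideanSpace, Fintype.card_fin]
  apply inv_mul_cancel₀
  positivity

/-- The Gaussian density, with values in `ℝ≥0∞`. -/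
def gaussE (d : ℕ) (ε : ℝ) (x : Space d) : ℝ≥0∞ := ENNReal.ofReal (gaussianKernel d ε x)

@[fun_prop]
theorem measurable_gaussE (ε : ℝ) : Measurable (gaussE d ε) :=
  (continuous_gaussianKernel ε).measurable.ennreal_ofReal

theorem gaussE_neg (ε : ℝ) (x : Space d) : gaussE d ε (-x) = gaussE d ε x := by
  simp [gaussE, gaussianKernel_neg]

theorem lintegral_gaussE {ε : ℝ} (hε : 0 < ε) : ∫⁻ x, gaussE d ε x = 1 := by
  unfold gaussE
  rw [← ofReal_integral_eq_lintegral_ofReal (integrable_gaussianKernel hε)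
    (ae_of_all _ (gaussianKernel_nonneg ε)), integral_gaussianKernel hε, ENNReal.ofReal_one]

/-- Completing the square in `h`: conditionally on the sum `x`, the second of two independent
Gaussians is Gaussian with mean `(b²/c²) x` and standard deviation `ab/c`. -/
theorem gaussianKernel_mul {a b c : ℝ} (ha : 0 < a) (hb : 0 < b) (hc : 0 < c)
    (habc : c ^ 2 = a ^ 2 + b ^ 2) (x h : Space d) :
    gaussianKernel d a (x - h) * gaussianKernel d b h =
      gaussianKernel d c x * gaussianKernel d (a * b / c) (h - (b ^ 2 / c ^ 2) • x) := by
  unfold gaussianKernel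
  rw [div_mul_div_comm, div_mul_div_comm, ← Real.exp_add, ← Real.exp_add,
    ← Real.mul_rpow (by positivity) (by positivity),
    ← Real.mul_rpow (by positivity) (by positivity)]
  congr 2
  · rw [norm_sub_sq_real, norm_sub_sq_real, norm_smul, real_inner_smul_right,
      real_inner_comm x h, mul_pow, Real.norm_eq_abs, sq_abs]
    have hb2 : b ^ 2 = c ^ 2 - a ^ 2 := by linarith
    field_simp
    have hb4 : b ^ 4 = (c ^ 2 - a ^ 2) ^ 2 := by rw [← hb2]; ring
    ring_nf
    simp only [hb4, hb2]
    ring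
  · field_simp

theorem lintegral_gaussE_mul {a b c : ℝ} (ha : 0 < a) (hb : 0 < b) (hc : 0 < c)
    (habc : c ^ 2 = a ^ 2 + b ^ 2) (x : Space d) :
    ∫⁻ h, gaussE d a (x - h) * gaussE d b h = gaussE d c x := by
  have h1 : ∀ h, gaussE d a (x - h) * gaussE d b h =
      gaussE d c x * gaussE d (a * b / c) (h - (b ^ 2 / c ^ 2) • x) := by
    intro h
    unfold gaussE
    rw [← ENNReal.ofReal_mul (gaussianKernel_nonneg _ _), gaussianKernel_mul ha hb hc habc,
      ENNReal.ofReal_mul (gaussianKernel_nonneg _ _)]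
  simp_rw [h1]
  rw [lintegral_const_mul _ (by fun_prop),
    lintegral_sub_right_eq_self (fun h => gaussE d (a * b / c) h), lintegral_gaussE (by positivity),
    mul_one]

/-- Half of the exponent absorbs `‖x‖²` through `t e^{-t} ≤ 1` with `t = ‖x‖²/(4ε²)`. The other half
is a Gaussian of doubled variance, and `2^{d/2}` is the ratio of the normalizations. -/
theorem norm_sq_mul_gaussianKernel_le {ε : ℝ} (hε : 0 < ε) (x : Space d) :
    ‖x‖ ^ 2 * gaussianKernel d ε x ≤
      4 * 2 ^ ((d : ℝ) / 2) * ε ^ 2 * gaussianKernel d (Real.sqrt 2 * ε) x := by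
  unfold gaussianKernel
  have h2 : (Real.sqrt 2 * ε) ^ 2 = 2 * ε ^ 2 := by
    rw [mul_pow, Real.sq_sqrt (by norm_num)]
  rw [h2]
  have h3 : (2 * Real.pi * (2 * ε ^ 2)) ^ ((d : ℝ) / 2) =
      2 ^ ((d : ℝ) / 2) * (2 * Real.pi * ε ^ 2) ^ ((d : ℝ) / 2) := by
    rw [← Real.mul_rpow (by positivity) (by positivity)]
    congr 1; ring
  rw [h3]
  set t := ‖x‖ ^ 2 / (4 * ε ^ 2) with ht
  have e1 : -‖x‖ ^ 2 / (2 * ε ^ 2) = -t + -t := by rw [ht]; field_simp; ring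
  have e2 : -‖x‖ ^ 2 / (2 * (2 * ε ^ 2)) = -t := by rw [ht]; field_simp; ring
  have e3 : ‖x‖ ^ 2 = 4 * ε ^ 2 * t := by rw [ht]; field_simp
  rw [e1, e2, Real.exp_add, e3]
  have h4 : t * Real.exp (-t) ≤ 1 := by
    rw [Real.exp_neg, mul_inv_le_iff₀ (Real.exp_pos t), one_mul]
    linarith [Real.add_one_le_exp t]
  set D := (2 * Real.pi * ε ^ 2) ^ ((d : ℝ) / 2)
  have hD : 0 < D := by positivity
  have h22 : (0 : ℝ) < 2 ^ ((d : ℝ) / 2) := by positivity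
  calc 4 * ε ^ 2 * t * (Real.exp (-t) * Real.exp (-t) / D)
      = (4 * ε ^ 2 * Real.exp (-t) / D) * (t * Real.exp (-t)) := by ring
    _ ≤ (4 * ε ^ 2 * Real.exp (-t) / D) * 1 := by gcongr
    _ = _ := by field_simp

/-- The Gaussian probability measure with density `p_ε`. -/
def gaussMeasure (d : ℕ) (ε : ℝ) : Measure (Space d) := volume.withDensity (gaussE d ε)

theorem isProbabilityMeasure_gaussMeasure {ε : ℝ} (hε : 0 < ε) :
    IsProbabilityMeasure (gaussMeasure d ε) := by
  constructor
  rw [gaussMeasure, withDensity_apply _ MeasurableSet.univ, setLIntegral_univ,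
    lintegral_gaussE hε]

theorem lintegral_gaussMeasure (ε : ℝ) {F : Space d → ℝ≥0∞} (hF : Measurable F) :
    ∫⁻ h, F h ∂(gaussMeasure d ε) = ∫⁻ h, gaussE d ε h * F h := by
  rw [gaussMeasure, lintegral_withDensity_eq_lintegral_mul _ (measurable_gaussE ε) hF]
  rfl

/-- The constant in the second moment bound for Gaussians. -/
def momentConst (d : ℕ) : ℝ := Real.sqrt (4 * 2 ^ ((d : ℝ) / 2))

theorem momentConst_pos (d : ℕ) : 0 < momentConst d := by unfold momentConst; positivity

theorem lintegral_enorm_sq_gaussMeasure_le {ε : ℝ} (hε : 0 < ε) :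
    ∫⁻ h, ‖h‖ₑ ^ 2 ∂(gaussMeasure d ε) ≤ ENNReal.ofReal ((momentConst d * ε) ^ 2) := by
  rw [lintegral_gaussMeasure ε (by fun_prop)]
  have h1 : ∀ h : Space d, gaussE d ε h * ‖h‖ₑ ^ 2 ≤
      ENNReal.ofReal ((momentConst d * ε) ^ 2) * gaussE d (Real.sqrt 2 * ε) h := by
    intro h
    unfold gaussE
    rw [← ofReal_norm, ← ENNReal.ofReal_pow (norm_nonneg _),
      ← ENNReal.ofReal_mul (gaussianKernel_nonneg _ _), ← ENNReal.ofReal_mul (by positivity)]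
    apply ENNReal.ofReal_le_ofReal
    rw [mul_comm, momentConst, mul_pow, Real.sq_sqrt (by positivity)]
    exact norm_sq_mul_gaussianKernel_le hε h
  calc _ ≤ ∫⁻ h, ENNReal.ofReal ((momentConst d * ε) ^ 2) * gaussE d (Real.sqrt 2 * ε) h :=
        lintegral_mono h1
    _ = _ := by
        rw [lintegral_const_mul _ (measurable_gaussE _), lintegral_gaussE (by positivity), mul_one]

end Gaussian

/-! ### Weighted `L²` seminorms -/

section Weighted

variable {d : ℕ}

theorem measurable_coe (u : L2 d) : Measurable (u : Space d → ℝ) :=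
  (Lp.stronglyMeasurable u).measurable

theorem lintegral_enorm_sq (u : L2 d) : ∫⁻ x, ‖u x‖ₑ ^ 2 = ENNReal.ofReal (‖u‖ ^ 2) := by
  rw [Lp.norm_def, ← ENNReal.toReal_pow, ENNReal.ofReal_toReal (by
    exact ENNReal.pow_ne_top (Lp.eLpNorm_ne_top u)),
    eLpNorm_eq_lintegral_rpow_enorm_toReal (by norm_num) (by norm_num)]
  simp only [ENNReal.toReal_ofNat, one_div, ENNReal.rpow_ofNat]
  rw [← ENNReal.rpow_natCast, ← ENNReal.rpow_mul]
  simp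

/-- The `L²` norm of `u` with weight `ρ`. -/
def wnorm (ρ : Space d → ℝ≥0∞) (u : L2 d) : ℝ≥0∞ := eLpNorm u 2 (volume.withDensity ρ)

theorem wnorm_sq {ρ : Space d → ℝ≥0∞} (hρ : Measurable ρ) (u : L2 d) :
    wnorm ρ u ^ 2 = ∫⁻ y, ρ y * ‖u y‖ₑ ^ 2 := by
  have hu := measurable_coe u
  rw [wnorm, eLpNorm_eq_lintegral_rpow_enorm_toReal (by norm_num) (by norm_num)]
  simp only [ENNReal.toReal_ofNat, one_div, ENNReal.rpow_ofNat]
  rw [← ENNReal.rpow_natCast, ← ENNReal.rpow_mul]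
  simp only [Nat.cast_ofNat, ne_eq, OfNat.ofNat_ne_zero, not_false_eq_true, inv_mul_cancel₀,
    ENNReal.rpow_one]
  rw [lintegral_withDensity_eq_lintegral_mul _ hρ (by fun_prop)]
  rfl

theorem wnorm_add_le (ρ : Space d → ℝ≥0∞) (u v : L2 d) :
    wnorm ρ (u + v) ≤ wnorm ρ u + wnorm ρ v := by
  unfold wnorm
  have h : ((u + v : L2 d) : Space d → ℝ) =ᵐ[volume.withDensity ρ]
      (u : Space d → ℝ) + (v : Space d → ℝ) :=
    (withDensity_absolutelyContinuous _ _).ae_le (Lp.coeFn_add u v)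
  rw [eLpNorm_congr_ae h]
  exact eLpNorm_add_le (measurable_coe u).aestronglyMeasurable
    (measurable_coe v).aestronglyMeasurable (by norm_num)

theorem wnorm_neg (ρ : Space d → ℝ≥0∞) (u : L2 d) : wnorm ρ (-u) = wnorm ρ u := by
  unfold wnorm
  have h : ((-u : L2 d) : Space d → ℝ) =ᵐ[volume.withDensity ρ] -(u : Space d → ℝ) :=
    (withDensity_absolutelyContinuous _ _).ae_le (Lp.coeFn_neg u)
  rw [eLpNorm_congr_ae h, eLpNorm_neg]

theorem wnorm_le {ρ : Space d → ℝ≥0∞} (hρ : Measurable ρ) {S : ℝ} (hS : 0 ≤ S)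
    (hb : ∀ y, ρ y ≤ ENNReal.ofReal S) (u : L2 d) :
    wnorm ρ u ≤ ENNReal.ofReal (Real.sqrt S * ‖u‖) := by
  rw [← ENNReal.pow_le_pow_left_iff two_ne_zero, wnorm_sq hρ, ← ENNReal.ofReal_pow (by positivity),
    mul_pow, Real.sq_sqrt hS, ENNReal.ofReal_mul hS, ← lintegral_enorm_sq]
  rw [← lintegral_const_mul _ (by have := measurable_coe u; fun_prop)]
  exact lintegral_mono fun y => by gcongr; exact hb y

theorem wnorm_trans_sq {ρ : Space d → ℝ≥0∞} (hρ : Measurable ρ) (u : L2 d) (h : Space d) :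
    wnorm ρ (trans h u) ^ 2 = ∫⁻ y, ρ y * ‖u (y + h)‖ₑ ^ 2 := by
  rw [wnorm_sq hρ]
  apply lintegral_congr_ae
  filter_upwards [coeFn_trans h u] with y hy
  rw [hy]

theorem measurable_wnorm_trans {ρ : Space d → ℝ≥0∞} (hρ : Measurable ρ) (u : L2 d) :
    Measurable fun h => wnorm ρ (trans h u) := by
  have hu := measurable_coe u
  have h1 : (fun h => wnorm ρ (trans h u)) =
      fun h => (∫⁻ y, ρ y * ‖u (y + h)‖ₑ ^ 2) ^ (1 / 2 : ℝ) := by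
    ext h
    rw [← wnorm_trans_sq hρ, ← ENNReal.rpow_natCast, ← ENNReal.rpow_mul]
    simp
  rw [h1]
  apply Measurable.pow_const
  apply Measurable.lintegral_prod_right'
    (f := fun p : Space d × Space d => ρ p.2 * ‖u (p.2 + p.1)‖ₑ ^ 2)
  fun_prop

/-- By Tonelli, averaging the weight over translations is the same as averaging over translations of
`u`. -/
theorem wnorm_conv_sq {ρ : Space d → ℝ≥0∞} (hρ : Measurable ρ) (δ : ℝ) (u : L2 d) :
    wnorm (fun y => ∫⁻ h, ρ (y - h) * gaussE d δ h) u ^ 2 =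
      ∫⁻ h, wnorm ρ (trans h u) ^ 2 ∂(gaussMeasure d δ) := by
  have hu := measurable_coe u
  have hm := measurable_gaussE (d := d) δ
  rw [wnorm_sq (Measurable.lintegral_prod_right'
    (f := fun p : Space d × Space d => ρ (p.1 - p.2) * gaussE d δ p.2) (by fun_prop)),
    lintegral_gaussMeasure _ ((measurable_wnorm_trans hρ u).pow_const 2)]
  simp_rw [wnorm_trans_sq hρ]
  have e1 : ∀ y, (∫⁻ h, ρ (y - h) * gaussE d δ h) * ‖u y‖ₑ ^ 2 =
      ∫⁻ h, gaussE d δ h * (ρ (y - h) * ‖u y‖ₑ ^ 2) := by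
    intro y
    rw [← lintegral_mul_const _ (by fun_prop)]
    congr 1; ext h; ring
  simp_rw [e1]
  rw [lintegral_lintegral_swap (by fun_prop)]
  congr 1; ext h
  rw [lintegral_const_mul _ (by fun_prop)]
  congr 1
  rw [← lintegral_add_right_eq_self (fun y => ρ (y - h) * ‖u y‖ₑ ^ 2) h]
  simp

/-- The function `h ↦ wnorm ρ (trans h u)` differs from the constant `wnorm ρ u` by at most `√S ‖g‖
|h|`. Minkowski's inequality in `L²` of the Gaussian measure, where `|h|` has norm at most
`momentConst d * δ`, gives both bounds. The lemma serves twice: with a mollified kernel as weight,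
to compare scales, and with the potential of `u` as weight, to remove the mollification. -/
theorem wnorm_conv_le {ρ : Space d → ℝ≥0∞} (hρ : Measurable ρ) {S : ℝ} (hS : 0 ≤ S)
    (hb : ∀ y, ρ y ≤ ENNReal.ofReal S) {δ : ℝ} (hδ : 0 < δ) {u : L2 d} {g : V2 d}
    (hu : HasGrad u g) :
    wnorm (fun y => ∫⁻ h, ρ (y - h) * gaussE d δ h) u ≤
        wnorm ρ u + ENNReal.ofReal (Real.sqrt S * ‖g‖ * (momentConst d * δ)) ∧
      wnorm ρ u ≤ wnorm (fun y => ∫⁻ h, ρ (y - h) * gaussE d δ h) u +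
        ENNReal.ofReal (Real.sqrt S * ‖g‖ * (momentConst d * δ)) := by
  have hP := isProbabilityMeasure_gaussMeasure (d := d) hδ
  set P := gaussMeasure d δ
  set c := ENNReal.ofReal (Real.sqrt S * ‖g‖) with hc
  have hstep : ∀ h, wnorm ρ (trans h u - u) ≤ c * ‖h‖ₑ := by
    intro h
    refine (wnorm_le hρ hS hb _).trans ?_
    rw [hc, ← ofReal_norm, ← ENNReal.ofReal_mul (by positivity)]
    apply ENNReal.ofReal_le_ofReal
    rw [mul_assoc]
    gcongr
    rw [mul_comm]
    exact hu.norm_trans_sub_le h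
  have hm := measurable_wnorm_trans hρ u
  have hB : wnorm (fun y => ∫⁻ h, ρ (y - h) * gaussE d δ h) u =
      (∫⁻ h, wnorm ρ (trans h u) ^ (2 : ℝ) ∂P) ^ (1 / 2 : ℝ) := by
    simp only [ENNReal.rpow_ofNat]
    rw [← wnorm_conv_sq hρ, ← ENNReal.rpow_natCast, ← ENNReal.rpow_mul]
    simp
  have hC : (∫⁻ h, (c * ‖h‖ₑ) ^ (2 : ℝ) ∂P) ^ (1 / 2 : ℝ) ≤
      ENNReal.ofReal (Real.sqrt S * ‖g‖ * (momentConst d * δ)) := by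
    have h0 := momentConst_pos d
    rw [one_div, ENNReal.rpow_inv_le_iff (by norm_num)]
    simp only [ENNReal.rpow_ofNat, mul_pow]
    rw [lintegral_const_mul _ (by fun_prop), ENNReal.ofReal_mul (by positivity), mul_pow]
    gcongr
    rw [← ENNReal.ofReal_pow (by positivity)]
    exact lintegral_enorm_sq_gaussMeasure_le hδ
  have hA : (∫⁻ _, wnorm ρ u ^ (2 : ℝ) ∂P) ^ (1 / 2 : ℝ) = wnorm ρ u := by
    rw [lintegral_const, measure_univ, mul_one, ← ENNReal.rpow_mul]
    simp
  let F₁ : Space d → ℝ≥0∞ := fun _ => wnorm ρ u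
  let F₂ : Space d → ℝ≥0∞ := fun h => c * ‖h‖ₑ
  let F₃ : Space d → ℝ≥0∞ := fun h => wnorm ρ (trans h u)
  have m₁ : AEMeasurable F₁ P := by fun_prop
  have m₂ : AEMeasurable F₂ P := by fun_prop
  have m₃ : AEMeasurable F₃ P := hm.aemeasurable
  constructor
  · rw [hB]
    calc (∫⁻ h, wnorm ρ (trans h u) ^ (2 : ℝ) ∂P) ^ (1 / 2 : ℝ)
        ≤ (∫⁻ h, (F₁ + F₂) h ^ (2 : ℝ) ∂P) ^ (1 / 2 : ℝ) := by
          gcongr with h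
          have := wnorm_add_le ρ u (trans h u - u)
          rw [add_sub_cancel] at this
          refine this.trans ?_
          simp only [Pi.add_apply, F₁, F₂]
          gcongr
          exact hstep h
      _ ≤ (∫⁻ h, F₁ h ^ (2 : ℝ) ∂P) ^ (1 / 2 : ℝ) + (∫⁻ h, F₂ h ^ (2 : ℝ) ∂P) ^ (1 / 2 : ℝ) :=
          ENNReal.lintegral_Lp_add_le m₁ m₂ (by norm_num)
      _ ≤ _ := add_le_add hA.le hC
  · rw [hB]
    calc wnorm ρ u = (∫⁻ _, wnorm ρ u ^ (2 : ℝ) ∂P) ^ (1 / 2 : ℝ) := hA.symm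
      _ ≤ (∫⁻ h, (F₃ + F₂) h ^ (2 : ℝ) ∂P)
            ^ (1 / 2 : ℝ) := by
          gcongr with h
          have := wnorm_add_le ρ (trans h u) (-(trans h u - u))
          rw [wnorm_neg] at this
          simp only [neg_sub, add_sub_cancel] at this
          refine this.trans ?_
          simp only [Pi.add_apply, F₂, F₃]
          gcongr
          exact hstep h
      _ ≤ (∫⁻ h, F₃ h ^ (2 : ℝ) ∂P) ^ (1 / 2 : ℝ) + (∫⁻ h, F₂ h ^ (2 : ℝ) ∂P) ^ (1 / 2 : ℝ) :=
          ENNReal.lintegral_Lp_add_le m₃ m₂ (by norm_num)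
      _ ≤ _ := add_le_add le_rfl hC

/-- Telescoping over dyadic scales from `r` down to `ε`. The increments decay geometrically with
ratio `2^{-θ}`, so the sum is controlled by the largest scale and does not see `ε`. -/
theorem abs_sub_le_of_abs_sub_le_of_le_two_mul {N : ℝ → ℝ} {θ D : ℝ} (hθ : 0 < θ) (hD : 0 ≤ D)
    (h : ∀ ε ε', 0 < ε → ε ≤ ε' → ε' ≤ 2 * ε → |N ε - N ε'| ≤ D * ε ^ θ) {ε r : ℝ} (hε : 0 < ε)
    (hr : ε ≤ r) : |N ε - N r| ≤ D / (1 - 2 ^ (-θ)) * r ^ θ := by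
  have hq : (2 : ℝ) ^ (-θ) < 1 := Real.rpow_lt_one_of_one_lt_of_neg (by norm_num) (by linarith)
  have hq0 : (0 : ℝ) < 2 ^ (-θ) := by positivity
  set q : ℝ := 2 ^ (-θ) with hqdef
  have hD' : D ≤ D / (1 - q) := by
    rw [le_div_iff₀ (by linarith)]
    nlinarith
  -- The induction closes because `C = D / (1 - q)` solves `C = C q + D`, whence `(C + D) q ≤ C`.
  have hD'' : (D / (1 - q) + D) * q ≤ D / (1 - q) := by
    have : D / (1 - q) = D / (1 - q) * q + D := by
      have h1q : 1 - q ≠ 0 := by linarith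
      field_simp
      ring
    nlinarith
  have key : ∀ k : ℕ, ∀ r, ε ≤ r → r ≤ 2 ^ k * ε → |N ε - N r| ≤ D / (1 - q) * r ^ θ := by
    intro k
    induction k with
    | zero =>
      intro r h1 h2
      have : r = ε := by simp at h2; linarith
      rw [this, sub_self, abs_zero]
      have : 0 < 1 - q := by linarith
      positivity
    | succ k ih =>
      intro r h1 h2
      rcases le_total r (2 * ε) with h3 | h3
      · refine (h ε r hε h1 h3).trans ?_
        gcongr
      · have i1 := ih (r / 2) (by linarith) (by rw [pow_succ] at h2; linarith)
        have i2 := h (r / 2) r (by linarith) (by linarith) (by linarith)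
        have e : (r / 2) ^ θ = q * r ^ θ := by
          rw [Real.div_rpow (by linarith) (by norm_num), hqdef, Real.rpow_neg (by norm_num)]
          field_simp
        rw [e] at i1 i2
        have hrθ : 0 ≤ r ^ θ := Real.rpow_nonneg (by linarith) _
        calc |N ε - N r| ≤ |N ε - N (r / 2)| + |N (r / 2) - N r| := abs_sub_le _ _ _
          _ ≤ D / (1 - q) * (q * r ^ θ) + D * (q * r ^ θ) := add_le_add i1 i2
          _ = ((D / (1 - q) + D) * q) * r ^ θ := by ring
          _ ≤ _ := by gcongr
  obtain ⟨k, hk⟩ := pow_unbounded_of_one_lt (r / ε) (by norm_num : (1 : ℝ) < 2)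
  exact key k r hr (by rw [div_lt_iff₀ hε] at hk; exact hk.le)

end Weighted

/-! ### Regular covariance measures -/

section Regular

variable {d : ℕ}

/-- The properties of the covariance measure `γ` used in the analysis of the variational problems:
its mollifications are of order `ε^{-w}`, with `0 < w < 2`, and vanish at infinity. -/
structure RegularCov (γ : Measure (Space d)) (w A : ℝ) : Prop where
  sfinite : SFinite γ
  w_pos : 0 < w
  w_lt : w < 2
  A_pos : 0 < A
  bound : ∀ ε x, 0 < ε → mollifiedKernel γ ε x ≤ ENNReal.ofReal (A * ε ^ (-w))
  decay : ∀ ε, 0 < ε → ∀ η : ℝ, 0 < η → ∃ R : ℝ, ∀ x, R < ‖x‖ →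
    mollifiedKernel γ ε x ≤ ENNReal.ofReal η
  lower : ∃ a : ℝ, 0 < a ∧ ∀ ε, 0 < ε → ENNReal.ofReal (a * ε ^ (-w)) ≤ mollifiedKernel γ ε 0

theorem mollifiedKernel_eq (γ : Measure (Space d)) (ε : ℝ) (x : Space d) :
    mollifiedKernel γ ε x = ∫⁻ y, gaussE d ε (x - y) ∂γ := rfl

theorem measurable_mollifiedKernel (γ : Measure (Space d)) [SFinite γ] (ε : ℝ) :
    Measurable (mollifiedKernel γ ε) := by
  have : Measurable fun p : Space d × Space d => gaussE d ε (p.1 - p.2) := by fun_prop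
  exact this.lintegral_prod_right'

theorem sfinite_mollifiedCov (γ : Measure (Space d)) [SFinite γ] (ε : ℝ) :
    SFinite (mollifiedCov γ ε) := by
  unfold mollifiedCov
  infer_instance

/-- This is `γ_c = γ_a * p_b`, a consequence of `p_c = p_a * p_b`. The shift is placed on `y` so
that the right side has the form of the averaged weight in `wnorm_conv_sq`. -/
theorem mollifiedKernel_semigroup (γ : Measure (Space d)) [SFinite γ] {a b c : ℝ} (ha : 0 < a)
    (hb : 0 < b) (hc : 0 < c) (habc : c ^ 2 = a ^ 2 + b ^ 2) (x y : Space d) :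
    mollifiedKernel γ c (x - y) =
      ∫⁻ h, mollifiedKernel γ a (x - (y - h)) * gaussE d b h := by
  simp_rw [mollifiedKernel_eq]
  have e1 : ∀ h, (∫⁻ z, gaussE d a (x - (y - h) - z) ∂γ) * gaussE d b h =
      ∫⁻ z, gaussE d a (x - (y - h) - z) * gaussE d b h ∂γ := fun h => by
    rw [lintegral_mul_const _ (by fun_prop)]
  simp_rw [e1]
  rw [lintegral_lintegral_swap (by fun_prop)]
  congr 1; ext z
  rw [← lintegral_gaussE_mul ha hb hc habc, ← lintegral_neg_eq_self]
  congr 1; ext h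
  rw [gaussE_neg]
  congr 2
  abel

theorem ofReal_sq_eq_enorm_sq (a : ℝ) : ENNReal.ofReal (a ^ 2) = ‖a‖ₑ ^ 2 := by
  rw [Real.enorm_eq_ofReal_abs, ← ENNReal.ofReal_pow (abs_nonneg a), sq_abs]

/-- The potential `μ * f²` generated by `f²`. -/
def pot (μ : Measure (Space d)) (f : Space d → ℝ) (x : Space d) : ℝ≥0∞ :=
  ∫⁻ z, ‖f (x - z)‖ₑ ^ 2 ∂μ

theorem interaction_eq (μ : Measure (Space d)) (f : Space d → ℝ) :
    interaction μ f = 2⁻¹ * ∫⁻ x, ‖f x‖ₑ ^ 2 * pot μ f x := by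
  simp only [interaction, pot, ofReal_sq_eq_enorm_sq]

theorem measurable_pot (μ : Measure (Space d)) [SFinite μ] {f : Space d → ℝ} (hf : Measurable f) :
    Measurable (pot μ f) := by
  have : Measurable fun p : Space d × Space d => ‖f (p.1 - p.2)‖ₑ ^ 2 := by fun_prop
  exact this.lintegral_prod_right'

/-- The measure `μ` may be singular, so `f = f'` almost everywhere says nothing directly about
`μ`-almost every `z`. However, translates of a null set are null, and Tonelli gives `f (x - z) = f'
(x - z)` for `μ`-almost every `z`, for almost every `x`. -/
theorem interaction_congr_ae (μ : Measure (Space d)) [SFinite μ] {f f' : Space d → ℝ}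
    (h : f =ᵐ[volume] f') : interaction μ f = interaction μ f' := by
  rw [interaction_eq, interaction_eq]
  congr 1
  apply lintegral_congr_ae
  obtain ⟨s, hs, hsm, hs0⟩ := exists_measurable_superset_of_null (ae_iff.1 h)
  have h1 : ∀ᵐ x : Space d, ∀ᵐ z ∂μ, x - z ∉ s := by
    have hms : MeasurableSet {p : Space d × Space d | p.1 - p.2 ∉ s} :=
      (hsm.preimage (measurable_fst.sub measurable_snd)).compl
    refine (Measure.ae_ae_comm hms).2 (ae_of_all _ fun z => ?_)
    rw [ae_iff]
    simp only [not_not]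
    have := (measurePreserving_sub_right volume z).measure_preimage hsm.nullMeasurableSet
    rw [hs0] at this
    exact this
  filter_upwards [h, h1] with x hx hx1
  rw [hx]
  congr 1
  unfold pot
  apply lintegral_congr_ae
  filter_upwards [hx1] with z hz
  have : f (x - z) = f' (x - z) := by
    by_contra hne
    exact hz (hs hne)
  rw [this]

theorem interaction_comp_add_right (μ : Measure (Space d)) (f : Space d → ℝ) (h : Space d) :
    interaction μ (fun x => f (x + h)) = interaction μ f := by
  rw [interaction_eq, interaction_eq]
  congr 1
  rw [← lintegral_add_right_eq_self (fun x => ‖f x‖ₑ ^ 2 * pot μ f x) h]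
  have : ∀ x z : Space d, x - z + h = x + h - z := fun x z => by abel
  simp only [pot, this]

theorem interaction_trans (μ : Measure (Space d)) [SFinite μ] (u : L2 d) (h : Space d) :
    interaction μ (trans h u : L2 d) = interaction μ u := by
  rw [interaction_congr_ae μ (coeFn_trans h u), interaction_comp_add_right μ u h]

/-- Seen as squared weighted norms, potentials can be compared by the triangle inequality. -/
theorem pot_withDensity {k : Space d → ℝ≥0∞} (hk : Measurable k) (u : L2 d) (x : Space d) :
    pot (volume.withDensity k) u x = wnorm (fun y => k (x - y)) u ^ 2 := by
  have hu := measurable_coe u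
  rw [wnorm_sq (by fun_prop), pot, lintegral_withDensity_eq_lintegral_mul _ hk (by fun_prop)]
  rw [← lintegral_sub_left_eq_self _ x]
  simp

theorem interaction_le_add_of_pot_le (μ ν : Measure (Space d)) (u : L2 d)
    {c : ℝ} (hc : 0 ≤ c) (h : ∀ x, pot μ u x ≤ pot ν u x + ENNReal.ofReal c) :
    interaction μ u ≤ interaction ν u + ENNReal.ofReal (c * ‖u‖ ^ 2) := by
  have hu := measurable_coe u
  rw [interaction_eq, interaction_eq]
  calc 2⁻¹ * ∫⁻ x, ‖u x‖ₑ ^ 2 * pot μ u x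
      ≤ 2⁻¹ * ∫⁻ x, (‖u x‖ₑ ^ 2 * pot ν u x + ENNReal.ofReal c * ‖u x‖ₑ ^ 2) := by
        gcongr with x
        rw [mul_comm (ENNReal.ofReal c), ← mul_add]
        gcongr
        exact h x
    _ = (2⁻¹ * ∫⁻ x, ‖u x‖ₑ ^ 2 * pot ν u x) + 2⁻¹ * (ENNReal.ofReal c * ENNReal.ofReal (‖u‖ ^ 2)) := by
        rw [lintegral_add_right _ (by fun_prop), lintegral_const_mul _ (by fun_prop),
          lintegral_enorm_sq, mul_add]
    _ ≤ _ := by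
        rw [← ENNReal.ofReal_mul hc]
        gcongr
        calc 2⁻¹ * ENNReal.ofReal (c * ‖u‖ ^ 2) ≤ 1 * ENNReal.ofReal (c * ‖u‖ ^ 2) := by
              gcongr
              simp
          _ = _ := one_mul _

theorem interaction_le_of_pot_le (μ : Measure (Space d)) (u : L2 d)
    {c : ℝ} (hc : 0 ≤ c) (h : ∀ᵐ x, pot μ u x ≤ ENNReal.ofReal c) :
    interaction μ u ≤ ENNReal.ofReal (c * ‖u‖ ^ 2 / 2) := by
  have hu := measurable_coe u
  rw [interaction_eq]
  calc 2⁻¹ * ∫⁻ x, ‖u x‖ₑ ^ 2 * pot μ u x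
      ≤ 2⁻¹ * ∫⁻ x, ENNReal.ofReal c * ‖u x‖ₑ ^ 2 := by
        gcongr 2⁻¹ * ?_
        apply lintegral_mono_ae
        filter_upwards [h] with x hx
        rw [mul_comm (ENNReal.ofReal c)]
        gcongr
    _ = 2⁻¹ * (ENNReal.ofReal c * ENNReal.ofReal (‖u‖ ^ 2)) := by
        rw [lintegral_const_mul _ (by fun_prop), lintegral_enorm_sq]
    _ = _ := by
        have : (2⁻¹ : ℝ≥0∞) = ENNReal.ofReal (2⁻¹) := by
          rw [ENNReal.ofReal_inv_of_pos (by norm_num)]; simp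
        rw [this, ← ENNReal.ofReal_mul hc, ← ENNReal.ofReal_mul (by norm_num)]
        congr 1; ring

namespace RegularCov

variable {γ : Measure (Space d)} {w A : ℝ}

/-- The weighted norm of `u` with weight `γ_ε(x - ·)`. -/
def N (γ : Measure (Space d)) (x : Space d) (u : L2 d) (ε : ℝ) : ℝ :=
  (wnorm (fun y => mollifiedKernel γ ε (x - y)) u).toReal

theorem measurable_shift (hγ : RegularCov γ w A) (ε : ℝ) (x : Space d) :
    Measurable fun y => mollifiedKernel γ ε (x - y) := by
  have := hγ.sfinite
  have := measurable_mollifiedKernel γ ε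
  fun_prop

theorem wnorm_le (hγ : RegularCov γ w A) {ε : ℝ} (hε : 0 < ε) (x : Space d) (u : L2 d) :
    wnorm (fun y => mollifiedKernel γ ε (x - y)) u ≤
      ENNReal.ofReal (Real.sqrt (A * ε ^ (-w)) * ‖u‖) := by
  have := hγ.A_pos
  exact PAM.wnorm_le (hγ.measurable_shift ε x) (by positivity) (fun y => hγ.bound ε _ hε) u

theorem ofReal_N (hγ : RegularCov γ w A) {ε : ℝ} (hε : 0 < ε) (x : Space d) (u : L2 d) :
    ENNReal.ofReal (N γ x u ε) = wnorm (fun y => mollifiedKernel γ ε (x - y)) u :=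
  ENNReal.ofReal_toReal ((hγ.wnorm_le hε x u).trans_lt ENNReal.ofReal_lt_top).ne

theorem N_nonneg (x : Space d) (u : L2 d) (ε : ℝ) : 0 ≤ N γ x u ε := ENNReal.toReal_nonneg

theorem N_le (hγ : RegularCov γ w A) {ε : ℝ} (hε : 0 < ε) (x : Space d) (u : L2 d) :
    N γ x u ε ≤ Real.sqrt (A * ε ^ (-w)) * ‖u‖ :=
  ENNReal.toReal_le_of_le_ofReal (by positivity) (hγ.wnorm_le hε x u)

theorem pot_mollifiedCov (hγ : RegularCov γ w A) {ε : ℝ} (hε : 0 < ε) (x : Space d) (u : L2 d) :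
    pot (mollifiedCov γ ε) u x = ENNReal.ofReal (N γ x u ε ^ 2) := by
  have := hγ.sfinite
  rw [mollifiedCov, pot_withDensity (measurable_mollifiedKernel γ ε), ENNReal.ofReal_pow
    (N_nonneg _ _ _), hγ.ofReal_N hε]

/-- The scales `ε` and `ε'` are linked by a Gaussian of width `δ = √(ε'² - ε²) ≤ 2ε`, while the
weight is at most `A ε^{-w}`. Thus `wnorm_conv_le` gives an error of order `√(A ε^{-w}) · ε = √A
ε^{1-w/2}`. -/
theorem abs_N_sub_le_of_le_two_mul (hγ : RegularCov γ w A) {u : L2 d} {g : V2 d}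
    (hu : HasGrad u g) (x : Space d) {ε ε' : ℝ} (hε : 0 < ε) (h1 : ε ≤ ε') (h2 : ε' ≤ 2 * ε) :
    |N γ x u ε - N γ x u ε'| ≤ (2 * momentConst d * Real.sqrt A * ‖g‖) * ε ^ (1 - w / 2) := by
  have hA := hγ.A_pos
  have hm := momentConst_pos d
  have := hγ.sfinite
  rcases eq_or_lt_of_le h1 with rfl | h1
  · rw [sub_self, abs_zero]; positivity
  have hε' : 0 < ε' := hε.trans h1
  set δ := Real.sqrt (ε' ^ 2 - ε ^ 2) with hδ
  have hδ0 : 0 < δ := Real.sqrt_pos.2 (by nlinarith)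
  have hδ2 : δ ^ 2 = ε' ^ 2 - ε ^ 2 := Real.sq_sqrt (by nlinarith)
  have hδle : δ ≤ 2 * ε := by nlinarith
  have hsg : (fun y => mollifiedKernel γ ε' (x - y)) = fun y =>
      ∫⁻ h, (fun y => mollifiedKernel γ ε (x - y)) (y - h) * gaussE d δ h := by
    ext y
    exact mollifiedKernel_semigroup γ hε hδ0 hε' (by linarith) x y
  have key := wnorm_conv_le (hγ.measurable_shift ε x) (by positivity)
    (fun y => hγ.bound ε _ hε) hδ0 hu
  rw [← hsg, ← hγ.ofReal_N hε, ← hγ.ofReal_N hε'] at key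
  set e := Real.sqrt (A * ε ^ (-w)) * ‖g‖ * (momentConst d * δ) with he
  have he0 : 0 ≤ e := by positivity
  have hNe := N_nonneg (γ := γ) x u ε
  have hNe' := N_nonneg (γ := γ) x u ε'
  rw [← ENNReal.ofReal_add hNe he0, ← ENNReal.ofReal_add hNe' he0,
    ENNReal.ofReal_le_ofReal_iff (by positivity), ENNReal.ofReal_le_ofReal_iff (by positivity)] at key
  have hle : e ≤ (2 * momentConst d * Real.sqrt A * ‖g‖) * ε ^ (1 - w / 2) := by
    have h3 : Real.sqrt (A * ε ^ (-w)) * ε = Real.sqrt A * ε ^ (1 - w / 2) := by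
      rw [Real.sqrt_mul hA.le, mul_assoc, Real.sqrt_eq_rpow (ε ^ (-w)), ← Real.rpow_mul hε.le,
        ← Real.rpow_add_one hε.ne']
      congr 2; ring
    calc e ≤ Real.sqrt (A * ε ^ (-w)) * ‖g‖ * (momentConst d * (2 * ε)) := by rw [he]; gcongr
      _ = (Real.sqrt (A * ε ^ (-w)) * ε) * (2 * momentConst d * ‖g‖) := by ring
      _ = _ := by rw [h3]; ring
  rw [abs_le]
  constructor <;> linarith [key.1, key.2]

/-- The Hölder constant in `abs_N_sub_le`. -/
def holderConst (d : ℕ) (w A : ℝ) : ℝ :=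
  2 * momentConst d * Real.sqrt A / (1 - 2 ^ (-(1 - w / 2)))

theorem holderConst_nonneg (hγ : RegularCov γ w A) : 0 ≤ holderConst d w A := by
  have hm := momentConst_pos d
  have hq : (2 : ℝ) ^ (-(1 - w / 2)) < 1 :=
    Real.rpow_lt_one_of_one_lt_of_neg (by norm_num) (by linarith [hγ.w_lt])
  unfold holderConst
  have : 0 < 1 - (2 : ℝ) ^ (-(1 - w / 2)) := by linarith
  positivity

/-- Dyadic summation of the previous bound. The condition `w < 2` is what makes the exponent `1 -
w/2` positive and the geometric series convergent. -/
theorem abs_N_sub_le (hγ : RegularCov γ w A) {u : L2 d} {g : V2 d}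
    (hu : HasGrad u g) (x : Space d) {ε r : ℝ} (hε : 0 < ε) (hr : ε ≤ r) :
    |N γ x u ε - N γ x u r| ≤ holderConst d w A * ‖g‖ * r ^ (1 - w / 2) := by
  have hm := momentConst_pos d
  have := abs_sub_le_of_abs_sub_le_of_le_two_mul (N := N γ x u) (θ := 1 - w / 2)
    (by linarith [hγ.w_lt]) (D := 2 * momentConst d * Real.sqrt A * ‖g‖) (by positivity)
    (fun ε ε' h0 h1 h2 => hγ.abs_N_sub_le_of_le_two_mul hu x h0 h1 h2) hε hr
  refine this.trans_eq ?_
  unfold holderConst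
  ring

/-- A bound for the potentials at all scales up to `1`. -/
theorem N_le_of_le_one (hγ : RegularCov γ w A) {u : L2 d} {g : V2 d}
    (hu : HasGrad u g) (x : Space d) {ε : ℝ} (hε : 0 < ε) (h1 : ε ≤ 1) :
    N γ x u ε ≤ Real.sqrt A * ‖u‖ + holderConst d w A * ‖g‖ := by
  have i1 := hγ.abs_N_sub_le hu x hε h1
  have i2 := hγ.N_le one_pos x u
  simp only [Real.one_rpow, mul_one] at i1 i2
  linarith [(abs_le.1 i1).2]

/-- The bound on the oscillation of the interaction at scales up to `r`. -/
def oscConst (d : ℕ) (w A : ℝ) (R : ℝ) : ℝ :=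
  2 * (Real.sqrt A * R + holderConst d w A * R) * (holderConst d w A * R) * R ^ 2

/-- Potentials are squares: `N_ε² - N_ε'² = (N_ε - N_ε')(N_ε + N_ε')`, where the sum is bounded at
scales up to `1` and the difference is the Hölder increment. -/
theorem pot_le_pot_add (hγ : RegularCov γ w A) {u : L2 d} {g : V2 d}
    (hu : HasGrad u g) {R : ℝ} (huR : ‖u‖ ≤ R) (hgR : ‖g‖ ≤ R) {ε ε' r : ℝ} (hε : 0 < ε)
    (hε' : 0 < ε') (h : |N γ x u ε - N γ x u ε'| ≤ holderConst d w A * ‖g‖ * r ^ (1 - w / 2))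
    (h1 : ε ≤ 1) (h1' : ε' ≤ 1) (hr : 0 < r) :
    pot (mollifiedCov γ ε) u x ≤ pot (mollifiedCov γ ε') u x +
      ENNReal.ofReal (2 * (Real.sqrt A * R + holderConst d w A * R) * (holderConst d w A * R)
        * r ^ (1 - w / 2)) := by
  have hH := hγ.holderConst_nonneg
  have hR : 0 ≤ R := (norm_nonneg _).trans huR
  rw [hγ.pot_mollifiedCov hε, hγ.pot_mollifiedCov hε', ← ENNReal.ofReal_add (by positivity)
    (by positivity)]
  apply ENNReal.ofReal_le_ofReal
  have b1 := hγ.N_le_of_le_one hu x hε h1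
  have b2 := hγ.N_le_of_le_one hu x hε' h1'
  have n1 := N_nonneg (γ := γ) x u ε
  have n2 := N_nonneg (γ := γ) x u ε'
  set B := Real.sqrt A * R + holderConst d w A * R with hB
  have hBle : Real.sqrt A * ‖u‖ + holderConst d w A * ‖g‖ ≤ B := by rw [hB]; gcongr
  have hle : |N γ x u ε - N γ x u ε'| ≤ holderConst d w A * R * r ^ (1 - w / 2) :=
    h.trans (by gcongr)
  set t := holderConst d w A * R * r ^ (1 - w / 2) with ht
  have ht0 : 0 ≤ t := by positivity
  calc N γ x u ε ^ 2
      = N γ x u ε' ^ 2 + (N γ x u ε - N γ x u ε') * (N γ x u ε + N γ x u ε') := by ring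
    _ ≤ N γ x u ε' ^ 2 + t * (B + B) := by
        gcongr
        · exact (le_abs_self _).trans hle
        · linarith
        · linarith
    _ = _ := by rw [ht]; ring

/-- The potential bounds are uniform in `x`, so they integrate against `u²`. The error depends only
on the larger scale `r`, which later allows `ε → 0` with `r` fixed. -/
theorem interaction_mollified_le (hγ : RegularCov γ w A) {u : L2 d} {g : V2 d}
    (hu : HasGrad u g) {R : ℝ} (huR : ‖u‖ ≤ R) (hgR : ‖g‖ ≤ R) {ε r : ℝ} (hε : 0 < ε)
    (hr : ε ≤ r) (h1 : r ≤ 1) :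
    interaction (mollifiedCov γ ε) u ≤ interaction (mollifiedCov γ r) u +
        ENNReal.ofReal (oscConst d w A R * r ^ (1 - w / 2)) ∧
      interaction (mollifiedCov γ r) u ≤ interaction (mollifiedCov γ ε) u +
        ENNReal.ofReal (oscConst d w A R * r ^ (1 - w / 2)) := by
  have hH := hγ.holderConst_nonneg
  have hR : 0 ≤ R := (norm_nonneg _).trans huR
  have hr0 : 0 < r := hε.trans_le hr
  have h2 : 2 * (Real.sqrt A * R + holderConst d w A * R) * (holderConst d w A * R)
        * r ^ (1 - w / 2) * ‖u‖ ^ 2 ≤ oscConst d w A R * r ^ (1 - w / 2) := by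
    calc _ ≤ 2 * (Real.sqrt A * R + holderConst d w A * R) * (holderConst d w A * R)
        * r ^ (1 - w / 2) * R ^ 2 := by gcongr
      _ = _ := by unfold oscConst; ring
  constructor
  · refine (interaction_le_add_of_pot_le _ (mollifiedCov γ r) u (by positivity) fun x =>
      hγ.pot_le_pot_add hu huR hgR hε hr0 (hγ.abs_N_sub_le hu x hε hr) (hr.trans h1) h1 hr0).trans ?_
    gcongr
  · refine (interaction_le_add_of_pot_le _ (mollifiedCov γ ε) u (by positivity) fun x =>
      hγ.pot_le_pot_add hu huR hgR hr0 hε (by rw [abs_sub_comm]; exact hγ.abs_N_sub_le hu x hε hr)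
        h1 (hr.trans h1) hr0).trans ?_
    gcongr

/-- Potentials are form bounded with arbitrarily small relative bound, uniformly in the scale. -/
theorem exists_N_sq_le (hγ : RegularCov γ w A) {τ : ℝ} (hτ : 0 < τ) :
    ∃ C : ℝ, 0 ≤ C ∧ ∀ (u : L2 d) (g : V2 d), HasGrad u g → ∀ ε x, 0 < ε →
      N γ x u ε ^ 2 ≤ C * ‖u‖ ^ 2 + τ * ‖g‖ ^ 2 := by
  have hA := hγ.A_pos
  have hH := hγ.holderConst_nonneg
  have hθ : 0 < 1 - w / 2 := by linarith [hγ.w_lt]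
  -- The threshold scale: below `r` the Hölder increment costs at most `τ ‖g‖²`, the factor `2`
  -- coming from `(a + b)² ≤ 2a² + 2b²`. Above `r` the kernel itself is bounded by `A r^{-w}`.
  obtain ⟨r, hr, hrτ⟩ : ∃ r : ℝ, 0 < r ∧ 2 * (holderConst d w A * r ^ (1 - w / 2)) ^ 2 ≤ τ := by
    have hc : Tendsto (fun r : ℝ => 2 * (holderConst d w A * r ^ (1 - w / 2)) ^ 2) (𝓝[>] 0)
        (𝓝 (2 * (holderConst d w A * 0 ^ (1 - w / 2)) ^ 2)) := by
      have : ContinuousAt (fun r : ℝ => r ^ (1 - w / 2)) 0 :=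
        Real.continuousAt_rpow_const _ _ (Or.inr hθ.le)
      exact ((((this.tendsto.const_mul _).pow 2).const_mul 2).mono_left nhdsWithin_le_nhds)
    rw [Real.zero_rpow hθ.ne', mul_zero, zero_pow two_ne_zero, mul_zero] at hc
    have h1 := (hc.eventually (gt_mem_nhds hτ)).and self_mem_nhdsWithin
    obtain ⟨r, hr1, hr2⟩ := h1.exists
    exact ⟨r, hr2, hr1.le⟩
  refine ⟨2 * (A * r ^ (-w)), by positivity, fun u g hu ε x hε => ?_⟩
  have hN := N_nonneg (γ := γ) x u ε
  rcases le_total ε r with h | h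
  · have i1 := (abs_le.1 (hγ.abs_N_sub_le hu x hε h)).2
    have i2 := hγ.N_le hr x u
    have hs : Real.sqrt (A * r ^ (-w)) ^ 2 = A * r ^ (-w) := Real.sq_sqrt (by positivity)
    set s := Real.sqrt (A * r ^ (-w))
    calc N γ x u ε ^ 2 ≤ (s * ‖u‖ + holderConst d w A * ‖g‖ * r ^ (1 - w / 2)) ^ 2 := by
          gcongr; linarith
      _ ≤ 2 * (s * ‖u‖) ^ 2 + 2 * (holderConst d w A * ‖g‖ * r ^ (1 - w / 2)) ^ 2 := by
          nlinarith [sq_nonneg (s * ‖u‖ - holderConst d w A * ‖g‖ * r ^ (1 - w / 2))]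
      _ = 2 * s ^ 2 * ‖u‖ ^ 2 + 2 * (holderConst d w A * r ^ (1 - w / 2)) ^ 2 * ‖g‖ ^ 2 := by ring
      _ ≤ 2 * s ^ 2 * ‖u‖ ^ 2 + τ * ‖g‖ ^ 2 := by gcongr
      _ = _ := by rw [hs]
  · calc N γ x u ε ^ 2 ≤ (Real.sqrt (A * ε ^ (-w)) * ‖u‖) ^ 2 := by
          gcongr; exact hγ.N_le hε x u
      _ = A * ε ^ (-w) * ‖u‖ ^ 2 := by rw [mul_pow, Real.sq_sqrt (by positivity)]
      _ ≤ A * r ^ (-w) * ‖u‖ ^ 2 := by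
          gcongr A * ?_ * ‖u‖ ^ 2
          exact Real.rpow_le_rpow_of_nonpos hr h (by linarith [hγ.w_pos])
      _ ≤ _ := by
          have : 0 ≤ A * r ^ (-w) * ‖u‖ ^ 2 := by positivity
          nlinarith [mul_nonneg hτ.le (sq_nonneg ‖g‖)]

end RegularCov

end Regular

/-! ### Removing the mollification -/

section ZeroScale

variable {d : ℕ}

theorem le_gaussianKernel {ε ρ : ℝ} {z : Space d} (hz : ‖z‖ ≤ ρ) :
    Real.exp (-ρ ^ 2 / (2 * ε ^ 2)) / (2 * Real.pi * ε ^ 2) ^ ((d : ℝ) / 2) ≤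
      gaussianKernel d ε z := by
  unfold gaussianKernel
  gcongr

/-- On the ball the Gaussian weight is at least its value at distance `ρ`, by which the bound is
divided. -/
theorem setLIntegral_closedBall_le {f : Space d → ℝ≥0∞} {ε ρ b : ℝ} (hε : 0 < ε)
    {x : Space d} (h : ∫⁻ y, gaussE d ε (x - y) * f y ≤ ENNReal.ofReal b) :
    ∫⁻ y in Metric.closedBall x ρ, f y ≤ ENNReal.ofReal
      (Real.exp (ρ ^ 2 / (2 * ε ^ 2)) * (2 * Real.pi * ε ^ 2) ^ ((d : ℝ) / 2) * b) := by
  set D := (2 * Real.pi * ε ^ 2) ^ ((d : ℝ) / 2) with hD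
  have hD0 : 0 < D := by positivity
  set c := Real.exp (-ρ ^ 2 / (2 * ε ^ 2)) / D with hc
  have hc0 : 0 < c := by positivity
  have hinv : Real.exp (ρ ^ 2 / (2 * ε ^ 2)) * D = c⁻¹ := by
    rw [hc, inv_div, neg_div, Real.exp_neg]
    field_simp
  rw [hinv, ENNReal.ofReal_mul (by positivity), ENNReal.ofReal_inv_of_pos hc0,
    ← ENNReal.div_eq_inv_mul, ENNReal.le_div_iff_mul_le (by simp [hc0]) (by simp), mul_comm,
    ← lintegral_const_mul' _ _ ENNReal.ofReal_ne_top]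
  refine le_trans ?_ h
  refine le_trans ?_ (setLIntegral_le_lintegral (Metric.closedBall x ρ) _)
  apply setLIntegral_mono' Metric.isClosed_closedBall.measurableSet
  intro y hy
  gcongr
  apply ENNReal.ofReal_le_ofReal
  apply le_gaussianKernel
  rwa [← dist_eq_norm, dist_comm]

/-- The Gaussian of width `ε` dominates a fixed multiple of the normalized indicator of the ball of
radius `ε`. So averages of `f` over small balls are bounded, and Lebesgue differentiation passes the
bound to `f`. -/
theorem exists_ae_le_of_lintegral_gaussE_mul_le {f : Space d → ℝ≥0∞} (hf : Measurable f) {b : ℝ}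
    (hb : 0 ≤ b)
    (h : ∀ x ε, 0 < ε → ε ≤ 1 → ∫⁻ y, gaussE d ε (x - y) * f y ≤ ENNReal.ofReal b) :
    ∃ c : ℝ, 0 ≤ c ∧ ∀ᵐ x, f x ≤ ENNReal.ofReal c := by
  set v : ℝ := (volume (Metric.ball (0 : Space d) 1)).toReal with hv
  have hv0 : 0 < v := ENNReal.toReal_pos (Metric.measure_ball_pos _ _ one_pos).ne'
    measure_ball_lt_top.ne
  set K : ℝ := Real.exp (1 / 2) * (2 * Real.pi) ^ ((d : ℝ) / 2) * b with hK
  have hK0 : 0 ≤ K := by positivity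
  refine ⟨K / v, by positivity, ?_⟩
  have havg : ∀ x ε, 0 < ε → ε ≤ 1 → (∫⁻ y in Metric.closedBall x ε, f y) /
      volume (Metric.closedBall x ε) ≤ ENNReal.ofReal (K / v) := by
    intro x ε hε h1
    have e1 := setLIntegral_closedBall_le (ρ := ε) hε (h x ε hε h1)
    have e2 : Real.exp (ε ^ 2 / (2 * ε ^ 2)) * (2 * Real.pi * ε ^ 2) ^ ((d : ℝ) / 2) * b =
        ε ^ d * K := by
      have : ε ^ 2 / (2 * ε ^ 2) = 1 / 2 := by field_simp
      rw [this, Real.mul_rpow (by positivity) (by positivity), ← Real.rpow_natCast ε 2,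
        ← Real.rpow_mul hε.le]
      have : ((2 : ℕ) : ℝ) * ((d : ℝ) / 2) = d := by push_cast; ring
      rw [this, Real.rpow_natCast, hK]
      ring
    rw [e2] at e1
    rw [Measure.addHaar_closedBall _ _ hε.le, finrank_euclideanSpace, Fintype.card_fin,
      ← ENNReal.ofReal_toReal (a := volume (Metric.ball (0 : Space d) 1)) measure_ball_lt_top.ne,
      ← hv, ← ENNReal.ofReal_mul (by positivity)]
    refine (ENNReal.div_le_div_right e1 _).trans ?_
    rw [← ENNReal.ofReal_div_of_pos (by positivity)]
    apply ENNReal.ofReal_le_ofReal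
    rw [mul_div_mul_left _ _ (by positivity)]
  -- The differentiation theorem is applied to functions of finite integral, hence the restriction
  -- to balls of radius `n`, whose integrals are controlled by the scale `1`.
  have hae : ∀ᵐ x, ∀ n : ℕ, (Metric.ball (0 : Space d) n).indicator f x ≤ ENNReal.ofReal (K / v) := by
    rw [ae_all_iff]
    intro n
    have hfin : ∫⁻ y, (Metric.ball (0 : Space d) n).indicator f y ≠ ⊤ := by
      rw [lintegral_indicator Metric.isOpen_ball.measurableSet]
      refine ((lintegral_mono_set Metric.ball_subset_closedBall).trans
        (setLIntegral_closedBall_le (ρ := n) one_pos (h 0 1 one_pos le_rfl))).trans_lt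
        ENNReal.ofReal_lt_top |>.ne
    filter_upwards [(Besicovitch.vitaliFamily (volume : Measure (Space d))).ae_tendsto_lintegral_div
      (hf.indicator Metric.isOpen_ball.measurableSet).aemeasurable hfin] with x hx
    have hx2 := hx.comp (Besicovitch.tendsto_filterAt (volume : Measure (Space d)) x)
    refine le_of_tendsto hx2 ?_
    have : Set.Ioc (0 : ℝ) 1 ∈ 𝓝[>] (0 : ℝ) := Ioc_mem_nhdsGT one_pos
    filter_upwards [this] with ε hε
    refine le_trans ?_ (havg x ε hε.1 hε.2)
    simp only [Function.comp]
    gcongr with y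
    exact Set.indicator_le_self _ _ y
  filter_upwards [hae] with x hx
  obtain ⟨n, hn⟩ := exists_nat_gt ‖x‖
  have := hx n
  rwa [Set.indicator_of_mem (by simpa using hn)] at this

namespace RegularCov

variable {γ : Measure (Space d)} {w A : ℝ}

/-- Associativity of convolution: `p_ε * (γ * u²) = γ_ε * u²`. -/
theorem lintegral_gaussE_mul_pot (hγ : RegularCov γ w A) (ε : ℝ) (u : L2 d) (x : Space d) :
    ∫⁻ y, gaussE d ε (x - y) * pot γ u y = pot (mollifiedCov γ ε) u x := by
  have := hγ.sfinite
  have hu := measurable_coe u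
  have hm := measurable_mollifiedKernel γ ε
  rw [pot, mollifiedCov, lintegral_withDensity_eq_lintegral_mul _ hm (by fun_prop)]
  simp only [Pi.mul_apply, pot]
  simp_rw [mollifiedKernel_eq]
  have e1 : ∀ y, gaussE d ε (x - y) * ∫⁻ z, ‖u (y - z)‖ₑ ^ 2 ∂γ =
      ∫⁻ z, gaussE d ε (x - y) * ‖u (y - z)‖ₑ ^ 2 ∂γ := fun y => by
    rw [lintegral_const_mul _ (by fun_prop)]
  have e2 : ∀ y, (∫⁻ z, gaussE d ε (y - z) ∂γ) * ‖u (x - y)‖ₑ ^ 2 =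
      ∫⁻ z, gaussE d ε (y - z) * ‖u (x - y)‖ₑ ^ 2 ∂γ := fun y => by
    rw [lintegral_mul_const _ (by fun_prop)]
  simp_rw [e1, e2]
  conv_lhs => rw [lintegral_lintegral_swap (by fun_prop)]
  conv_rhs => rw [lintegral_lintegral_swap (by fun_prop)]
  congr 1; ext z
  rw [← lintegral_sub_left_eq_self (fun y => gaussE d ε (y - z) * ‖u (x - y)‖ₑ ^ 2) (x + z)]
  congr 1; ext y
  have h1 : x + z - y - z = x - y := by abel
  have h2 : x - (x + z - y) = y - z := by abel
  rw [h1, h2]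

/-- The Gaussian averages of `γ * u²` are the mollified potentials, which are bounded uniformly in
the point and in `ε ≤ 1`. -/
theorem exists_ae_pot_le (hγ : RegularCov γ w A) {u : L2 d} {g : V2 d} (hu : HasGrad u g) :
    ∃ c : ℝ, 0 ≤ c ∧ ∀ᵐ x, pot γ u x ≤ ENNReal.ofReal c := by
  have := hγ.sfinite
  apply exists_ae_le_of_lintegral_gaussE_mul_le (measurable_pot γ (measurable_coe u))
    (b := (Real.sqrt A * ‖u‖ + holderConst d w A * ‖g‖) ^ 2) (by positivity)
  intro x ε hε h1
  rw [hγ.lintegral_gaussE_mul_pot, hγ.pot_mollifiedCov hε]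
  apply ENNReal.ofReal_le_ofReal
  have := N_nonneg (γ := γ) x u ε
  gcongr
  exact hγ.N_le_of_le_one hu x hε h1

/-- With `ρ = γ * u²`, the interactions of `γ_ε` and `γ` are half the squared norms of `u` with
weights `ρ * p_ε` and `ρ`. The weight `ρ` is bounded, so `wnorm_conv_le` squeezes one norm between
translates of the other by `O(ε)`. -/
theorem tendsto_interaction (hγ : RegularCov γ w A) {u : L2 d} {g : V2 d} (hu : HasGrad u g) :
    Tendsto (fun ε => interaction (mollifiedCov γ ε) u) (𝓝[>] 0) (𝓝 (interaction γ u)) := by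
  have := hγ.sfinite
  have hum := measurable_coe u
  obtain ⟨c, hc, hpot⟩ := hγ.exists_ae_pot_le hu
  -- The cutoff changes the potential only on a null set and makes its bound hold at every point, as
  -- `wnorm_conv_le` requires.
  set ρ : Space d → ℝ≥0∞ := fun x => min (pot γ u x) (ENNReal.ofReal c) with hρ
  have hρm : Measurable ρ := (measurable_pot γ hum).min measurable_const
  have hρae : ∀ᵐ x, ρ x = pot γ u x := by
    filter_upwards [hpot] with x hx
    exact min_eq_left hx
  have hρb : ∀ y, ρ y ≤ ENNReal.ofReal c := fun y => min_le_right _ _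
  have e0 : interaction γ u = 2⁻¹ * wnorm ρ u ^ 2 := by
    rw [interaction_eq, wnorm_sq hρm]
    congr 1
    apply lintegral_congr_ae
    filter_upwards [hρae] with x hx
    rw [hx, mul_comm]
  have e1 : ∀ ε, interaction (mollifiedCov γ ε) u =
      2⁻¹ * wnorm (fun y => ∫⁻ h, ρ (y - h) * gaussE d ε h) u ^ 2 := by
    intro ε
    have hm : Measurable fun y => ∫⁻ h, ρ (y - h) * gaussE d ε h :=
      Measurable.lintegral_prod_right'
        (f := fun p : Space d × Space d => ρ (p.1 - p.2) * gaussE d ε p.2) (by fun_prop)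
    rw [interaction_eq, wnorm_sq hm]
    congr 2; ext x
    rw [mul_comm]
    congr 1
    rw [← hγ.lintegral_gaussE_mul_pot,
      ← lintegral_sub_left_eq_self (fun h => ρ (x - h) * gaussE d ε h) x]
    apply lintegral_congr_ae
    filter_upwards [hρae] with y hy
    rw [sub_sub_cancel, hy, mul_comm]
  simp_rw [e0, e1]
  refine ENNReal.Tendsto.const_mul ?_ (Or.inr (by norm_num))
  refine ((ENNReal.continuous_pow 2).tendsto _).comp ?_
  set s : ℝ → ℝ≥0∞ := fun ε => ENNReal.ofReal (Real.sqrt c * ‖g‖ * (momentConst d * ε)) with hs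
  have hs0 : Tendsto s (𝓝[>] 0) (𝓝 0) := by
    have : Tendsto s (𝓝 0) (𝓝 (s 0)) := by
      apply Continuous.tendsto
      exact ENNReal.continuous_ofReal.comp (by fun_prop)
    simp only [hs, mul_zero, ENNReal.ofReal_zero] at this
    exact this.mono_left nhdsWithin_le_nhds
  have hfin : wnorm ρ u ≠ ⊤ := ((PAM.wnorm_le hρm hc hρb u).trans_lt ENNReal.ofReal_lt_top).ne
  have hl : Tendsto (fun ε => wnorm ρ u - s ε) (𝓝[>] 0) (𝓝 (wnorm ρ u)) := by
    have := ENNReal.Tendsto.sub (tendsto_const_nhds (x := wnorm ρ u) (f := 𝓝[>] (0 : ℝ))) hs0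
      (Or.inl hfin)
    simpa using this
  have hr : Tendsto (fun ε => wnorm ρ u + s ε) (𝓝[>] 0) (𝓝 (wnorm ρ u)) := by
    simpa using (tendsto_const_nhds (x := wnorm ρ u) (f := 𝓝[>] (0 : ℝ))).add hs0
  refine tendsto_of_tendsto_of_tendsto_of_le_of_le' hl hr ?_ ?_
  · filter_upwards [self_mem_nhdsWithin] with ε hε
    exact tsub_le_iff_right.2 (wnorm_conv_le hρm hc hρb hε hu).2
  · filter_upwards [self_mem_nhdsWithin] with ε hε
    exact (wnorm_conv_le hρm hc hρb hε hu).1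

end RegularCov

/-- The covariance at scale `ε`, which is `γ` itself for `ε ≤ 0`. -/
def scaledCov (γ : Measure (Space d)) (ε : ℝ) : Measure (Space d) :=
  if 0 < ε then mollifiedCov γ ε else γ

theorem scaledCov_of_pos (γ : Measure (Space d)) {ε : ℝ} (hε : 0 < ε) :
    scaledCov γ ε = mollifiedCov γ ε := if_pos hε

theorem scaledCov_zero (γ : Measure (Space d)) : scaledCov γ 0 = γ := if_neg (lt_irrefl _)

/-- The properties of a measure `μ` used in the compactness argument for the associated
variational problem. -/
structure Tame (μ : Measure (Space d)) : Prop where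
  sfinite : SFinite μ
  coercive : ∀ τ : ℝ, 0 < τ → ∃ C : ℝ, 0 ≤ C ∧ ∀ (u : L2 d) (g : V2 d), HasGrad u g →
    interaction μ u ≤ ENNReal.ofReal ((C * ‖u‖ ^ 2 + τ * ‖g‖ ^ 2) * ‖u‖ ^ 2)
  approx : ∀ R η : ℝ, 0 < η → ∃ (k : Space d → ℝ≥0∞) (S ρ : ℝ), Measurable k ∧ 0 ≤ S ∧
    (∀ x, k x ≤ ENNReal.ofReal S) ∧ (∀ x, ρ < ‖x‖ → k x = 0) ∧
    ∀ (u : L2 d) (g : V2 d), HasGrad u g → ‖u‖ ≤ R → ‖g‖ ≤ R →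
      interaction μ u ≤ interaction (volume.withDensity k) u + ENNReal.ofReal η ∧
      interaction (volume.withDensity k) u ≤ interaction μ u + ENNReal.ofReal η

namespace RegularCov

variable {γ : Measure (Space d)} {w A : ℝ}

theorem interaction_scaledCov_le (hγ : RegularCov γ w A) {u : L2 d} {g : V2 d}
    (hu : HasGrad u g) {R : ℝ} (huR : ‖u‖ ≤ R) (hgR : ‖g‖ ≤ R) {ε r : ℝ} (hr0 : 0 < r)
    (hr : ε ≤ r) (h1 : r ≤ 1) :
    interaction (scaledCov γ ε) u ≤ interaction (mollifiedCov γ r) u +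
        ENNReal.ofReal (oscConst d w A R * r ^ (1 - w / 2)) ∧
      interaction (mollifiedCov γ r) u ≤ interaction (scaledCov γ ε) u +
        ENNReal.ofReal (oscConst d w A R * r ^ (1 - w / 2)) := by
  by_cases hε : 0 < ε
  · rw [scaledCov_of_pos γ hε]
    exact hγ.interaction_mollified_le hu huR hgR hε hr h1
  · rw [scaledCov, if_neg hε]
    have hlim := hγ.tendsto_interaction hu
    have hmem : Set.Ioc (0 : ℝ) r ∈ 𝓝[>] (0 : ℝ) := Ioc_mem_nhdsGT hr0
    constructor
    · refine le_of_tendsto hlim ?_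
      filter_upwards [hmem] with ε hε
      exact (hγ.interaction_mollified_le hu huR hgR hε.1 hε.2 h1).1
    · refine ge_of_tendsto (hlim.add_const _) ?_
      filter_upwards [hmem] with ε hε
      exact (hγ.interaction_mollified_le hu huR hgR hε.1 hε.2 h1).2

/-- The interaction is dominated by the kinetic energy, uniformly in the scale. -/
theorem exists_interaction_scaledCov_le (hγ : RegularCov γ w A) {τ : ℝ} (hτ : 0 < τ) :
    ∃ C : ℝ, 0 ≤ C ∧ ∀ (u : L2 d) (g : V2 d), HasGrad u g → ∀ ε,
      interaction (scaledCov γ ε) u ≤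
        ENNReal.ofReal ((C * ‖u‖ ^ 2 + τ * ‖g‖ ^ 2) * ‖u‖ ^ 2) := by
  obtain ⟨C, hC, h⟩ := hγ.exists_N_sq_le hτ
  have key : ∀ (u : L2 d) (g : V2 d), HasGrad u g → ∀ ε, 0 < ε →
      interaction (mollifiedCov γ ε) u ≤
        ENNReal.ofReal ((C * ‖u‖ ^ 2 + τ * ‖g‖ ^ 2) * ‖u‖ ^ 2) := by
    intro u g hu ε hε
    refine (interaction_le_of_pot_le (mollifiedCov γ ε) u (c := C * ‖u‖ ^ 2 + τ * ‖g‖ ^ 2)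
      (by positivity) (ae_of_all _ fun x => ?_)).trans ?_
    · rw [hγ.pot_mollifiedCov hε]
      exact ENNReal.ofReal_le_ofReal (h u g hu ε x hε)
    · apply ENNReal.ofReal_le_ofReal
      have : 0 ≤ (C * ‖u‖ ^ 2 + τ * ‖g‖ ^ 2) * ‖u‖ ^ 2 := by positivity
      linarith
  refine ⟨C, hC, fun u g hu ε => ?_⟩
  by_cases hε : 0 < ε
  · rw [scaledCov_of_pos γ hε]
    exact key u g hu ε hε
  · rw [scaledCov, if_neg hε]
    refine le_of_tendsto (hγ.tendsto_interaction hu) ?_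
    filter_upwards [self_mem_nhdsWithin] with ε hε
    exact key u g hu ε hε

/-- Outside a large ball the kernel is at most `η'`, so discarding it costs at most `η' ‖u‖⁴`. -/
theorem exists_truncation (hγ : RegularCov γ w A) {r : ℝ} (hr : 0 < r) (R : ℝ) {η : ℝ}
    (hη : 0 < η) : ∃ (k : Space d → ℝ≥0∞) (S ρ : ℝ), Measurable k ∧ 0 ≤ S ∧
    (∀ x, k x ≤ ENNReal.ofReal S) ∧ (∀ x, ρ < ‖x‖ → k x = 0) ∧
    ∀ u : L2 d, ‖u‖ ≤ R →
      interaction (mollifiedCov γ r) u ≤ interaction (volume.withDensity k) u + ENNReal.ofReal η ∧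
      interaction (volume.withDensity k) u ≤ interaction (mollifiedCov γ r) u := by
  have := hγ.sfinite
  have hA := hγ.A_pos
  have hm := measurable_mollifiedKernel γ r
  -- The fourth power matches the degree of the interaction; the added `1` keeps the denominator
  -- positive.
  set η' := η / (1 + R ^ 4) with hη'
  have hη'0 : 0 < η' := by positivity
  obtain ⟨ρ, hρ⟩ := hγ.decay r hr η' hη'0
  set k : Space d → ℝ≥0∞ := (Metric.closedBall 0 ρ).indicator (mollifiedKernel γ r) with hk
  have hkm : Measurable k := hm.indicator Metric.isClosed_closedBall.measurableSet
  have hkle : ∀ x, k x ≤ mollifiedKernel γ r x := fun x => Set.indicator_le_self _ _ x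
  have hlek : ∀ x, mollifiedKernel γ r x ≤ k x + ENNReal.ofReal η' := by
    intro x
    by_cases hx : x ∈ Metric.closedBall (0 : Space d) ρ
    · rw [hk, Set.indicator_of_mem hx]
      exact le_self_add
    · refine (hρ x ?_).trans le_add_self
      simpa using hx
  refine ⟨k, A * r ^ (-w), ρ, hkm, by positivity, fun x => (hkle x).trans (hγ.bound r x hr),
    fun x hx => Set.indicator_of_notMem (by simpa using hx) _, fun u huR => ⟨?_, ?_⟩⟩
  · have hum := measurable_coe u
    refine (interaction_le_add_of_pot_le _ (volume.withDensity k) u (c := η' * ‖u‖ ^ 2)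
      (by positivity) fun x => ?_).trans ?_
    · rw [pot, pot, mollifiedCov, lintegral_withDensity_eq_lintegral_mul _ hm (by fun_prop),
        lintegral_withDensity_eq_lintegral_mul _ hkm (by fun_prop),
        ENNReal.ofReal_mul hη'0.le, ← lintegral_enorm_sq,
        ← lintegral_sub_left_eq_self (fun y => ‖u y‖ₑ ^ 2) x,
        ← lintegral_const_mul _ (by fun_prop), ← lintegral_add_right _ (by fun_prop)]
      apply lintegral_mono
      intro z
      simp only [Pi.mul_apply]
      rw [← add_mul]
      gcongr
      exact hlek z
    · gcongr
      have hR : 0 ≤ R := (norm_nonneg _).trans huR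
      calc η' * ‖u‖ ^ 2 * ‖u‖ ^ 2 ≤ η' * R ^ 2 * R ^ 2 := by gcongr
        _ = η' * R ^ 4 := by ring
        _ ≤ η' * (1 + R ^ 4) := by gcongr; linarith
        _ = η := by rw [hη']; field_simp
  · rw [interaction_eq, interaction_eq]
    gcongr with x
    unfold pot
    apply lintegral_mono'
    · exact withDensity_mono (ae_of_all _ hkle)
    · exact le_rfl

/-- At scale zero the kernel is unbounded or a point mass, so it is first replaced by a
mollification at a small scale `r` and then truncated, each at a cost of `η / 2`. At a positive
scale truncation suffices. -/
theorem tame_scaledCov (hγ : RegularCov γ w A) {ε : ℝ} (hε : 0 ≤ ε) : Tame (scaledCov γ ε) := by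
  have hs := hγ.sfinite
  refine ⟨?_, ?_, ?_⟩
  · unfold scaledCov
    split_ifs
    · exact sfinite_mollifiedCov γ ε
    · exact hs
  · intro τ hτ
    obtain ⟨C, hC, h⟩ := hγ.exists_interaction_scaledCov_le hτ
    exact ⟨C, hC, fun u g hu => h u g hu ε⟩
  · intro R η hη
    rcases eq_or_lt_of_le hε with rfl | hε
    · have hθ : 0 < 1 - w / 2 := by linarith [hγ.w_lt]
      obtain ⟨r, hr, hr1, hrη⟩ : ∃ r : ℝ, 0 < r ∧ r ≤ 1 ∧
          oscConst d w A R * r ^ (1 - w / 2) ≤ η / 2 := by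
        have hc : Tendsto (fun r : ℝ => oscConst d w A R * r ^ (1 - w / 2)) (𝓝[>] 0)
            (𝓝 (oscConst d w A R * 0 ^ (1 - w / 2))) := by
          have : ContinuousAt (fun r : ℝ => r ^ (1 - w / 2)) 0 :=
            Real.continuousAt_rpow_const _ _ (Or.inr hθ.le)
          exact (this.tendsto.const_mul _).mono_left nhdsWithin_le_nhds
        rw [Real.zero_rpow hθ.ne', mul_zero] at hc
        have h1 := (hc.eventually (gt_mem_nhds (half_pos hη))).and (Ioc_mem_nhdsGT one_pos)
        obtain ⟨r, hr1, hr2⟩ := h1.exists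
        exact ⟨r, hr2.1, hr2.2, hr1.le⟩
      obtain ⟨k, S, ρ, hk, hS, hkS, hkρ, h⟩ := hγ.exists_truncation hr R (half_pos hη)
      refine ⟨k, S, ρ, hk, hS, hkS, hkρ, fun u g hu huR hgR => ?_⟩
      have i1 := hγ.interaction_scaledCov_le hu huR hgR hr hr.le hr1
      have i2 := h u huR
      have i3 : ENNReal.ofReal (oscConst d w A R * r ^ (1 - w / 2)) ≤ ENNReal.ofReal (η / 2) :=
        ENNReal.ofReal_le_ofReal hrη
      have i4 : ENNReal.ofReal η = ENNReal.ofReal (η / 2) + ENNReal.ofReal (η / 2) := by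
        rw [← ENNReal.ofReal_add (by linarith) (by linarith), add_halves]
      constructor
      · calc _ ≤ _ := i1.1
          _ ≤ interaction (volume.withDensity k) u + ENNReal.ofReal (η / 2)
              + ENNReal.ofReal (η / 2) := add_le_add i2.1 i3
          _ = _ := by rw [i4, add_assoc]
      · calc _ ≤ _ := i2.2
          _ ≤ _ := i1.2
          _ ≤ _ := by
            gcongr
            exact hrη.trans (by linarith)
    · rw [scaledCov_of_pos γ hε]
      obtain ⟨k, S, ρ, hk, hS, hkS, hkρ, h⟩ := hγ.exists_truncation hε R hη
      exact ⟨k, S, ρ, hk, hS, hkS, hkρ, fun u g _ huR _ =>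
        ⟨(h u huR).1, (h u huR).2.trans le_self_add⟩⟩

end RegularCov

end ZeroScale

/-! ### Local compactness -/

section LocalCompactness

variable {d : ℕ}

/-- Sequential Banach–Alaoglu in the dual of a separable space, transported through the Riesz
isomorphism. -/
theorem exists_weakly_convergent_subseq {H : Type*} [NormedAddCommGroup H] [InnerProductSpace ℝ H]
    [CompleteSpace H] [TopologicalSpace.SeparableSpace H] {x : ℕ → H} {R : ℝ}
    (hx : ∀ n, ‖x n‖ ≤ R) : ∃ (a : H) (φ : ℕ → ℕ), StrictMono φ ∧
      ∀ y, Tendsto (fun n => inner ℝ y (x (φ n))) atTop (𝓝 (inner ℝ y a)) := by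
  have hcpt := WeakDual.isSeqCompact_closedBall ℝ H (0 : StrongDual ℝ H) R
  obtain ⟨a, -, φ, hφ, hlim⟩ := hcpt
    (x := fun n => StrongDual.toWeakDual (InnerProductSpace.toDual ℝ H (x n))) (fun n => by
      simpa using hx n)
  refine ⟨(InnerProductSpace.toDual ℝ H).symm (WeakDual.toStrongDual a), φ, hφ, fun y => ?_⟩
  have h1 := ((WeakDual.eval_continuous (𝕜 := ℝ) y).tendsto a).comp hlim
  rw [real_inner_comm, InnerProductSpace.toDual_symm_apply]
  refine h1.congr fun n => ?_
  rw [real_inner_comm]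
  rfl

theorem sq_lintegral_le_lintegral_sq {P : Measure (Space d)} [IsProbabilityMeasure P]
    {F : Space d → ℝ≥0∞} (hF : AEMeasurable F P) : (∫⁻ h, F h ∂P) ^ 2 ≤ ∫⁻ h, F h ^ 2 ∂P := by
  have := ENNReal.lintegral_mul_le_Lp_mul_Lq P (p := 2) (q := 2) ⟨by norm_num, by norm_num, by norm_num⟩
    hF (aemeasurable_const (b := 1))
  simp only [Pi.mul_apply, mul_one, ENNReal.rpow_ofNat, one_pow, lintegral_const, measure_univ,
    ENNReal.one_rpow] at this
  calc (∫⁻ h, F h ∂P) ^ 2 ≤ ((∫⁻ h, F h ^ 2 ∂P) ^ (1 / 2 : ℝ)) ^ 2 := by gcongr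
    _ = _ := by rw [← ENNReal.rpow_natCast, ← ENNReal.rpow_mul]; simp

theorem memLp_gaussianKernel_sub {δ : ℝ} (hδ : 0 < δ) (x : Space d) :
    MemLp (fun y => gaussianKernel d δ (x - y)) 2 volume := by
  have h1 : Integrable (fun y => gaussianKernel d δ (x - y)) :=
    (integrable_gaussianKernel hδ).comp_sub_left x
  have hc : Continuous (fun y => gaussianKernel d δ (x - y)) :=
    (continuous_gaussianKernel δ).comp (by fun_prop)
  rw [memLp_two_iff_integrable_sq hc.aestronglyMeasurable]
  refine (h1.const_mul (1 / (2 * Real.pi * δ ^ 2) ^ ((d : ℝ) / 2))).mono'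
    (hc.pow 2).aestronglyMeasurable (ae_of_all _ fun y => ?_)
  rw [Real.norm_of_nonneg (by positivity), sq]
  exact mul_le_mul_of_nonneg_right (gaussianKernel_le _ _) (gaussianKernel_nonneg _ _)

theorem norm_toLp_gaussianKernel_sub {δ : ℝ} (hδ : 0 < δ) (x : Space d) :
    ‖(memLp_gaussianKernel_sub hδ x).toLp _‖ = ‖(memLp_gaussianKernel_sub hδ (0 : Space d)).toLp _‖ := by
  rw [Lp.norm_toLp, Lp.norm_toLp]
  congr 1
  have := eLpNorm_comp_measurePreserving (p := 2) (g := fun y => gaussianKernel d δ (0 - y))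
    (f := fun y => y - x) (memLp_gaussianKernel_sub hδ (0 : Space d)).1
    (measurePreserving_sub_right volume x)
  rw [← this]
  congr 1; ext y
  simp

/-- The mollification of `u` at scale `δ`. -/
def mollify (δ : ℝ) (u : L2 d) (x : Space d) : ℝ := ∫ y, gaussianKernel d δ (x - y) * u y

/-- As an inner product, the mollification at a point passes to weak limits. The vector paired with
`u` has norm independent of `x`, which provides the domination. -/
theorem mollify_eq_inner {δ : ℝ} (hδ : 0 < δ) (u : L2 d) (x : Space d) :
    mollify δ u x = inner ℝ ((memLp_gaussianKernel_sub hδ x).toLp _) u := by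
  rw [inner_toLp_eq_integral, mollify]
  congr 1; ext y
  simp [mul_comm]

theorem measurable_mollify (δ : ℝ) (u : L2 d) : Measurable (mollify δ u) := by
  have hu := measurable_coe u
  have hg := (continuous_gaussianKernel (d := d) δ).measurable
  have : Measurable fun p : Space d × Space d => gaussianKernel d δ (p.1 - p.2) * u p.2 := by
    fun_prop
  exact this.stronglyMeasurable.integral_prod_right'.measurable

theorem enorm_sub_mollify_sq_le {δ : ℝ} (hδ : 0 < δ) (u : L2 d) (x : Space d) :
    ‖u x - mollify δ u x‖ₑ ^ 2 ≤ ∫⁻ h, gaussE d δ h * ‖u x - u (x - h)‖ₑ ^ 2 := by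
  have hu := measurable_coe u
  have hP := isProbabilityMeasure_gaussMeasure (d := d) hδ
  have i1 : Integrable fun y => gaussianKernel d δ (x - y) * u y :=
    (memLp_gaussianKernel_sub hδ x).integrable_mul (Lp.memLp u)
  have i2 : Integrable fun h => gaussianKernel d δ h * u (x - h) := by
    have := i1.comp_sub_left x
    simpa using this
  have e1 : u x - mollify δ u x = ∫ h, gaussianKernel d δ h * (u x - u (x - h)) := by
    simp_rw [mul_sub]
    rw [integral_sub ((integrable_gaussianKernel hδ).mul_const _) i2, integral_mul_const,
      integral_gaussianKernel hδ, one_mul, mollify,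
      ← integral_sub_left_eq_self (fun y => gaussianKernel d δ (x - y) * u y) volume x]
    simp
  have e2 : ‖u x - mollify δ u x‖ₑ ≤ ∫⁻ h, ‖u x - u (x - h)‖ₑ ∂(gaussMeasure d δ) := by
    rw [e1, lintegral_gaussMeasure _ (by fun_prop)]
    refine (enorm_integral_le_lintegral_enorm _).trans (lintegral_mono fun h => ?_)
    rw [enorm_mul, Real.enorm_of_nonneg (gaussianKernel_nonneg _ _)]
    rfl
  calc _ ≤ _ := pow_le_pow_left' e2 2
    _ ≤ _ := sq_lintegral_le_lintegral_sq (by fun_prop)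
    _ = _ := lintegral_gaussMeasure _ (by fun_prop)

/-- The error is an average of `u - u(· - h)` over Gaussian `h`. Jensen's inequality, the
translation bound and the second moment give an `L²` error of order `δ ‖g‖`, uniform on bounded sets
of `H¹`. -/
theorem lintegral_enorm_sub_mollify_sq_le {δ : ℝ} (hδ : 0 < δ) {u : L2 d} {g : V2 d}
    (hu : HasGrad u g) :
    ∫⁻ x, ‖u x - mollify δ u x‖ₑ ^ 2 ≤ ENNReal.ofReal ((‖g‖ * (momentConst d * δ)) ^ 2) := by
  have hum := measurable_coe u
  calc ∫⁻ x, ‖u x - mollify δ u x‖ₑ ^ 2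
      ≤ ∫⁻ x, ∫⁻ h, gaussE d δ h * ‖u x - u (x - h)‖ₑ ^ 2 :=
        lintegral_mono fun x => enorm_sub_mollify_sq_le hδ u x
    _ = ∫⁻ h, ∫⁻ x, gaussE d δ h * ‖u x - u (x - h)‖ₑ ^ 2 :=
        lintegral_lintegral_swap (by fun_prop)
    _ ≤ ∫⁻ h, gaussE d δ h * (ENNReal.ofReal (‖g‖ ^ 2) * ‖h‖ₑ ^ 2) := by
        gcongr with h
        rw [lintegral_const_mul _ (by fun_prop)]
        gcongr
        have e : ∫⁻ x, ‖u x - u (x - h)‖ₑ ^ 2 = ENNReal.ofReal (‖trans (-h) u - u‖ ^ 2) := by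
          rw [← lintegral_enorm_sq]
          apply lintegral_congr_ae
          filter_upwards [Lp.coeFn_sub (trans (-h) u) u, coeFn_trans (-h) u] with x h1 h2
          rw [h1, Pi.sub_apply, h2, ← sub_eq_add_neg, ← enorm_neg, neg_sub]
        rw [e, ← ofReal_norm, ← ENNReal.ofReal_pow (norm_nonneg _),
          ← ENNReal.ofReal_mul (by positivity), ← mul_pow]
        gcongr
        have := hu.norm_trans_sub_le (-h)
        rw [norm_neg] at this
        linarith
    _ = ENNReal.ofReal (‖g‖ ^ 2) * ∫⁻ h, ‖h‖ₑ ^ 2 ∂(gaussMeasure d δ) := by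
        rw [← lintegral_const_mul _ (by fun_prop), lintegral_gaussMeasure _ (by fun_prop)]
    _ ≤ ENNReal.ofReal (‖g‖ ^ 2) * ENNReal.ofReal ((momentConst d * δ) ^ 2) := by
        gcongr
        exact lintegral_enorm_sq_gaussMeasure_le hδ
    _ = _ := by rw [← ENNReal.ofReal_mul (by positivity), ← mul_pow]

theorem enorm_sq_le_two_mul (a b : ℝ) : ‖a‖ₑ ^ 2 ≤ 2 * ‖b‖ₑ ^ 2 + 2 * ‖a - b‖ₑ ^ 2 := by
  simp only [← ofReal_sq_eq_enorm_sq]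
  rw [show (2 : ℝ≥0∞) = ENNReal.ofReal 2 by simp, ← ENNReal.ofReal_mul (by norm_num),
    ← ENNReal.ofReal_mul (by norm_num), ← ENNReal.ofReal_add (by positivity) (by positivity)]
  apply ENNReal.ofReal_le_ofReal
  nlinarith [sq_nonneg (b - (a - b))]

/-- Weakly convergent sequences which are bounded in `H¹` converge in `L²_loc`. -/
theorem tendsto_setLIntegral_of_weak {r : ℕ → L2 d} {q : ℕ → V2 d} (hr : ∀ n, HasGrad (r n) (q n))
    {R : ℝ} (hrR : ∀ n, ‖r n‖ ≤ R) (hqR : ∀ n, ‖q n‖ ≤ R)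
    (hw : ∀ v, Tendsto (fun n => inner ℝ v (r n)) atTop (𝓝 0)) (x₀ : Space d) (ρ : ℝ) :
    Tendsto (fun n => ∫⁻ x in Metric.closedBall x₀ ρ, ‖r n x‖ₑ ^ 2) atTop (𝓝 0) := by
  have hR : 0 ≤ R := (norm_nonneg _).trans (hrR 0)
  have hm0 := momentConst_pos d
  -- For fixed `δ` the mollified sequence tends to zero pointwise by weak convergence and is
  -- uniformly bounded, so dominated convergence applies on the ball. The distance to the original
  -- sequence is small uniformly in `n`.
  have hmoll : ∀ δ, 0 < δ →
      Tendsto (fun n => ∫⁻ x in Metric.closedBall x₀ ρ, ‖mollify δ (r n) x‖ₑ ^ 2) atTop (𝓝 0) := by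
    intro δ hδ
    set K := ‖(memLp_gaussianKernel_sub hδ (0 : Space d)).toLp _‖ with hK
    have := tendsto_lintegral_of_dominated_convergence
      (μ := volume.restrict (Metric.closedBall x₀ ρ))
      (F := fun n x => ‖mollify δ (r n) x‖ₑ ^ 2) (f := fun _ => 0)
      (fun _ => ENNReal.ofReal ((K * R) ^ 2))
      (fun n => (measurable_mollify δ (r n)).enorm.pow_const 2)
      (fun n => ae_of_all _ fun x => by
        simp only
        rw [← ofReal_norm, ← ENNReal.ofReal_pow (norm_nonneg _)]
        refine ENNReal.ofReal_le_ofReal (pow_le_pow_left₀ (norm_nonneg _) ?_ 2)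
        rw [mollify_eq_inner hδ]
        refine (norm_inner_le_norm _ _).trans ?_
        rw [norm_toLp_gaussianKernel_sub hδ x]
        exact mul_le_mul_of_nonneg_left (hrR n) (norm_nonneg _))
      (by
        rw [lintegral_const, Measure.restrict_apply_univ]
        exact ENNReal.mul_ne_top ENNReal.ofReal_ne_top measure_closedBall_lt_top.ne)
      (ae_of_all _ fun x => by
        have h1 := hw ((memLp_gaussianKernel_sub hδ x).toLp _)
        simp_rw [← mollify_eq_inner hδ] at h1
        have h2 := ((ENNReal.continuous_pow 2).tendsto _).comp h1.enorm
        simpa [Function.comp_def] using h2)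
    simpa using this
  rw [ENNReal.tendsto_nhds_zero]
  intro ε hε
  have hlim : Tendsto (fun δ : ℝ => 2 * ENNReal.ofReal ((R * (momentConst d * δ)) ^ 2)) (𝓝[>] 0)
      (𝓝 0) := by
    have h1 : Tendsto (fun δ : ℝ => ENNReal.ofReal ((R * (momentConst d * δ)) ^ 2)) (𝓝 0)
        (𝓝 (ENNReal.ofReal ((R * (momentConst d * 0)) ^ 2))) :=
      (ENNReal.continuous_ofReal.comp (by fun_prop :
        Continuous fun δ : ℝ => (R * (momentConst d * δ)) ^ 2)).tendsto 0
    simp only [mul_zero, zero_pow two_ne_zero, ENNReal.ofReal_zero] at h1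
    have h2 := ENNReal.Tendsto.const_mul (h1.mono_left (nhdsWithin_le_nhds (s := Set.Ioi 0)))
      (a := 2) (Or.inr (by norm_num))
    simpa using h2
  have hε2 : 0 < ε / 2 := ENNReal.half_pos hε.ne'
  obtain ⟨δ, hδε, hδ⟩ := ((ENNReal.tendsto_nhds_zero.1 hlim _ hε2).and self_mem_nhdsWithin).exists
  have h3 := ENNReal.Tendsto.const_mul (hmoll δ hδ) (a := 2) (Or.inr (by norm_num))
  rw [mul_zero] at h3
  filter_upwards [ENNReal.tendsto_nhds_zero.1 h3 _ hε2] with n hn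
  have hrm := measurable_coe (r n)
  have hmm := measurable_mollify δ (r n)
  calc ∫⁻ x in Metric.closedBall x₀ ρ, ‖r n x‖ₑ ^ 2
      ≤ ∫⁻ x in Metric.closedBall x₀ ρ,
          (2 * ‖mollify δ (r n) x‖ₑ ^ 2 + 2 * ‖r n x - mollify δ (r n) x‖ₑ ^ 2) :=
        lintegral_mono fun x => enorm_sq_le_two_mul _ _
    _ = 2 * (∫⁻ x in Metric.closedBall x₀ ρ, ‖mollify δ (r n) x‖ₑ ^ 2) +
        2 * ∫⁻ x in Metric.closedBall x₀ ρ, ‖r n x - mollify δ (r n) x‖ₑ ^ 2 := by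
        rw [lintegral_add_left (by fun_prop), lintegral_const_mul _ (by fun_prop),
          lintegral_const_mul _ (by fun_prop)]
    _ ≤ ε / 2 + ε / 2 := by
        refine add_le_add hn (le_trans ?_ hδε)
        gcongr
        refine (setLIntegral_le_lintegral _ _).trans
          ((lintegral_enorm_sub_mollify_sq_le hδ (hr n)).trans ?_)
        have := hqR n
        have hδ' : 0 < δ := hδ
        gcongr
    _ = ε := ENNReal.add_halves ε

/-- Cauchy–Schwarz on a large ball, where `r n` tends to zero in `L²`, and on its complement, where
`u` has little mass. -/
theorem tendsto_lintegral_enorm_mul_enorm (u : L2 d) {r : ℕ → L2 d} {R : ℝ}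
    (hrR : ∀ n, ‖r n‖ ≤ R)
    (hloc : ∀ ρ : ℝ, Tendsto (fun n => ∫⁻ x in Metric.closedBall 0 ρ, ‖r n x‖ₑ ^ 2) atTop (𝓝 0)) :
    Tendsto (fun n => ∫⁻ x, ‖u x‖ₑ * ‖r n x‖ₑ) atTop (𝓝 0) := by
  have hum := measurable_coe u
  have hR : 0 ≤ R := (norm_nonneg _).trans (hrR 0)
  have hCS : ∀ (μ : Measure (Space d)) (v : L2 d), ∫⁻ x, ‖u x‖ₑ * ‖v x‖ₑ ∂μ ≤
      (∫⁻ x, ‖u x‖ₑ ^ 2 ∂μ) ^ (1 / 2 : ℝ) * (∫⁻ x, ‖v x‖ₑ ^ 2 ∂μ) ^ (1 / 2 : ℝ) := by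
    intro μ v
    have hvm := measurable_coe v
    have := ENNReal.lintegral_mul_le_Lp_mul_Lq μ (p := 2) (q := 2)
      ⟨by norm_num, by norm_num, by norm_num⟩ (f := fun x => ‖u x‖ₑ) (g := fun x => ‖v x‖ₑ)
      (by fun_prop) (by fun_prop)
    simpa using this
  have hhalf : ∀ {l : Filter ℕ} {f : ℕ → ℝ≥0∞}, Tendsto f l (𝓝 0) →
      Tendsto (fun n => f n ^ (1 / 2 : ℝ)) l (𝓝 0) := by
    intro l f hf
    have := (ENNReal.continuous_rpow_const (y := 1 / 2)).tendsto (0 : ℝ≥0∞) |>.comp hf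
    rw [ENNReal.zero_rpow_of_pos (by norm_num)] at this
    exact this
  have htail : Tendsto (fun k : ℕ => ∫⁻ x in (Metric.closedBall (0 : Space d) k)ᶜ, ‖u x‖ₑ ^ 2)
      atTop (𝓝 0) := by
    have hmeas : ∀ k : ℕ, MeasurableSet (Metric.closedBall (0 : Space d) k)ᶜ := fun k =>
      Metric.isClosed_closedBall.measurableSet.compl
    simp_rw [← lintegral_indicator (hmeas _)]
    have := tendsto_lintegral_of_dominated_convergence (μ := (volume : Measure (Space d)))
      (F := fun k x => ((Metric.closedBall (0 : Space d) (k : ℕ))ᶜ).indicator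
        (fun x => ‖u x‖ₑ ^ 2) x) (f := fun _ => 0) (fun x => ‖u x‖ₑ ^ 2)
      (fun k => Measurable.indicator (by fun_prop) (hmeas k))
      (fun k => ae_of_all _ fun x => Set.indicator_le_self _ _ x)
      (by rw [lintegral_enorm_sq]; exact ENNReal.ofReal_ne_top)
      (ae_of_all _ fun x => by
        apply tendsto_const_nhds.congr'
        obtain ⟨k₀, hk₀⟩ := exists_nat_gt ‖x‖
        filter_upwards [eventually_ge_atTop k₀] with k hk
        rw [Set.indicator_of_notMem]
        simp only [Set.mem_compl_iff, not_not, mem_closedBall_zero_iff]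
        exact hk₀.le.trans (by exact_mod_cast hk))
    simpa using this
  rw [ENNReal.tendsto_nhds_zero]
  intro ε hε
  have hε2 : 0 < ε / 2 := ENNReal.half_pos hε.ne'
  have h1 := ENNReal.Tendsto.mul_const (hhalf htail) (b := ENNReal.ofReal R)
    (Or.inr ENNReal.ofReal_ne_top)
  rw [zero_mul] at h1
  obtain ⟨k, hk⟩ := (ENNReal.tendsto_nhds_zero.1 h1 _ hε2).exists
  have h2 := ENNReal.Tendsto.const_mul (hhalf (hloc k)) (a := ENNReal.ofReal ‖u‖)
    (Or.inr ENNReal.ofReal_ne_top)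
  rw [mul_zero] at h2
  have hsqrt : ∀ v : L2 d, (∫⁻ x, ‖v x‖ₑ ^ 2) ^ (1 / 2 : ℝ) = ENNReal.ofReal ‖v‖ := by
    intro v
    rw [lintegral_enorm_sq, ENNReal.ofReal_rpow_of_nonneg (by positivity) (by norm_num),
      ← Real.sqrt_eq_rpow, Real.sqrt_sq (norm_nonneg v)]
  filter_upwards [ENNReal.tendsto_nhds_zero.1 h2 _ hε2] with n hn
  rw [← lintegral_add_compl _ (Metric.isClosed_closedBall (x := (0 : Space d)) (ε := k)).measurableSet]
  calc _ ≤ _ := add_le_add (hCS _ (r n)) (hCS _ (r n))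
    _ ≤ ε / 2 + ε / 2 := by
      refine add_le_add (le_trans ?_ hn) (le_trans ?_ hk)
      · gcongr
        rw [← hsqrt u]
        gcongr
        exact Measure.restrict_le_self
      · gcongr
        calc _ ≤ (∫⁻ x, ‖r n x‖ₑ ^ 2) ^ (1 / 2 : ℝ) := by
              gcongr
              exact Measure.restrict_le_self
          _ ≤ _ := by
            rw [hsqrt]
            exact ENNReal.ofReal_le_ofReal (hrR n)
    _ = ε := ENNReal.add_halves ε

end LocalCompactness

/-! ### Concentration compactness -/

section Splitting

variable {d : ℕ}

/-- The bilinear form `∬ a(x) k(x - y) b(y) dx dy`. -/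
def bil (k a b : Space d → ℝ≥0∞) : ℝ≥0∞ := ∫⁻ x, a x * ∫⁻ y, k (x - y) * b y

theorem measurable_conv {k b : Space d → ℝ≥0∞} (hk : Measurable k) (hb : Measurable b) :
    Measurable fun x => ∫⁻ y, k (x - y) * b y :=
  Measurable.lintegral_prod_right' (f := fun p : Space d × Space d => k (p.1 - p.2) * b p.2)
    (by fun_prop)

theorem interaction_withDensity {k : Space d → ℝ≥0∞} (hk : Measurable k) (u : L2 d) :
    interaction (volume.withDensity k) u =
      2⁻¹ * bil k (fun x => ‖u x‖ₑ ^ 2) (fun x => ‖u x‖ₑ ^ 2) := by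
  rw [interaction_eq, bil]
  congr 2; ext x
  rw [pot_withDensity hk, wnorm_sq (by fun_prop)]

theorem bil_add_left {k a a' b : Space d → ℝ≥0∞} (hk : Measurable k) (ha : Measurable a)
    (hb : Measurable b) : bil k (a + a') b = bil k a b + bil k a' b := by
  have := measurable_conv hk hb
  unfold bil
  rw [← lintegral_add_left (by fun_prop)]
  simp only [Pi.add_apply, add_mul]

theorem bil_add_right {k a b b' : Space d → ℝ≥0∞} (hk : Measurable k) (ha : Measurable a)
    (hb : Measurable b) : bil k a (b + b') = bil k a b + bil k a b' := by
  have := measurable_conv hk hb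
  unfold bil
  rw [← lintegral_add_left (by fun_prop)]
  congr 1; ext x
  rw [← mul_add, ← lintegral_add_left (by fun_prop)]
  simp only [Pi.add_apply, mul_add]

theorem bil_le {k a b : Space d → ℝ≥0∞} {S : ℝ≥0∞} (hS : ∀ x, k x ≤ S) (ha : Measurable a)
    (hb : Measurable b) : bil k a b ≤ S * ((∫⁻ x, a x) * ∫⁻ x, b x) := by
  unfold bil
  calc ∫⁻ x, a x * ∫⁻ y, k (x - y) * b y ≤ ∫⁻ x, a x * ∫⁻ y, S * b y := by
        gcongr with x y
        exact hS _
    _ = _ := by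
        rw [lintegral_mul_const _ ha, lintegral_const_mul _ hb]
        ring

/-- The kernel is not assumed even, so exchanging the arguments reflects it. -/
theorem bil_swap {k a b : Space d → ℝ≥0∞} (hk : Measurable k) (ha : Measurable a)
    (hb : Measurable b) : bil k a b = bil (fun z => k (-z)) b a := by
  unfold bil
  have e1 : ∀ x, a x * ∫⁻ y, k (x - y) * b y = ∫⁻ y, a x * (k (x - y) * b y) := fun x => by
    rw [lintegral_const_mul _ (by fun_prop)]
  have e2 : ∀ x, b x * ∫⁻ y, k (-(x - y)) * a y = ∫⁻ y, b x * (k (-(x - y)) * a y) := fun x => by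
    rw [lintegral_const_mul _ (by fun_prop)]
  simp_rw [e1, e2]
  rw [lintegral_lintegral_swap (by fun_prop)]
  congr 1; ext y
  congr 1; ext x
  rw [neg_sub]
  ring

theorem lintegral_kernel_mul_le {k b : Space d → ℝ≥0∞} {S : ℝ≥0∞} {ρ : ℝ} (hS : ∀ x, k x ≤ S)
    (hρ : ∀ x, ρ < ‖x‖ → k x = 0) (hb : Measurable b) (x : Space d) :
    ∫⁻ y, k (x - y) * b y ≤ S * ∫⁻ y in Metric.closedBall x ρ, b y := by
  rw [← lintegral_const_mul _ hb, ← lintegral_indicator Metric.isClosed_closedBall.measurableSet]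
  apply lintegral_mono
  intro y
  by_cases hy : y ∈ Metric.closedBall x ρ
  · simp only [Set.indicator_of_mem hy]
    gcongr
    exact hS _
  · have h0 : k (x - y) = 0 := hρ _ (by simpa [dist_eq_norm, norm_sub_rev] using hy)
    simp [h0]

/-- The kernel has range `ρ`, so the inner integral at `x` sees only the mass of `b n` near `x`,
which vanishes in the limit. Dominated convergence with majorant `a · S · c` concludes. -/
theorem tendsto_bil_zero {k a : Space d → ℝ≥0∞} {b : ℕ → Space d → ℝ≥0∞} {S c : ℝ≥0∞} {ρ : ℝ}
    (hk : Measurable k) (hS : ∀ x, k x ≤ S) (hStop : S ≠ ⊤) (hρ : ∀ x, ρ < ‖x‖ → k x = 0)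
    (ha : Measurable a) (hatop : ∫⁻ x, a x ≠ ⊤) (hb : ∀ n, Measurable (b n)) (hc : c ≠ ⊤)
    (hbc : ∀ n, ∫⁻ x, b n x ≤ c)
    (hloc : ∀ x, Tendsto (fun n => ∫⁻ y in Metric.closedBall x ρ, b n y) atTop (𝓝 0)) :
    Tendsto (fun n => bil k a (b n)) atTop (𝓝 0) := by
  unfold bil
  have := tendsto_lintegral_of_dominated_convergence (μ := (volume : Measure (Space d)))
    (F := fun n x => a x * ∫⁻ y, k (x - y) * b n y) (f := fun _ => 0) (fun x => a x * (S * c))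
    (fun n => ha.mul (measurable_conv hk (hb n)))
    (fun n => ae_of_all _ fun x => by
      simp only
      gcongr
      refine (lintegral_kernel_mul_le hS hρ (hb n) x).trans ?_
      gcongr
      exact (setLIntegral_le_lintegral _ _).trans (hbc n))
    (by
      rw [lintegral_mul_const _ ha]
      exact ENNReal.mul_ne_top hatop (ENNReal.mul_ne_top hStop hc))
    ?_
  · simpa using this
  · filter_upwards [ae_lt_top ha hatop] with x hx
    have h1 := ENNReal.Tendsto.const_mul (hloc x) (a := S) (Or.inr hStop)
    rw [mul_zero] at h1
    have h2 := tendsto_of_tendsto_of_tendsto_of_le_of_le tendsto_const_nhds h1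
      (fun n => zero_le) (fun n => lintegral_kernel_mul_le hS hρ (hb n) x)
    have h3 := ENNReal.Tendsto.const_mul h2 (a := a x) (Or.inr hx.ne)
    rwa [mul_zero] at h3

/-- Pointwise `|u + r|² ≤ U + V + W` with `U = u²`, `V = r²` and `W = 2|u||r|`. After expansion, the
mixed terms of `U` and `V` vanish by the finite range of `k`, and every term containing `W` vanishes
because `k` is bounded and `∫ W → 0`. -/
theorem eventually_interaction_withDensity_add_le {k : Space d → ℝ≥0∞} {S ρ : ℝ}
    (hk : Measurable k) (hS : ∀ x, k x ≤ ENNReal.ofReal S) (hρ : ∀ x, ρ < ‖x‖ → k x = 0)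
    (u : L2 d) {r : ℕ → L2 d} {R : ℝ} (hrR : ∀ n, ‖r n‖ ≤ R)
    (hloc : ∀ (x : Space d) (ρ : ℝ),
      Tendsto (fun n => ∫⁻ y in Metric.closedBall x ρ, ‖r n y‖ₑ ^ 2) atTop (𝓝 0))
    {η : ℝ} (hη : 0 < η) :
    ∀ᶠ n in atTop, interaction (volume.withDensity k) (u + r n : L2 d) ≤
      interaction (volume.withDensity k) u + interaction (volume.withDensity k) (r n) +
        ENNReal.ofReal η := by
  have hR : 0 ≤ R := (norm_nonneg _).trans (hrR 0)
  have hu := measurable_coe u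
  have hr := fun n => measurable_coe (r n)
  set U : Space d → ℝ≥0∞ := fun x => ‖u x‖ₑ ^ 2 with hU
  set V : ℕ → Space d → ℝ≥0∞ := fun n x => ‖r n x‖ₑ ^ 2 with hV
  set W : ℕ → Space d → ℝ≥0∞ := fun n x => 2 * (‖u x‖ₑ * ‖r n x‖ₑ) with hW
  have mU : Measurable U := by fun_prop
  have mV : ∀ n, Measurable (V n) := fun n => by have := hr n; fun_prop
  have mW : ∀ n, Measurable (W n) := fun n => by have := hr n; fun_prop
  have iU : ∫⁻ x, U x = ENNReal.ofReal (‖u‖ ^ 2) := lintegral_enorm_sq u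
  have iV : ∀ n, ∫⁻ x, V n x ≤ ENNReal.ofReal (R ^ 2) := fun n => by
    rw [lintegral_enorm_sq]
    have := hrR n
    gcongr
  have iW : Tendsto (fun n => ∫⁻ x, W n x) atTop (𝓝 0) := by
    have h1 := tendsto_lintegral_enorm_mul_enorm u hrR (hloc 0)
    have h2 := ENNReal.Tendsto.const_mul h1 (a := 2) (Or.inr (by norm_num))
    rw [mul_zero] at h2
    refine h2.congr fun n => ?_
    have := hr n
    rw [lintegral_const_mul _ (by fun_prop)]
  set S' := ENNReal.ofReal S with hS'
  set c : ℝ≥0∞ := ENNReal.ofReal (‖u‖ ^ 2) + ENNReal.ofReal (R ^ 2) with hc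
  have hctop : c ≠ ⊤ := ENNReal.add_ne_top.2 ⟨ENNReal.ofReal_ne_top, ENNReal.ofReal_ne_top⟩
  set err : ℕ → ℝ≥0∞ := fun n => bil k U (V n) + bil (fun z => k (-z)) U (V n) +
    S' * (c * (∫⁻ x, W n x) + (∫⁻ x, W n x) * (c + ∫⁻ x, W n x)) with herr
  have herr0 : Tendsto err atTop (𝓝 0) := by
    have h1 := tendsto_bil_zero hk hS ENNReal.ofReal_ne_top hρ mU
      (by rw [iU]; exact ENNReal.ofReal_ne_top) mV ENNReal.ofReal_ne_top iV (fun x => hloc x ρ)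
    have h2 := tendsto_bil_zero (k := fun z => k (-z)) (by fun_prop) (fun x => hS (-x))
      ENNReal.ofReal_ne_top (fun x hx => hρ (-x) (by rwa [norm_neg])) mU
      (by rw [iU]; exact ENNReal.ofReal_ne_top) mV ENNReal.ofReal_ne_top iV (fun x => hloc x ρ)
    have h3 := ENNReal.Tendsto.const_mul iW (a := c) (Or.inr hctop)
    have h4 := ENNReal.Tendsto.mul iW (Or.inr (by simpa using hctop))
      (tendsto_const_nhds (x := c).add iW) (Or.inr (by simp))
    have h5 := ENNReal.Tendsto.const_mul (h3.add h4) (a := S') (Or.inr ENNReal.ofReal_ne_top)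
    have h6 := (h1.add h2).add h5
    simpa using h6
  filter_upwards [ENNReal.tendsto_nhds_zero.1 herr0 (ENNReal.ofReal η) (by simpa using hη)] with n hn
  rw [interaction_congr_ae _ (Lp.coeFn_add u (r n))] 
  have hsum : interaction (volume.withDensity k) ((u : Space d → ℝ) + (r n : Space d → ℝ)) ≤
      2⁻¹ * bil k ((U + V n) + W n) ((U + V n) + W n) := by
    have hpt : ∀ x, ‖u x + r n x‖ₑ ^ 2 ≤ ((U + V n) + W n) x := by
      intro x
      calc ‖u x + r n x‖ₑ ^ 2 ≤ (‖u x‖ₑ + ‖r n x‖ₑ) ^ 2 := by gcongr; exact enorm_add_le _ _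
        _ = _ := by simp only [hU, hV, hW, Pi.add_apply]; ring
    have hrn := hr n
    rw [interaction_eq, bil]
    gcongr with x
    · exact hpt x
    · rw [pot, lintegral_withDensity_eq_lintegral_mul _ hk (by fun_prop),
        ← lintegral_sub_left_eq_self _ x]
      apply lintegral_mono
      intro y
      simp only [Pi.mul_apply, sub_sub_cancel]
      gcongr
      exact hpt y
  refine hsum.trans ?_
  have mP : Measurable (U + V n) := mU.add (mV n)
  have iP : ∫⁻ x, (U + V n) x ≤ c := by
    simp only [Pi.add_apply]
    rw [lintegral_add_left mU, iU]
    exact add_le_add le_rfl (iV n)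
  have hexp : bil k ((U + V n) + W n) ((U + V n) + W n) ≤ bil k U U + bil k (V n) (V n) + err n := by
    rw [bil_add_left hk mP (mP.add (mW n)), bil_add_right hk mP mP,
      bil_add_left hk mU mP, bil_add_right hk mU mU, bil_add_right hk (mV n) mU,
      bil_swap hk (mV n) mU]
    have h1 : bil k (U + V n) (W n) ≤ S' * (c * ∫⁻ x, W n x) :=
      (bil_le hS mP (mW n)).trans (by gcongr)
    have h2 : bil k (W n) (U + V n + W n) ≤ S' * ((∫⁻ x, W n x) * (c + ∫⁻ x, W n x)) := by
      refine (bil_le hS (mW n) (mP.add (mW n))).trans ?_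
      gcongr
      simp only [Pi.add_apply (U + V n) (W n)]
      rw [lintegral_add_left mP]
      gcongr
    calc _ ≤ bil k U U + bil k U (V n) + (bil (fun z => k (-z)) U (V n) + bil k (V n) (V n)) +
          S' * (c * ∫⁻ x, W n x) + S' * ((∫⁻ x, W n x) * (c + ∫⁻ x, W n x)) := by gcongr
      _ = _ := by rw [herr]; ring
  calc 2⁻¹ * bil k ((U + V n) + W n) ((U + V n) + W n)
      ≤ 2⁻¹ * (bil k U U + bil k (V n) (V n) + err n) := by gcongr
    _ = 2⁻¹ * bil k U U + 2⁻¹ * bil k (V n) (V n) + 2⁻¹ * err n := by rw [mul_add, mul_add]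
    _ ≤ _ := by
      rw [interaction_withDensity hk, interaction_withDensity hk]
      gcongr
      calc 2⁻¹ * err n ≤ 1 * err n := by gcongr; simp
        _ ≤ _ := by rw [one_mul]; exact hn

/-- This excludes vanishing: a bounded kernel of range `ρ` turns a uniform bound on the mass in
balls of radius `ρ` into a bound on the potential. -/
theorem interaction_withDensity_le_of_setLIntegral_le {k : Space d → ℝ≥0∞} {S ρ c : ℝ}
    (hk : Measurable k) (hS0 : 0 ≤ S) (hc : 0 ≤ c)
    (hS : ∀ x, k x ≤ ENNReal.ofReal S) (hρ : ∀ x, ρ < ‖x‖ → k x = 0)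
    (u : L2 d) (h : ∀ z, ∫⁻ x in Metric.closedBall z ρ, ‖u x‖ₑ ^ 2 ≤ ENNReal.ofReal c) :
    interaction (volume.withDensity k) u ≤ ENNReal.ofReal (S * c * ‖u‖ ^ 2 / 2) := by
  have hu := measurable_coe u
  refine interaction_le_of_pot_le _ u (by positivity) (ae_of_all _ fun x => ?_)
  rw [pot_withDensity hk, wnorm_sq (by fun_prop), ENNReal.ofReal_mul hS0]
  refine (lintegral_kernel_mul_le hS hρ (by fun_prop) x).trans ?_
  gcongr
  exact h x

/-- One-sided splitting of the interaction along weakly convergent sequences. -/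
theorem Tame.eventually_interaction_le {μ : Measure (Space d)} (hμ : Tame μ) {v : ℕ → L2 d}
    {h : ℕ → V2 d} {u : L2 d} {g : V2 d} (hv : ∀ n, HasGrad (v n) (h n)) (hu : HasGrad u g) {R : ℝ}
    (hvR : ∀ n, ‖v n‖ ≤ R) (hhR : ∀ n, ‖h n‖ ≤ R)
    (hw : ∀ y, Tendsto (fun n => inner ℝ y (v n)) atTop (𝓝 (inner ℝ y u))) {η : ℝ} (hη : 0 < η) :
    ∀ᶠ n in atTop, interaction μ (v n) ≤
      interaction μ u + interaction μ (v n - u : L2 d) + ENNReal.ofReal η := by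
  -- One radius that serves the sequence, its limit and the differences. The truncation is then used
  -- three times and the splitting once, each costing `η / 4`.
  set R' := R + ‖u‖ + ‖g‖ with hR'
  have hR0 : 0 ≤ R := (norm_nonneg _).trans (hvR 0)
  have hu0 := norm_nonneg u
  have hg0 := norm_nonneg g
  obtain ⟨k, S, ρ, hk, hS0, hS, hρ, happ⟩ := hμ.approx R' (η / 4) (by linarith)
  have hr : ∀ n, HasGrad (v n - u) (h n - g) := fun n => (hv n).sub hu
  have hrR : ∀ n, ‖v n - u‖ ≤ R' := fun n => (norm_sub_le _ _).trans (by linarith [hvR n])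
  have hqR : ∀ n, ‖h n - g‖ ≤ R' := fun n => (norm_sub_le _ _).trans (by linarith [hhR n])
  have hw' : ∀ y, Tendsto (fun n => inner ℝ y (v n - u)) atTop (𝓝 0) := by
    intro y
    have := (hw y).sub_const (inner ℝ y u)
    simpa [inner_sub_right] using this
  have hev := eventually_interaction_withDensity_add_le hk hS hρ u hrR
    (fun x ρ => tendsto_setLIntegral_of_weak hr hrR hqR hw' x ρ) (η := η / 4) (by linarith)
  filter_upwards [hev] with n hn
  rw [add_sub_cancel] at hn
  have e1 := (happ (v n) (h n) (hv n) (by linarith [hvR n]) (by linarith [hhR n])).1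
  have e2 := (happ u g hu (by linarith) (by linarith)).2
  have e3 := (happ (v n - u) (h n - g) (hr n) (hrR n) (hqR n)).2
  have hsum : ENNReal.ofReal η = ENNReal.ofReal (η / 4) + ENNReal.ofReal (η / 4) +
      ENNReal.ofReal (η / 4) + ENNReal.ofReal (η / 4) := by
    rw [← ENNReal.ofReal_add (by linarith) (by linarith),
      ← ENNReal.ofReal_add (by linarith) (by linarith),
      ← ENNReal.ofReal_add (by linarith) (by linarith)]
    congr 1; ring
  calc interaction μ (v n) ≤ _ := e1
    _ ≤ (interaction μ u + ENNReal.ofReal (η / 4)) +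
        (interaction μ (v n - u : L2 d) + ENNReal.ofReal (η / 4)) + ENNReal.ofReal (η / 4) +
          ENNReal.ofReal (η / 4) := by
        gcongr
        exact hn.trans (by gcongr)
    _ = _ := by rw [hsum]; ring

end Splitting

/-! ### Compactness of maximizing sequences -/

section Compactness

variable {d : ℕ}

/-- The energy of a Sobolev pair. -/
def En (κ : ℝ) (μ : Measure (Space d)) (u : L2 d) (g : V2 d) : ℝ :=
  (interaction μ u).toReal - κ * ‖g‖ ^ 2

namespace Tame

variable {μ : Measure (Space d)}

theorem interaction_ne_top (hμ : Tame μ) {u : L2 d} {g : V2 d} (hu : HasGrad u g) :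
    interaction μ u ≠ ⊤ := by
  obtain ⟨C, -, h⟩ := hμ.coercive 1 one_pos
  exact ((h u g hu).trans_lt ENNReal.ofReal_lt_top).ne

theorem toReal_interaction_le (hμ : Tame μ) {τ : ℝ} (hτ : 0 < τ) : ∃ C : ℝ, 0 ≤ C ∧
    ∀ (u : L2 d) (g : V2 d), HasGrad u g →
      (interaction μ u).toReal ≤ (C * ‖u‖ ^ 2 + τ * ‖g‖ ^ 2) * ‖u‖ ^ 2 := by
  obtain ⟨C, hC, h⟩ := hμ.coercive τ hτ
  exact ⟨C, hC, fun u g hu => ENNReal.toReal_le_of_le_ofReal (by positivity) (h u g hu)⟩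

theorem toReal_interaction_smul (hμ : Tame μ) (c : ℝ) (u : L2 d) :
    (interaction μ (c • u : L2 d)).toReal = c ^ 4 * (interaction μ u).toReal := by
  have := hμ.sfinite
  rw [interaction_congr_ae μ (Lp.coeFn_smul c u), interaction_eq, interaction_eq]
  have e1 : ∀ x, pot μ (c • (u : Space d → ℝ)) x = ‖c‖ₑ ^ 2 * pot μ u x := by
    intro x
    unfold pot
    rw [← lintegral_const_mul' _ _ (by simp)]
    congr 1; ext z
    rw [Pi.smul_apply, smul_eq_mul, enorm_mul, mul_pow]
  have e2 : ∫⁻ x, ‖(c • (u : Space d → ℝ)) x‖ₑ ^ 2 * pot μ (c • (u : Space d → ℝ)) x =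
      ‖c‖ₑ ^ 4 * ∫⁻ x, ‖u x‖ₑ ^ 2 * pot μ u x := by
    rw [← lintegral_const_mul' _ _ (by simp)]
    congr 1; ext x
    rw [e1, Pi.smul_apply, smul_eq_mul, enorm_mul]
    ring
  rw [e2, mul_left_comm, ENNReal.toReal_mul, ENNReal.toReal_pow, toReal_enorm, Real.norm_eq_abs]
  rw [show (4 : ℕ) = 2 * 2 from rfl, pow_mul, sq_abs, ← pow_mul]

variable {κ M : ℝ}

/-- Let `m = ‖u‖` and let `I` be the interaction of `u`. Normalizing `u` divides `I` by `m⁴` but the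
kinetic energy only by `m²`, so `I / m² - κ ‖g‖² ≤ m² M`. For `m < 1` the loss is strict: if `I > 0`
because `1 / m² > 1`, and if `I = 0` because `M > 0`. This strict inequality excludes the splitting
of mass. -/
theorem En_le_of_norm_le_one (hμ : Tame μ) (hκ : 0 < κ) (hM0 : 0 < M)
    (hM : ∀ (u : L2 d) (g : V2 d), HasGrad u g → ‖u‖ = 1 → En κ μ u g ≤ M) {u : L2 d} {g : V2 d}
    (hu : HasGrad u g) (h1 : ‖u‖ ≤ 1) :
    En κ μ u g ≤ ‖u‖ ^ 2 * M ∧ (0 < ‖u‖ → ‖u‖ < 1 → En κ μ u g < ‖u‖ ^ 2 * M) := by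
  rcases eq_or_lt_of_le (norm_nonneg u) with h0 | h0
  · obtain ⟨C, -, h⟩ := hμ.toReal_interaction_le one_pos
    have := h u g hu
    rw [← h0] at this ⊢
    refine ⟨?_, fun h => absurd h (lt_irrefl _)⟩
    unfold En
    have : 0 ≤ κ * ‖g‖ ^ 2 := by positivity
    simp only [ne_eq, OfNat.ofNat_ne_zero, not_false_eq_true, zero_pow, mul_zero, zero_mul] at *
    linarith
  · have key := hM _ _ (hu.smul ‖u‖⁻¹) (by rw [norm_smul, norm_inv, norm_norm]; field_simp)
    unfold En at *
    rw [hμ.toReal_interaction_smul, norm_smul, norm_inv, norm_norm] at key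
    have hI : 0 ≤ (interaction μ u).toReal := ENNReal.toReal_nonneg
    set I := (interaction μ u).toReal
    set m := ‖u‖
    have hm2 : m ^ 2 ≤ 1 := by nlinarith
    have key2 : I * (1 / m ^ 2) - κ * ‖g‖ ^ 2 ≤ m ^ 2 * M := by
      have := mul_le_mul_of_nonneg_left key (sq_nonneg m)
      refine le_trans (le_of_eq ?_) this
      field_simp
    have h3 : 1 ≤ 1 / m ^ 2 := by rw [le_div_iff₀ (by positivity)]; linarith
    constructor
    · nlinarith
    · intro _ hlt
      have hm2' : m ^ 2 < 1 := by nlinarith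
      have h4 : 1 < 1 / m ^ 2 := by rw [lt_div_iff₀ (by positivity)]; linarith
      rcases eq_or_lt_of_le hI with hI0 | hI0
      · rw [← hI0]
        have : 0 ≤ κ * ‖g‖ ^ 2 := by positivity
        have : 0 < m ^ 2 * M := by positivity
        linarith
      · nlinarith

theorem En_trans (hμ : Tame μ) (u : L2 d) (g : V2 d) (z : Space d) :
    En κ μ (trans z u) (trans z g) = En κ μ u g := by
  have := hμ.sfinite
  unfold En
  rw [interaction_trans, LinearIsometry.norm_map]

/-- Coercivity with `τ = κ / 2` absorbs the interaction into half of the kinetic energy. -/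
theorem exists_norm_grad_le (hμ : Tame μ) (hκ : 0 < κ) (b : ℝ) : ∃ R : ℝ, 0 ≤ R ∧
    ∀ (u : L2 d) (g : V2 d), HasGrad u g → ‖u‖ = 1 → b ≤ En κ μ u g → ‖g‖ ≤ R := by
  obtain ⟨C, hC, h⟩ := hμ.toReal_interaction_le (half_pos hκ)
  refine ⟨Real.sqrt (2 * (C + |b|) / κ), Real.sqrt_nonneg _, fun u g hu h1 hb => ?_⟩
  apply Real.le_sqrt_of_sq_le
  have := h u g hu
  rw [h1] at this
  unfold En at hb
  rw [le_div_iff₀ hκ]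
  nlinarith [neg_abs_le b]

/-- Maximizing sequences do not vanish. -/
theorem exists_mass_lower_bound (hμ : Tame μ) (hκ : 0 < κ) (hM0 : 0 < M) (R : ℝ) :
    ∃ c ρ : ℝ, 0 < c ∧ ∀ (u : L2 d) (g : V2 d), HasGrad u g → ‖u‖ = 1 → ‖g‖ ≤ R →
      M / 2 ≤ En κ μ u g →
      ∃ z, ENNReal.ofReal c < ∫⁻ x in Metric.closedBall z ρ, ‖u x‖ₑ ^ 2 := by
  -- If every ball of radius `ρ` had mass at most `M / (4(S + 1))`, the truncated interaction would
  -- be at most `M / 8`. With the error `M / 8` the energy would be at most `M / 4`, below `M / 2`.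
  -- The `1` in `S + 1` avoids a zero denominator.
  obtain ⟨k, S, ρ, hk, hS0, hS, hρ, happ⟩ := hμ.approx (max R 1) (M / 8) (by linarith)
  have hc : 0 < M / (4 * (S + 1)) := by positivity
  refine ⟨M / (4 * (S + 1)), ρ, hc, fun u g hu h1 hgR hE => ?_⟩
  by_contra! hcon
  have i1 := interaction_withDensity_le_of_setLIntegral_le hk hS0 hc.le hS hρ u hcon
  have i2 := (happ u g hu (by rw [h1]; exact le_max_right _ _) (hgR.trans (le_max_left _ _))).1
  have i3 := i2.trans (add_le_add i1 le_rfl)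
  rw [← ENNReal.ofReal_add (by positivity) (by positivity)] at i3
  have i4 := ENNReal.toReal_le_of_le_ofReal (by positivity) i3
  unfold En at hE
  have h5 : S * (M / (4 * (S + 1))) ≤ M / 4 := by
    rw [← mul_div_assoc, div_le_div_iff₀ (by positivity) (by norm_num)]
    nlinarith
  rw [h1] at i4
  have : 0 ≤ κ * ‖g‖ ^ 2 := by positivity
  linarith

/-- Each function is recentred where its mass concentrates. Weak compactness gives a limit pair, and
the limit is not zero because local compactness would otherwise make the mass near the origin
vanish. -/
theorem exists_translated_weak_limit (hμ : Tame μ) (hκ : 0 < κ) (hM0 : 0 < M)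
    {v : ℕ → L2 d} {h : ℕ → V2 d} (hv : ∀ n, HasGrad (v n) (h n)) (hv1 : ∀ n, ‖v n‖ = 1) {R : ℝ}
    (hhR : ∀ n, ‖h n‖ ≤ R) (hE : ∀ n, M / 2 ≤ En κ μ (v n) (h n)) :
    ∃ (φ : ℕ → ℕ) (z : ℕ → Space d) (u : L2 d) (g : V2 d), StrictMono φ ∧ HasGrad u g ∧ 0 < ‖u‖ ∧
      (∀ y, Tendsto (fun n => inner ℝ y (trans (z n) (v (φ n)))) atTop (𝓝 (inner ℝ y u))) ∧
      (∀ y, Tendsto (fun n => inner ℝ y (trans (z n) (h (φ n)))) atTop (𝓝 (inner ℝ y g))) := by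
  obtain ⟨c, ρ, hc, hmass⟩ := hμ.exists_mass_lower_bound hκ hM0 R
  have : Fact ((2 : ℝ≥0∞) ≠ ⊤) := ⟨by norm_num⟩
  choose z hz using fun n => hmass (v n) (h n) (hv n) (hv1 n) (hhR n) (hE n)
  obtain ⟨u, φ₁, hφ₁, hu⟩ := exists_weakly_convergent_subseq (x := fun n => trans (z n) (v n))
    (R := 1) (fun n => by rw [LinearIsometry.norm_map, hv1])
  obtain ⟨g, φ₂, hφ₂, hg⟩ := exists_weakly_convergent_subseq
    (x := fun n => trans (z (φ₁ n)) (h (φ₁ n)))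
    (R := R) (fun n => by rw [LinearIsometry.norm_map]; exact hhR _)
  have hu' : ∀ y, Tendsto (fun n => inner ℝ y (trans (z (φ₁ (φ₂ n))) (v (φ₁ (φ₂ n))))) atTop
      (𝓝 (inner ℝ y u)) := fun y => (hu y).comp hφ₂.tendsto_atTop
  have hgrad : HasGrad u g := HasGrad.of_tendsto
    (fun n => (hv (φ₁ (φ₂ n))).trans (z (φ₁ (φ₂ n)))) hu' hg
  refine ⟨φ₁ ∘ φ₂, fun n => z (φ₁ (φ₂ n)), u, g, hφ₁.comp hφ₂, hgrad, ?_, hu', hg⟩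
  rw [norm_pos_iff]
  rintro rfl
  have hloc := tendsto_setLIntegral_of_weak (r := fun n => trans (z (φ₁ (φ₂ n))) (v (φ₁ (φ₂ n))))
    (q := fun n => trans (z (φ₁ (φ₂ n))) (h (φ₁ (φ₂ n)))) (R := max R 1)
    (fun n => (hv _).trans _) (fun n => by rw [LinearIsometry.norm_map, hv1]; exact le_max_right _ _)
    (fun n => by rw [LinearIsometry.norm_map]; exact (hhR _).trans (le_max_left _ _))
    (fun y => by simpa using hu' y) 0 ρ
  obtain ⟨n, hn⟩ := (ENNReal.tendsto_nhds_zero.1 hloc (ENNReal.ofReal c) (by simpa using hc)).exists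
  refine absurd hn (not_le.2 ?_)
  refine (hz (φ₁ (φ₂ n))).trans_eq ?_
  set w := v (φ₁ (φ₂ n))
  set t := z (φ₁ (φ₂ n))
  have e1 : ∫⁻ x in Metric.closedBall 0 ρ, ‖trans t w x‖ₑ ^ 2 =
      ∫⁻ x in Metric.closedBall 0 ρ, ‖w (x + t)‖ₑ ^ 2 := by
    apply lintegral_congr_ae
    filter_upwards [ae_restrict_of_ae (coeFn_trans t w)] with x hx
    rw [hx]
  rw [e1, ← lintegral_indicator Metric.isClosed_closedBall.measurableSet,
    ← lintegral_indicator Metric.isClosed_closedBall.measurableSet,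
    ← lintegral_add_right_eq_self _ t]
  congr 1; ext x
  by_cases hx : x ∈ Metric.closedBall (0 : Space d) ρ
  · rw [Set.indicator_of_mem hx, Set.indicator_of_mem]
    simpa [dist_eq_norm] using hx
  · rw [Set.indicator_of_notMem hx, Set.indicator_of_notMem]
    simpa [dist_eq_norm] using hx

theorem tendsto_of_weak {v : ℕ → L2 d} {u : L2 d}
    (hw : ∀ y, Tendsto (fun n => inner ℝ y (v n)) atTop (𝓝 (inner ℝ y u)))
    (hv1 : ∀ n, ‖v n‖ = 1) :
    Tendsto (fun n => ‖v n - u‖ ^ 2) atTop (𝓝 (1 - ‖u‖ ^ 2)) := by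
  have h1 : ∀ n, ‖v n - u‖ ^ 2 = 1 - 2 * inner ℝ u (v n) + ‖u‖ ^ 2 := by
    intro n
    rw [norm_sub_sq_real, hv1, real_inner_comm]
    ring
  simp_rw [h1]
  have h2 := (((hw u).const_mul 2).const_sub 1).add_const (‖u‖ ^ 2)
  rw [real_inner_self_eq_norm_sq] at h2
  convert! h2 using 2
  ring

/-- Maximizing sequences converge strongly in `H¹` after translation, along a subsequence. -/
theorem exists_maximizer_of_maximizing (hμ : Tame μ) (hκ : 0 < κ) (hM0 : 0 < M)
    (hM : ∀ (u : L2 d) (g : V2 d), HasGrad u g → ‖u‖ = 1 → En κ μ u g ≤ M)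
    {v : ℕ → L2 d} {h : ℕ → V2 d} (hv : ∀ n, HasGrad (v n) (h n)) (hv1 : ∀ n, ‖v n‖ = 1)
    (hE : Tendsto (fun n => En κ μ (v n) (h n)) atTop (𝓝 M)) :
    ∃ (φ : ℕ → ℕ) (z : ℕ → Space d) (u : L2 d) (g : V2 d), StrictMono φ ∧ HasGrad u g ∧ ‖u‖ = 1 ∧
      En κ μ u g = M ∧ Tendsto (fun n => trans (z n) (v (φ n))) atTop (𝓝 u) ∧
      Tendsto (fun n => trans (z n) (h (φ n))) atTop (𝓝 g) := by
  -- The first terms are dropped so that every energy is at least `M / 2`; the final subsequence is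
  -- shifted accordingly.
  obtain ⟨N₀, hN₀⟩ := eventually_atTop.1 (hE.eventually (le_mem_nhds (half_lt_self hM0)))
  obtain ⟨R, hR0, hR⟩ := hμ.exists_norm_grad_le hκ (M / 2)
  obtain ⟨φ, z, u, g, hφ, hu, hu0, hwu, hwg⟩ := hμ.exists_translated_weak_limit hκ hM0
    (v := fun n => v (n + N₀)) (h := fun n => h (n + N₀)) (fun n => hv _) (fun n => hv1 _)
    (R := R) (fun n => hR _ _ (hv _) (hv1 _) (hN₀ _ (by omega))) (fun n => hN₀ _ (by omega))
  set v' : ℕ → L2 d := fun n => trans (z n) (v (φ n + N₀)) with hv'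
  set h' : ℕ → V2 d := fun n => trans (z n) (h (φ n + N₀)) with hh'
  have hgrad' : ∀ n, HasGrad (v' n) (h' n) := fun n => (hv _).trans _
  have hv'1 : ∀ n, ‖v' n‖ = 1 := fun n => by rw [hv', LinearIsometry.norm_map, hv1]
  have hψ : StrictMono fun n => φ n + N₀ := fun a b hab => by
    have := hφ hab
    simp only
    omega
  have hE' : Tendsto (fun n => En κ μ (v' n) (h' n)) atTop (𝓝 M) := by
    simp_rw [hv', hh', hμ.En_trans]
    exact hE.comp hψ.tendsto_atTop
  have hh'R : ∀ n, ‖h' n‖ ≤ R := fun n => by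
    rw [hh', LinearIsometry.norm_map]
    exact hR _ _ (hv _) (hv1 _) (hN₀ _ (by omega))
  have hr2 := tendsto_of_weak hwu hv'1
  have hrgrad : ∀ n, HasGrad (v' n - u) (h' n - g) := fun n => (hgrad' n).sub hu
  have hule : ‖u‖ ≤ 1 := by
    have := ge_of_tendsto hr2 (Eventually.of_forall fun n => sq_nonneg _)
    nlinarith [norm_nonneg u]
  have hcross : Tendsto (fun n => 2 * κ * (inner ℝ g (h' n) - ‖g‖ ^ 2)) atTop (𝓝 0) := by
    have h2 := ((hwg g).sub_const (‖g‖ ^ 2)).const_mul (2 * κ)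
    rw [real_inner_self_eq_norm_sq, sub_self, mul_zero] at h2
    exact h2
  -- Splitting of the energy: the interaction splits one-sidedly up to `η / 2`, and the kinetic
  -- energy splits up to the cross term `hcross`, which vanishes by weak convergence.
  have hsplit : ∀ η : ℝ, 0 < η → ∀ᶠ n in atTop, En κ μ (v' n) (h' n) ≤
      En κ μ u g + En κ μ (v' n - u) (h' n - g) + η := by
    intro η hη
    have e1 := hμ.eventually_interaction_le hgrad' hu (R := max R 1)
      (fun n => by rw [hv'1]; exact le_max_right _ _) (fun n => (hh'R n).trans (le_max_left _ _))
      hwu (half_pos hη)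
    have e2 := hcross.eventually (lt_mem_nhds (show -(η / 2) < 0 by linarith))
    filter_upwards [e1, e2] with n h1 h2
    have n1 := hμ.interaction_ne_top hu
    have n2 := hμ.interaction_ne_top (hrgrad n)
    have h3 := ENNReal.toReal_mono (ENNReal.add_ne_top.2 ⟨ENNReal.add_ne_top.2 ⟨n1, n2⟩,
      ENNReal.ofReal_ne_top⟩) h1
    rw [ENNReal.toReal_add (ENNReal.add_ne_top.2 ⟨n1, n2⟩) ENNReal.ofReal_ne_top,
      ENNReal.toReal_add n1 n2, ENNReal.toReal_ofReal (by linarith)] at h3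
    have h4 : ‖h' n - g‖ ^ 2 = ‖h' n‖ ^ 2 - 2 * inner ℝ g (h' n) + ‖g‖ ^ 2 := by
      rw [norm_sub_sq_real, real_inner_comm]
    unfold En
    rw [h4]
    nlinarith
  -- No loss of mass: otherwise the limit has energy strictly below `‖u‖² M`, while the remainder
  -- contributes at most its asymptotic mass `1 - ‖u‖²` times `M`. Together they stay below `M`.
  have hu1 : ‖u‖ = 1 := by
    by_contra hne
    have hlt : ‖u‖ < 1 := lt_of_le_of_ne hule hne
    have hstrict := (hμ.En_le_of_norm_le_one hκ hM0 hM hu hule).2 hu0 hlt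
    have hr1 : ∀ᶠ n in atTop, ‖v' n - u‖ ≤ 1 := by
      have : 1 - ‖u‖ ^ 2 < 1 := by nlinarith
      filter_upwards [hr2.eventually (gt_mem_nhds this)] with n hn
      nlinarith [norm_nonneg (v' n - u)]
    have hle : ∀ η : ℝ, 0 < η → M ≤ En κ μ u g + (1 - ‖u‖ ^ 2) * M + η := by
      intro η hη
      have hlim : Tendsto (fun n => En κ μ u g + ‖v' n - u‖ ^ 2 * M + η) atTop
          (𝓝 (En κ μ u g + (1 - ‖u‖ ^ 2) * M + η)) :=
        ((hr2.mul_const M).const_add _).add_const _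
      refine le_of_tendsto_of_tendsto hE' hlim ?_
      filter_upwards [hsplit η hη, hr1] with n h1 h2
      have h3 := (hμ.En_le_of_norm_le_one hκ hM0 hM (hrgrad n) h2).1
      linarith
    have := le_of_forall_pos_le_add hle
    nlinarith
  have hr0 : Tendsto (fun n => ‖v' n - u‖ ^ 2) atTop (𝓝 0) := by simpa [hu1] using hr2
  -- Coercivity carries a factor `‖v' n - u‖²`, which now tends to zero while the gradients stay
  -- bounded.
  have hI0 : ∀ η : ℝ, 0 < η → ∀ᶠ n in atTop, (interaction μ (v' n - u : L2 d)).toReal ≤ η := by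
    intro η hη
    obtain ⟨C, hC, hco⟩ := hμ.toReal_interaction_le one_pos
    have hb : Tendsto (fun n => (C * ‖v' n - u‖ ^ 2 + (R + ‖g‖) ^ 2) * ‖v' n - u‖ ^ 2) atTop
        (𝓝 ((C * 0 + (R + ‖g‖) ^ 2) * 0)) := ((hr0.const_mul C).add_const _).mul hr0
    rw [mul_zero] at hb
    filter_upwards [hb.eventually (gt_mem_nhds hη)] with n hn
    refine (hco _ _ (hrgrad n)).trans (le_trans ?_ hn.le)
    rw [one_mul]
    gcongr
    exact (norm_sub_le _ _).trans (by linarith [hh'R n])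
  -- Used twice: nonnegativity of the left side gives `En κ μ u g ≥ M`, and then equality forces
  -- strong convergence of the gradients.
  have hkey : ∀ η : ℝ, 0 < η → ∀ᶠ n in atTop, κ * ‖h' n - g‖ ^ 2 ≤ En κ μ u g - M + η := by
    intro η hη
    filter_upwards [hsplit (η / 3) (by linarith), hI0 (η / 3) (by linarith),
      hE'.eventually (lt_mem_nhds (show M - η / 3 < M by linarith))] with n h1 h2 h3
    have h4 : En κ μ (v' n - u) (h' n - g) =
      (interaction μ (v' n - u : L2 d)).toReal - κ * ‖h' n - g‖ ^ 2 := rfl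
    linarith
  have hEu : En κ μ u g = M := by
    refine le_antisymm (hM u g hu hu1) (le_of_forall_pos_le_add fun η hη => ?_)
    obtain ⟨n, hn⟩ := (hkey η hη).exists
    have : 0 ≤ κ * ‖h' n - g‖ ^ 2 := by positivity
    linarith
  have hq0 : Tendsto (fun n => ‖h' n - g‖ ^ 2) atTop (𝓝 0) := by
    refine tendsto_order.2 ⟨fun a ha => Eventually.of_forall fun n => ha.trans_le (sq_nonneg _),
      fun a ha => ?_⟩
    filter_upwards [hkey (κ * (a / 2)) (by positivity)] with n hn
    rw [hEu, sub_self, zero_add] at hn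
    have := le_of_mul_le_mul_left hn hκ
    linarith
  have hsq : ∀ {a : ℕ → ℝ}, (∀ n, 0 ≤ a n) → Tendsto (fun n => a n ^ 2) atTop (𝓝 0) →
      Tendsto a atTop (𝓝 0) := by
    intro a ha hlim
    have := (Real.continuous_sqrt.tendsto 0).comp hlim
    rw [Real.sqrt_zero] at this
    refine this.congr fun n => ?_
    simp [Real.sqrt_sq (ha n)]
  exact ⟨fun n => φ n + N₀, z, u, g, hψ, hu, hu1, hEu,
    tendsto_iff_norm_sub_tendsto_zero.2 (hsq (fun n => norm_nonneg _) hr0),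
    tendsto_iff_norm_sub_tendsto_zero.2 (hsq (fun n => norm_nonneg _) hq0)⟩

end Tame

end Compactness

section Bridge

variable {d : ℕ}

/-! ### Sobolev functions and Sobolev pairs -/

theorem MemH1.exists_hasGrad {f : Space d → ℝ} (hf : MemH1 f) :
    ∃ (u : L2 d) (g : V2 d), HasGrad u g ∧ f =ᵐ[volume] u := by
  obtain ⟨h2, g, hg, hw⟩ := hf
  exact ⟨h2.toLp f, hg.toLp g, hw.hasGrad h2 hg, h2.coeFn_toLp.symm⟩

theorem HasGrad.memH1 {u : L2 d} {g : V2 d} (h : HasGrad u g) {f : Space d → ℝ}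
    (hf : f =ᵐ[volume] u) : MemH1 f :=
  ⟨(memLp_congr_ae hf).2 (Lp.memLp u), g, Lp.memLp g,
    h.isWeakGradient.congr hf.symm (ae_eq_refl _)⟩

theorem HasGrad.weakGrad_ae_eq {u : L2 d} {g : V2 d} (h : HasGrad u g) {f : Space d → ℝ}
    (hf : f =ᵐ[volume] u) : weakGrad f =ᵐ[volume] g :=
  PAM.weakGrad_ae_eq hf (h.isWeakGradient.congr hf.symm (ae_eq_refl _)) h.isWeakGradient

theorem integral_norm_sq {F : Type*} [NormedAddCommGroup F] [InnerProductSpace ℝ F]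
    (u : Lp F 2 (volume : Measure (Space d))) : ∫ x, ‖u x‖ ^ 2 = ‖u‖ ^ 2 := by
  rw [← real_inner_self_eq_norm_sq, L2.inner_def]
  congr 1; ext x
  rw [real_inner_self_eq_norm_sq]

theorem HasGrad.integral_norm_weakGrad_sq {u : L2 d} {g : V2 d} (h : HasGrad u g)
    {f : Space d → ℝ} (hf : f =ᵐ[volume] u) : ∫ x, ‖weakGrad f x‖ ^ 2 = ‖g‖ ^ 2 := by
  rw [← integral_norm_sq]
  apply integral_congr_ae
  filter_upwards [h.weakGrad_ae_eq hf] with x hx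
  rw [hx]

theorem HasGrad.h1Norm_eq {u : L2 d} {g : V2 d} (h : HasGrad u g)
    {f : Space d → ℝ} (hf : f =ᵐ[volume] u) : h1Norm f = Real.sqrt (‖u‖ ^ 2 + ‖g‖ ^ 2) := by
  rw [h1Norm, h.integral_norm_weakGrad_sq hf, ← integral_norm_sq u]
  congr 2
  apply integral_congr_ae
  filter_upwards [hf] with x hx
  rw [hx, Real.norm_eq_abs, sq_abs]

theorem eLpNorm_eq_one_iff {u : L2 d} {f : Space d → ℝ} (hf : f =ᵐ[volume] u) :
    eLpNorm f 2 volume = 1 ↔ ‖u‖ = 1 := by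
  rw [eLpNorm_congr_ae hf, Lp.norm_def]
  constructor
  · intro h
    rw [h, ENNReal.toReal_one]
  · intro h
    rwa [ENNReal.toReal_eq_one_iff] at h

theorem Tame.energy_eq {μ : Measure (Space d)} (hμ : Tame μ) (κ : ℝ) {u : L2 d} {g : V2 d}
    (h : HasGrad u g) {f : Space d → ℝ} (hf : f =ᵐ[volume] u) :
    energy κ μ f = ((En κ μ u g : ℝ) : EReal) := by
  have := hμ.sfinite
  rw [energy, h.integral_norm_weakGrad_sq hf, interaction_congr_ae μ hf, En, EReal.coe_sub]
  congr 1
  rw [← ENNReal.ofReal_toReal (hμ.interaction_ne_top h), EReal.coe_ennreal_ofReal,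
    ENNReal.toReal_ofReal ENNReal.toReal_nonneg, max_eq_left ENNReal.toReal_nonneg]

/-- The set of energies of normalized Sobolev pairs. -/
def energies (κ : ℝ) (μ : Measure (Space d)) : Set ℝ :=
  {e | ∃ (u : L2 d) (g : V2 d), HasGrad u g ∧ ‖u‖ = 1 ∧ e = En κ μ u g}

/-- Passes from the extended-real supremum over functions to a real supremum over Sobolev pairs;
nonemptiness excludes the value `⊥`. -/
theorem Tame.varConst_eq {μ : Measure (Space d)} (hμ : Tame μ) {κ M : ℝ}
    (hne : (energies κ μ).Nonempty) (hM : IsLUB (energies κ μ) M) :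
    varConst κ μ = (M : EReal) := by
  apply le_antisymm
  · apply sSup_le
    rintro e ⟨f, hf, h1, rfl⟩
    obtain ⟨u, g, hu, hfu⟩ := hf.exists_hasGrad
    rw [hμ.energy_eq κ hu hfu]
    exact_mod_cast hM.1 ⟨u, g, hu, (eLpNorm_eq_one_iff hfu).1 h1, rfl⟩
  · have hle : ∀ e ∈ energies κ μ, (e : EReal) ≤ varConst κ μ := by
      rintro e ⟨u, g, hu, h1, rfl⟩
      refine le_sSup ⟨u, hu.memH1 (ae_eq_refl _), (eLpNorm_eq_one_iff (ae_eq_refl _)).2 h1, ?_⟩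
      rw [hμ.energy_eq κ hu (ae_eq_refl _)]
    obtain ⟨e₀, he₀⟩ := hne
    induction hv : varConst κ μ with
    | bot =>
      have := hle e₀ he₀
      rw [hv] at this
      exact absurd this (not_le.2 (EReal.bot_lt_coe e₀))
    | top => exact le_top
    | coe a =>
      rw [EReal.coe_le_coe_iff]
      refine hM.2 fun e he => ?_
      have := hle e he
      rw [hv] at this
      exact_mod_cast this

theorem Tame.bddAbove_energies {μ : Measure (Space d)} (hμ : Tame μ) {κ : ℝ} (hκ : 0 < κ) :
    BddAbove (energies κ μ) := by
  obtain ⟨C, -, h⟩ := hμ.toReal_interaction_le hκ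
  refine ⟨C, ?_⟩
  rintro e ⟨u, g, hu, h1, rfl⟩
  have := h u g hu
  rw [h1] at this
  unfold En
  linarith

theorem Tame.isMaximizer_iff {μ : Measure (Space d)} (hμ : Tame μ) {κ M : ℝ}
    (hv : varConst κ μ = (M : EReal)) {u : L2 d} {g : V2 d} (hu : HasGrad u g) {f : Space d → ℝ}
    (hf : f =ᵐ[volume] u) : IsMaximizer κ μ f ↔ ‖u‖ = 1 ∧ En κ μ u g = M := by
  unfold IsMaximizer
  rw [hv, hμ.energy_eq κ hu hf, eLpNorm_eq_one_iff hf, EReal.coe_eq_coe_iff]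
  exact ⟨fun h => h.2, fun h => ⟨hu.memH1 hf, h⟩⟩

theorem Tame.exists_isMaximizer {μ : Measure (Space d)} (hμ : Tame μ) {κ M : ℝ} (hκ : 0 < κ)
    (hM0 : 0 < M) (hne : (energies κ μ).Nonempty) (hM : IsLUB (energies κ μ) M) :
    ∃ f, IsMaximizer κ μ f := by
  obtain ⟨e, -, -, he, hmem⟩ := hM.exists_seq_monotone_tendsto hne
  choose v h hv hv1 hE using hmem
  obtain ⟨φ, z, u, g, -, hu, hu1, hEu, -, -⟩ := hμ.exists_maximizer_of_maximizing hκ hM0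
    (fun u g hu h1 => hM.1 ⟨u, g, hu, h1, rfl⟩) hv hv1 (by simpa only [← hE] using he)
  exact ⟨u, (hμ.isMaximizer_iff (hμ.varConst_eq hne hM) hu (ae_eq_refl _)).2 ⟨hu1, hEu⟩⟩

end Bridge

/-! ### Gaussian trial functions -/

section Trial

variable {d : ℕ}

/-- The square root of the Gaussian density. -/
def trial (d : ℕ) (s : ℝ) (x : Space d) : ℝ :=
  Real.exp (-(1 / (4 * s ^ 2)) * ‖x‖ ^ 2) / Real.sqrt ((2 * Real.pi * s ^ 2) ^ ((d : ℝ) / 2))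

/-- The gradient of the trial function. -/
def trialGrad (d : ℕ) (s : ℝ) (x : Space d) : Space d := (-(1 / (2 * s ^ 2)) * trial d s x) • x

theorem trial_sq {s : ℝ} (x : Space d) : trial d s x ^ 2 = gaussianKernel d s x := by
  unfold trial gaussianKernel
  rw [div_pow, Real.sq_sqrt (by positivity), ← Real.exp_nat_mul]
  congr 2
  field_simp
  push_cast
  ring

theorem contDiff_trial (s : ℝ) : ContDiff ℝ 1 (trial d s) := by
  unfold trial
  have : ContDiff ℝ 1 fun x : Space d => ‖x‖ ^ 2 := contDiff_norm_sq ℝ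
  fun_prop

theorem fderiv_trial (s : ℝ) (x v : Space d) :
    fderiv ℝ (trial d s) x v = inner ℝ (trialGrad d s x) v := by
  have h1 : HasFDerivAt (fun x : Space d => ‖x‖ ^ 2) (2 • innerSL ℝ x) x :=
    (hasStrictFDerivAt_norm_sq x).hasFDerivAt
  have h2 := ((h1.const_mul (-(1 / (4 * s ^ 2)))).exp).mul_const
    (Real.sqrt ((2 * Real.pi * s ^ 2) ^ ((d : ℝ) / 2)))⁻¹
  have h3 : HasFDerivAt (trial d s) _ x := h2
  rw [h3.fderiv, trialGrad, inner_smul_left, trial]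
  simp
  ring

theorem continuous_trialGrad (s : ℝ) : Continuous (trialGrad d s) := by
  have := (contDiff_trial (d := d) s).continuous
  unfold trialGrad
  fun_prop

theorem memLp_trial {s : ℝ} (hs : 0 < s) : MemLp (trial d s) 2 volume := by
  rw [memLp_two_iff_integrable_sq (contDiff_trial s).continuous.aestronglyMeasurable]
  simp_rw [trial_sq]
  exact integrable_gaussianKernel hs

theorem norm_trialGrad_sq {s : ℝ} (x : Space d) :
    ‖trialGrad d s x‖ ^ 2 = (1 / (2 * s ^ 2)) ^ 2 * (‖x‖ ^ 2 * gaussianKernel d s x) := by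
  rw [trialGrad, norm_smul, mul_pow, Real.norm_eq_abs, sq_abs, mul_pow, trial_sq]
  ring

theorem integrable_norm_sq_mul_gaussianKernel {s : ℝ} (hs : 0 < s) :
    Integrable fun x : Space d => ‖x‖ ^ 2 * gaussianKernel d s x := by
  have hc := continuous_gaussianKernel (d := d) s
  refine ((integrable_gaussianKernel (d := d) (ε := Real.sqrt 2 * s) (by positivity)).const_mul
    (4 * 2 ^ ((d : ℝ) / 2) * s ^ 2)).mono' (by fun_prop) (ae_of_all _ fun x => ?_)
  rw [Real.norm_of_nonneg (mul_nonneg (by positivity) (gaussianKernel_nonneg _ _))]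
  exact norm_sq_mul_gaussianKernel_le hs x

theorem memLp_trialGrad {s : ℝ} (hs : 0 < s) : MemLp (trialGrad d s) 2 volume := by
  rw [← memLp_norm_iff (continuous_trialGrad s).aestronglyMeasurable,
    memLp_two_iff_integrable_sq (continuous_trialGrad s).norm.aestronglyMeasurable]
  simp_rw [norm_trialGrad_sq]
  exact (integrable_norm_sq_mul_gaussianKernel hs).const_mul _

theorem hasGrad_trial {s : ℝ} (hs : 0 < s) :
    HasGrad ((memLp_trial (d := d) hs).toLp _) ((memLp_trialGrad (d := d) hs).toLp _) := by
  apply IsWeakGradient.hasGrad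
  refine ⟨(memLp_trial hs).locallyIntegrable (by norm_num),
    (memLp_trialGrad hs).locallyIntegrable (by norm_num), fun φ hφ hc v => ?_⟩
  have hct := (contDiff_trial (d := d) s).continuous
  have hcg := continuous_trialGrad (d := d) s
  simp_rw [← fderiv_trial]
  have hcf : Continuous fun x => fderiv ℝ (trial d s) x v :=
    ((contDiff_trial s).continuous_fderiv (by simp)).clm_apply continuous_const
  apply integral_mul_fderiv_eq_neg_fderiv_mul_of_integrable
  · exact (hcf.mul hφ.continuous).integrable_of_hasCompactSupport hc.mul_left
  · exact (hct.mul ((hφ.continuous_fderiv (by simp)).clm_apply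
      continuous_const)).integrable_of_hasCompactSupport (hc.fderiv_apply ℝ v).mul_left
  · exact (hct.mul hφ.continuous).integrable_of_hasCompactSupport hc.mul_left
  · exact fun x _ => (contDiff_trial s).differentiable (by simp) x
  · exact fun x _ => hφ.differentiable (by simp) x

theorem norm_toLp_trial {s : ℝ} (hs : 0 < s) : ‖(memLp_trial (d := d) hs).toLp _‖ = 1 := by
  have h : ‖(memLp_trial (d := d) hs).toLp _‖ ^ 2 = 1 := by
    rw [← integral_norm_sq, ← integral_gaussianKernel (d := d) hs]
    apply integral_congr_ae
    filter_upwards [(memLp_trial (d := d) hs).coeFn_toLp] with x hx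
    rw [hx, Real.norm_eq_abs, sq_abs, trial_sq]
  exact (pow_eq_one_iff_of_nonneg (norm_nonneg _) two_ne_zero).1 h

theorem norm_toLp_trialGrad_sq_le {s : ℝ} (hs : 0 < s) :
    ‖(memLp_trialGrad (d := d) hs).toLp _‖ ^ 2 ≤ momentConst d ^ 2 / s ^ 2 := by
  have h : ‖(memLp_trialGrad (d := d) hs).toLp _‖ ^ 2 =
      ∫ x : Space d, (1 / (2 * s ^ 2)) ^ 2 * (‖x‖ ^ 2 * gaussianKernel d s x) := by
    rw [← integral_norm_sq]
    apply integral_congr_ae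
    filter_upwards [(memLp_trialGrad (d := d) hs).coeFn_toLp] with x hx
    rw [hx, norm_trialGrad_sq]
  have h2 : ∫ x : Space d, ‖x‖ ^ 2 * gaussianKernel d s x ≤ momentConst d ^ 2 * s ^ 2 := by
    have hi := (integrable_gaussianKernel (d := d) (ε := Real.sqrt 2 * s) (by positivity)).const_mul
      (4 * 2 ^ ((d : ℝ) / 2) * s ^ 2)
    refine (integral_mono (integrable_norm_sq_mul_gaussianKernel hs) hi
      (fun x => norm_sq_mul_gaussianKernel_le hs x)).trans_eq ?_
    rw [integral_const_mul, integral_gaussianKernel (by positivity), momentConst,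
      Real.sq_sqrt (by positivity), mul_one]
  rw [h, integral_const_mul]
  have h0 := momentConst_pos d
  calc (1 / (2 * s ^ 2)) ^ 2 * ∫ x : Space d, ‖x‖ ^ 2 * gaussianKernel d s x
      ≤ (1 / (2 * s ^ 2)) ^ 2 * (momentConst d ^ 2 * s ^ 2) := by gcongr
    _ = (1 / 4) * (momentConst d ^ 2 / s ^ 2) := by field_simp; norm_num
    _ ≤ 1 * (momentConst d ^ 2 / s ^ 2) := by gcongr; norm_num
    _ = _ := one_mul _

namespace RegularCov

variable {γ : Measure (Space d)} {w A : ℝ}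

/-- The trial function squares to `p_s`, so the double integral is `γ_ε * p_s * p_s` at the origin,
which is `γ` mollified at scale `√(ε² + 2s²)`. -/
theorem interaction_trial (hγ : RegularCov γ w A) {s ε : ℝ} (hs : 0 < s) (hε : 0 < ε) :
    interaction (mollifiedCov γ ε) (trial d s) =
      2⁻¹ * mollifiedKernel γ (Real.sqrt (ε ^ 2 + 2 * s ^ 2)) 0 := by
  have := hγ.sfinite
  have hm := measurable_mollifiedKernel γ ε
  have hE : ∀ x, ‖trial d s x‖ₑ ^ 2 = gaussE d s x := fun x => by
    rw [← ofReal_sq_eq_enorm_sq, trial_sq]; rfl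
  rw [interaction_eq]
  simp only [pot, hE]
  congr 1
  have e1 : ∀ x, gaussE d s x * ∫⁻ z, gaussE d s (x - z) ∂(mollifiedCov γ ε) =
      ∫⁻ z, gaussE d s x * (mollifiedKernel γ ε z * gaussE d s (x - z)) := by
    intro x
    rw [mollifiedCov, lintegral_withDensity_eq_lintegral_mul _ hm (by fun_prop),
      lintegral_const_mul _ (by fun_prop)]
    rfl
  simp_rw [e1]
  rw [lintegral_lintegral_swap (by fun_prop)]
  have e2 : ∀ z, ∫⁻ x, gaussE d s x * (mollifiedKernel γ ε z * gaussE d s (x - z)) =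
      mollifiedKernel γ ε z * gaussE d (Real.sqrt 2 * s) z := by
    intro z
    rw [← lintegral_gaussE_mul hs hs (by positivity) (c := Real.sqrt 2 * s)
      (by rw [mul_pow, Real.sq_sqrt (by norm_num)]; ring) z, ← lintegral_const_mul _ (by fun_prop)]
    congr 1; ext x
    rw [← gaussE_neg s (x - z), neg_sub]
    ring
  simp_rw [e2]
  have h3 := mollifiedKernel_semigroup γ hε (b := Real.sqrt 2 * s) (by positivity)
    (c := Real.sqrt (ε ^ 2 + 2 * s ^ 2)) (by positivity)
    (by rw [Real.sq_sqrt (by positivity), mul_pow, Real.sq_sqrt (by norm_num)]) 0 0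
  simp only [sub_zero, zero_sub, neg_neg] at h3
  exact h3.symm

/-- Wide Gaussians win: the interaction is at least of order `s^{-w}`, the kinetic energy at most of
order `s^{-2}`, and `w < 2`. -/
theorem exists_En_pos (hγ : RegularCov γ w A) {κ : ℝ} (hκ : 0 < κ) (ε : ℝ) :
    ∃ (u : L2 d) (g : V2 d), HasGrad u g ∧ ‖u‖ = 1 ∧ 0 < En κ (scaledCov γ ε) u g := by
  have := hγ.sfinite
  obtain ⟨a, ha, hlow⟩ := hγ.lower
  have hw := hγ.w_lt
  have hw0 := hγ.w_pos
  have hm0 := momentConst_pos d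
  -- The condition `ε ≤ s` gives `√(ε² + 2s²) ≤ 2s`; the last condition is the comparison of
  -- interaction and kinetic energy, solved for `s^{2-w}`.
  obtain ⟨s, hs1, hs2, hs3⟩ : ∃ s : ℝ, 1 ≤ s ∧ ε ≤ s ∧
      κ * momentConst d ^ 2 * (2 * (a * (2 : ℝ) ^ (-w))⁻¹) < s ^ (2 - w) := by
    have h1 := (tendsto_rpow_atTop (show 0 < 2 - w by linarith)).eventually_gt_atTop
      (κ * momentConst d ^ 2 * (2 * (a * (2 : ℝ) ^ (-w))⁻¹))
    obtain ⟨s, hs⟩ := ((eventually_ge_atTop 1).and ((eventually_ge_atTop ε).and h1)).exists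
    exact ⟨s, hs⟩
  have hs : 0 < s := by linarith
  have hpos : ∀ ε', 0 < ε' → ε' ≤ s → ENNReal.ofReal (2⁻¹ * (a * (2 * s) ^ (-w))) ≤
      interaction (mollifiedCov γ ε') (trial d s) := by
    intro ε' h1 h2
    rw [hγ.interaction_trial hs h1, ENNReal.ofReal_mul (by norm_num),
      ENNReal.ofReal_inv_of_pos (by norm_num)]
    simp only [ENNReal.ofReal_ofNat]
    gcongr
    refine le_trans ?_ (hlow _ (by positivity))
    apply ENNReal.ofReal_le_ofReal
    apply mul_le_mul_of_nonneg_left _ ha.le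
    apply Real.rpow_le_rpow_of_nonpos (by positivity) _ (by linarith)
    apply Real.sqrt_le_iff.2
    constructor
    · positivity
    · nlinarith
  set u := (memLp_trial (d := d) hs).toLp _ with hu
  set g := (memLp_trialGrad (d := d) hs).toLp _ with hg
  have hgrad : HasGrad u g := hasGrad_trial hs
  have hcoe : (u : Space d → ℝ) =ᵐ[volume] trial d s := (memLp_trial hs).coeFn_toLp
  have hmain : ENNReal.ofReal (2⁻¹ * (a * (2 * s) ^ (-w))) ≤ interaction (scaledCov γ ε) u := by
    have hlow' : ∀ ε', 0 < ε' → ε' ≤ s → ENNReal.ofReal (2⁻¹ * (a * (2 * s) ^ (-w))) ≤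
        interaction (mollifiedCov γ ε') u := by
      intro ε' h1 h2
      have := sfinite_mollifiedCov γ ε'
      rw [interaction_congr_ae _ hcoe]
      exact hpos ε' h1 h2
    by_cases hε : 0 < ε
    · rw [scaledCov_of_pos γ hε]
      exact hlow' ε hε hs2
    · rw [scaledCov, if_neg hε]
      refine ge_of_tendsto (hγ.tendsto_interaction hgrad) ?_
      filter_upwards [Ioc_mem_nhdsGT hs] with ε' hε'
      exact hlow' ε' hε'.1 hε'.2
  refine ⟨u, g, hgrad, norm_toLp_trial hs, ?_⟩
  have hfin : interaction (scaledCov γ ε) u ≠ ⊤ := by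
    obtain ⟨C, -, h⟩ := hγ.exists_interaction_scaledCov_le one_pos
    exact ((h u g hgrad ε).trans_lt ENNReal.ofReal_lt_top).ne
  have h5 := (ENNReal.ofReal_le_iff_le_toReal hfin).1 hmain
  have h6 := norm_toLp_trialGrad_sq_le (d := d) hs
  rw [← hg] at h6
  unfold En
  have h7 : κ * ‖g‖ ^ 2 ≤ κ * (momentConst d ^ 2 / s ^ 2) := by gcongr
  have h8 : κ * (momentConst d ^ 2 / s ^ 2) < 2⁻¹ * (a * (2 * s) ^ (-w)) := by
    rw [Real.mul_rpow (by norm_num) hs.le, ← mul_div_assoc, div_lt_iff₀ (by positivity)]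
    have e1 : s ^ (2 - w) = s ^ (-w) * s ^ 2 := by
      rw [← Real.rpow_natCast s 2, ← Real.rpow_add hs]
      congr 1; push_cast; ring
    rw [e1] at hs3
    have h2w : (0 : ℝ) < a * 2 ^ (-w) := by positivity
    set t := a * (2 : ℝ) ^ (-w)
    have h9 := mul_lt_mul_of_pos_right hs3 (show 0 < 2⁻¹ * t by positivity)
    calc κ * momentConst d ^ 2 = κ * momentConst d ^ 2 * (2 * t⁻¹) * (2⁻¹ * t) := by field_simp
      _ < s ^ (-w) * s ^ 2 * (2⁻¹ * t) := h9
      _ = _ := by ring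
  linarith

end RegularCov

end Trial

/-! ### Smoothed power singularities -/

section Power

variable {E : Type*} [NormedAddCommGroup E] [NormedSpace ℝ E] [FiniteDimensional ℝ E]
  [MeasurableSpace E] [BorelSpace E] {μ : Measure E} [μ.IsAddHaarMeasure] {a : ℝ}

theorem setLIntegral_ball_norm_rpow_lt_top [Nontrivial E] (ha : a < Module.finrank ℝ E) {R : ℝ} (hR : 0 < R) :
    ∫⁻ x in Metric.ball (0 : E) R, ENNReal.ofReal (‖x‖ ^ (-a)) ∂μ < ⊤ := by
  have h : IntegrableOn (fun x : E => (fun t : ℝ => t ^ (-a)) ‖x‖) (Metric.ball (0 : E) R) μ := by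
    refine (integrableOn_fun_norm_addHaar μ (f := fun t : ℝ => t ^ (-a))).2 ?_
    have hn : 0 < Module.finrank ℝ E := Module.finrank_pos
    have h1 : IntegrableOn (fun t : ℝ => t ^ ((Module.finrank ℝ E : ℝ) - 1 - a)) (Set.Ioo 0 R) :=
      (intervalIntegral.integrableOn_Ioo_rpow_iff hR).2 (by linarith)
    refine h1.congr_fun (fun t ht => ?_) measurableSet_Ioo
    have ht0 : 0 < t := ht.1
    simp only [smul_eq_mul]
    rw [← Real.rpow_natCast, ← Real.rpow_add ht0, Nat.cast_sub hn]
    congr 1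
    push_cast
    ring
  have := h.lintegral_lt_top
  exact this

/-- Inside the ball `G` is bounded and the singularity is integrated; outside, the power is at most
`R^{-a}` and `G` has mass at most one. Taking `R = 1` gives boundedness, and large `R` gives decay.
-/
theorem lintegral_mul_norm_rpow_le {G : E → ℝ≥0∞} (hG : Measurable G) (ha : 0 ≤ a)
    (hG1 : ∫⁻ z, G z ∂μ ≤ 1) {R : ℝ} (hR : 0 < R) {s : ℝ≥0∞} {x : E}
    (hs : ∀ y, ‖y‖ < R → G (x - y) ≤ s) :
    ∫⁻ y, G (x - y) * ENNReal.ofReal (‖y‖ ^ (-a)) ∂μ ≤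
      s * (∫⁻ y in Metric.ball (0 : E) R, ENNReal.ofReal (‖y‖ ^ (-a)) ∂μ) +
        ENNReal.ofReal (R ^ (-a)) := by
  have hm : Measurable fun y : E => ENNReal.ofReal (‖y‖ ^ (-a)) :=
    (measurable_norm.pow_const _).ennreal_ofReal
  rw [← lintegral_add_compl _ (Metric.isOpen_ball (x := (0 : E)) (ε := R)).measurableSet]
  gcongr
  · rw [← lintegral_const_mul _ hm]
    apply setLIntegral_mono' Metric.isOpen_ball.measurableSet
    intro y hy
    gcongr
    exact hs y (by simpa using hy)
  · calc ∫⁻ y in (Metric.ball (0 : E) R)ᶜ, G (x - y) * ENNReal.ofReal (‖y‖ ^ (-a)) ∂μ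
        ≤ ∫⁻ y in (Metric.ball (0 : E) R)ᶜ, G (x - y) * ENNReal.ofReal (R ^ (-a)) ∂μ := by
          apply setLIntegral_mono' Metric.isOpen_ball.measurableSet.compl
          intro y hy
          exact mul_le_mul' le_rfl (ENNReal.ofReal_le_ofReal
            (Real.rpow_le_rpow_of_nonpos hR (by simpa using hy) (by linarith)))
      _ ≤ ∫⁻ y, G (x - y) * ENNReal.ofReal (R ^ (-a)) ∂μ := setLIntegral_le_lintegral _ _
      _ = (∫⁻ z, G z ∂μ) * ENNReal.ofReal (R ^ (-a)) := by
          rw [lintegral_mul_const _ (by fun_prop), lintegral_sub_left_eq_self]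
      _ ≤ 1 * ENNReal.ofReal (R ^ (-a)) := by gcongr
      _ = _ := one_mul _

variable [Nontrivial E]

theorem exists_lintegral_mul_norm_rpow_le {G : E → ℝ≥0∞} (hG : Measurable G) (ha : 0 ≤ a)
    (had : a < Module.finrank ℝ E) (hG0 : ∀ z, G z ≤ 1) (hG1 : ∫⁻ z, G z ∂μ ≤ 1) :
    ∃ C : ℝ, 0 < C ∧ ∀ x, ∫⁻ y, G (x - y) * ENNReal.ofReal (‖y‖ ^ (-a)) ∂μ ≤ ENNReal.ofReal C := by
  have hJ := setLIntegral_ball_norm_rpow_lt_top (μ := μ) had one_pos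
  refine ⟨(∫⁻ y in Metric.ball (0 : E) 1, ENNReal.ofReal (‖y‖ ^ (-a)) ∂μ).toReal + 1,
    by positivity, fun x => ?_⟩
  refine (lintegral_mul_norm_rpow_le hG ha hG1 one_pos (s := 1) (fun y _ => hG0 _)).trans ?_
  rw [one_mul, Real.one_rpow, ENNReal.ofReal_add ENNReal.toReal_nonneg (by norm_num),
    ENNReal.ofReal_toReal hJ.ne]

/-- First `R` makes the far part small. Then `‖x‖ > R₁ + R` keeps `x - y` outside radius `R₁` for
every `y` in the ball, where `G` is small enough to beat the integral of the singularity. -/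
theorem lintegral_mul_norm_rpow_decay {G : E → ℝ≥0∞} (hG : Measurable G) (ha : 0 < a)
    (had : a < Module.finrank ℝ E) (hG1 : ∫⁻ z, G z ∂μ ≤ 1)
    (hGd : ∀ η : ℝ, 0 < η → ∃ R : ℝ, ∀ z, R < ‖z‖ → G z ≤ ENNReal.ofReal η) {η : ℝ} (hη : 0 < η) :
    ∃ R : ℝ, ∀ x, R < ‖x‖ →
      ∫⁻ y, G (x - y) * ENNReal.ofReal (‖y‖ ^ (-a)) ∂μ ≤ ENNReal.ofReal η := by
  obtain ⟨R, hR1, hR⟩ : ∃ R : ℝ, R ^ (-a) < η / 2 ∧ 0 < R :=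
    (((tendsto_rpow_neg_atTop ha).eventually (gt_mem_nhds (half_pos hη))).and
      (eventually_gt_atTop 0)).exists
  have hJ := setLIntegral_ball_norm_rpow_lt_top (μ := μ) had hR
  set J := ∫⁻ y in Metric.ball (0 : E) R, ENNReal.ofReal (‖y‖ ^ (-a)) ∂μ with hJdef
  obtain ⟨j, hj0, hj⟩ : ∃ j : ℝ, 0 ≤ j ∧ J = ENNReal.ofReal j :=
    ⟨J.toReal, ENNReal.toReal_nonneg, (ENNReal.ofReal_toReal hJ.ne).symm⟩
  obtain ⟨R₁, hR₁⟩ := hGd (η / (2 * (j + 1))) (by positivity)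
  refine ⟨R₁ + R, fun x hx => ?_⟩
  refine (lintegral_mul_norm_rpow_le hG ha.le hG1 hR
    (s := ENNReal.ofReal (η / (2 * (j + 1)))) (fun y hy => hR₁ _ ?_)).trans ?_
  · linarith [norm_sub_norm_le x y]
  · rw [← hJdef, hj, ← ENNReal.ofReal_mul (by positivity),
      ← ENNReal.ofReal_add (by positivity) (by positivity)]
    apply ENNReal.ofReal_le_ofReal
    have : η / (2 * (j + 1)) * j ≤ η / 2 := by
      rw [div_mul_eq_mul_div, div_le_div_iff₀ (by positivity) (by norm_num)]
      nlinarith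
    linarith

theorem lintegral_mul_norm_rpow_pos {G : E → ℝ≥0∞} (hG : Measurable G) (hG0 : ∀ z, 0 < G z) (x : E) :
    0 < ∫⁻ y, G (x - y) * ENNReal.ofReal (‖y‖ ^ (-a)) ∂μ := by
  have hm : Measurable fun y : E => ENNReal.ofReal (‖y‖ ^ (-a)) :=
    (measurable_norm.pow_const _).ennreal_ofReal
  rw [pos_iff_ne_zero]
  intro h
  rw [lintegral_eq_zero_iff (by fun_prop)] at h
  have h0 : ∀ᵐ y ∂μ, y ≠ 0 := by
    rw [ae_iff]
    simp
  have : ∀ᵐ _ ∂μ, False := by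
    filter_upwards [h, h0] with y h1 h2
    simp only [Pi.zero_apply, mul_eq_zero, ENNReal.ofReal_eq_zero] at h1
    rcases h1 with h1 | h1
    · exact (hG0 (x - y)).ne' h1
    · have : 0 < ‖y‖ ^ (-a) := Real.rpow_pos_of_pos (norm_pos_iff.2 h2) _
      linarith
  rw [ae_iff] at this
  simp at this

end Power

/-! ### Regularity of the white, Riesz and fractional kernels -/

section Kernels

variable {d : ℕ}

theorem exists_exp_neg_sq_le {η : ℝ} (hη : 0 < η) :
    ∃ R : ℝ, ∀ t, R < t → Real.exp (-t ^ 2 / 2) ≤ η := by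
  refine ⟨Real.sqrt (2 / η), fun t ht => ?_⟩
  have h1 : 2 / η < t ^ 2 := by
    rw [← Real.sqrt_lt_sqrt_iff (by positivity), Real.sqrt_sq]
    · exact ht
    · exact (Real.sqrt_nonneg _).trans ht.le
  rw [neg_div, Real.exp_neg]
  apply inv_le_of_inv_le₀ hη
  have h2 := Real.add_one_le_exp (t ^ 2 / 2)
  have h3 : η⁻¹ = (2 / η) / 2 := by field_simp
  rw [h3]
  linarith

theorem gaussianKernel_one_le (x : Space d) : gaussianKernel d 1 x ≤ Real.exp (-‖x‖ ^ 2 / 2) := by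
  unfold gaussianKernel
  rw [one_pow, mul_one, mul_one]
  apply div_le_self (Real.exp_pos _).le
  apply Real.one_le_rpow _ (by positivity)
  linarith [Real.pi_gt_three]

theorem gaussE_one_le_one (x : Space d) : gaussE d 1 x ≤ 1 := by
  rw [gaussE, ENNReal.ofReal_le_one]
  refine (gaussianKernel_one_le x).trans (Real.exp_le_one_iff.2 ?_)
  rw [neg_div, neg_nonpos]
  positivity

theorem gaussE_one_decay {η : ℝ} (hη : 0 < η) :
    ∃ R : ℝ, ∀ x : Space d, R < ‖x‖ → gaussE d 1 x ≤ ENNReal.ofReal η := by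
  obtain ⟨R, hR⟩ := exists_exp_neg_sq_le hη
  exact ⟨R, fun x hx => ENNReal.ofReal_le_ofReal ((gaussianKernel_one_le x).trans (hR _ hx))⟩

theorem gaussE_pos {ε : ℝ} (hε : 0 < ε) (x : Space d) : 0 < gaussE d ε x :=
  ENNReal.ofReal_pos.2 (gaussianKernel_pos hε x)

theorem gaussianKernel_scale {ε : ℝ} (hε : 0 < ε) (x : Space d) :
    gaussianKernel d ε x = (ε ^ d)⁻¹ * gaussianKernel d 1 (ε⁻¹ • x) := by
  unfold gaussianKernel
  have h1 : (2 * Real.pi * ε ^ 2) ^ ((d : ℝ) / 2) = (2 * Real.pi * 1 ^ 2) ^ ((d : ℝ) / 2) * ε ^ d := by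
    rw [Real.mul_rpow (by positivity) (by positivity), ← Real.rpow_natCast ε 2,
      ← Real.rpow_mul hε.le, ← Real.rpow_natCast ε d]
    congr 1
    · simp
    · congr 1; push_cast; ring
  rw [h1, norm_smul, mul_pow, Real.norm_eq_abs, sq_abs]
  have h2 : -(ε⁻¹ ^ 2 * ‖x‖ ^ 2) / (2 * 1 ^ 2) = -‖x‖ ^ 2 / (2 * ε ^ 2) := by
    field_simp
  rw [h2]
  field_simp

/-- Homogeneity carries the scale `1` to all scales: `A` is the bound on the kernel at scale `1`,
and the lower constant is its value at the origin. -/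
theorem regularCov_of_scaling {γ : Measure (Space d)} {w : ℝ} (hs : SFinite γ) (hw0 : 0 < w)
    (hw2 : w < 2)
    (hscale : ∀ ε x, 0 < ε → mollifiedKernel γ ε x =
      ENNReal.ofReal (ε ^ (-w)) * mollifiedKernel γ 1 (ε⁻¹ • x))
    (hbound : ∃ C : ℝ, 0 < C ∧ ∀ x, mollifiedKernel γ 1 x ≤ ENNReal.ofReal C)
    (hdecay : ∀ η : ℝ, 0 < η → ∃ R : ℝ, ∀ x, R < ‖x‖ → mollifiedKernel γ 1 x ≤ ENNReal.ofReal η)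
    (hpos : 0 < mollifiedKernel γ 1 0) : ∃ A, RegularCov γ w A := by
  obtain ⟨C, hC, hb⟩ := hbound
  refine ⟨C, hs, hw0, hw2, hC, fun ε x hε => ?_, fun ε hε η hη => ?_, ?_⟩
  · rw [hscale ε x hε, mul_comm C, ENNReal.ofReal_mul (by positivity)]
    gcongr
    exact hb _
  · obtain ⟨R, hR⟩ := hdecay (η / ε ^ (-w)) (by positivity)
    refine ⟨ε * R, fun x hx => ?_⟩
    rw [hscale ε x hε]
    calc _ ≤ ENNReal.ofReal (ε ^ (-w)) * ENNReal.ofReal (η / ε ^ (-w)) := by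
          gcongr
          apply hR
          rw [norm_smul, norm_inv, Real.norm_of_nonneg hε.le, lt_inv_mul_iff₀ hε]
          exact hx
      _ = _ := by
          rw [← ENNReal.ofReal_mul (by positivity)]
          congr 1
          field_simp
  · have htop : mollifiedKernel γ 1 0 ≠ ⊤ := ((hb 0).trans_lt ENNReal.ofReal_lt_top).ne
    refine ⟨(mollifiedKernel γ 1 0).toReal, ENNReal.toReal_pos hpos.ne' htop, fun ε hε => ?_⟩
    rw [hscale ε 0 hε, smul_zero, mul_comm (ENNReal.toReal _), ENNReal.ofReal_mul (by positivity),
      ENNReal.ofReal_toReal htop]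

theorem mollifiedKernel_withDensity {f : Space d → ℝ≥0∞} (hf : Measurable f) (ε : ℝ) (x : Space d) :
    mollifiedKernel (volume.withDensity f) ε x = ∫⁻ y, gaussE d ε (x - y) * f y := by
  rw [mollifiedKernel_eq, lintegral_withDensity_eq_lintegral_mul _ hf (by fun_prop)]
  simp only [Pi.mul_apply, mul_comm]

/-- Substituting `y ↦ ε • y` produces the Jacobian `ε^{-d}`, which is also the scaling factor of the
Gaussian, so only the homogeneity of `f` remains. -/
theorem mollifiedKernel_withDensity_scale {f : Space d → ℝ≥0∞} (hf : Measurable f) {w : ℝ}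
    (hfs : ∀ ε y, 0 < ε → f (ε • y) = ENNReal.ofReal (ε ^ (-w)) * f y) {ε : ℝ} (hε : 0 < ε)
    (x : Space d) :
    mollifiedKernel (volume.withDensity f) ε x =
      ENNReal.ofReal (ε ^ (-w)) * mollifiedKernel (volume.withDensity f) 1 (ε⁻¹ • x) := by
  rw [mollifiedKernel_withDensity hf, mollifiedKernel_withDensity hf]
  have hm : Measurable fun y => gaussE d ε (x - y) * f y := by fun_prop
  have h1 : ∫⁻ y, gaussE d ε (x - ε • y) * f (ε • y) =
      ENNReal.ofReal ((ε ^ d)⁻¹) * ∫⁻ y, gaussE d ε (x - y) * f y := by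
    rw [← lintegral_map (f := fun y => gaussE d ε (x - y) * f y) hm (measurable_const_smul ε),
      Measure.map_addHaar_smul _ hε.ne', lintegral_smul_measure, finrank_euclideanSpace,
      Fintype.card_fin, abs_of_pos (by positivity), smul_eq_mul]
  have h2 : ∀ y, gaussE d ε (x - ε • y) * f (ε • y) =
      ENNReal.ofReal ((ε ^ d)⁻¹) * (ENNReal.ofReal (ε ^ (-w)) * (gaussE d 1 (ε⁻¹ • x - y) * f y)) := by
    intro y
    rw [hfs ε y hε, gaussE, gaussianKernel_scale hε, ENNReal.ofReal_mul (by positivity),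
      smul_sub, smul_smul, inv_mul_cancel₀ hε.ne', one_smul, gaussE]
    ring
  simp_rw [h2] at h1
  rw [lintegral_const_mul _ (by fun_prop), lintegral_const_mul _ (by fun_prop)] at h1
  have h0 : ENNReal.ofReal ((ε ^ d)⁻¹) ≠ 0 := by
    rw [Ne, ENNReal.ofReal_eq_zero, not_le]
    positivity
  exact ((ENNReal.mul_right_inj h0 ENNReal.ofReal_ne_top).1 h1).symm

theorem regularCov_white {σ : ℝ} (hσ : 0 < σ) (h0 : 0 < (d : ℝ)) (h2 : (d : ℝ) < 2) :
    ∃ A, RegularCov ((NoiseKernel.white : NoiseKernel d).cov σ) d A := by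
  have hmk : ∀ ε x, mollifiedKernel ((NoiseKernel.white : NoiseKernel d).cov σ) ε x =
      ENNReal.ofReal (σ ^ 2) * gaussE d ε x := by
    intro ε x
    rw [mollifiedKernel_eq, NoiseKernel.cov, lintegral_smul_measure, lintegral_dirac, sub_zero,
      smul_eq_mul]
  apply regularCov_of_scaling
  · unfold NoiseKernel.cov
    infer_instance
  · exact h0
  · exact h2
  · intro ε x hε
    rw [hmk, hmk, gaussE, gaussianKernel_scale hε, ENNReal.ofReal_mul (by positivity),
      Real.rpow_neg hε.le, Real.rpow_natCast, gaussE]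
    ring
  · refine ⟨σ ^ 2, by positivity, fun x => ?_⟩
    rw [hmk]
    calc _ ≤ ENNReal.ofReal (σ ^ 2) * 1 := by gcongr; exact gaussE_one_le_one x
      _ = _ := mul_one _
  · intro η hη
    obtain ⟨R, hR⟩ := gaussE_one_decay (d := d) (η := η / σ ^ 2) (by positivity)
    refine ⟨R, fun x hx => ?_⟩
    rw [hmk]
    calc _ ≤ ENNReal.ofReal (σ ^ 2) * ENNReal.ofReal (η / σ ^ 2) := by gcongr; exact hR x hx
      _ = _ := by rw [← ENNReal.ofReal_mul (by positivity)]; congr 1; field_simp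
  · rw [hmk]
    exact ENNReal.mul_pos (by simpa using hσ.ne') (gaussE_pos one_pos _).ne'

theorem regularCov_riesz {σ a : ℝ} (hσ : 0 < σ) (h0 : 0 < a) (had : a < d) (h2 : a < 2) :
    ∃ A, RegularCov ((NoiseKernel.riesz a : NoiseKernel d).cov σ) a A := by
  have hd : 0 < d := by exact_mod_cast h0.trans had
  have : Nonempty (Fin d) := ⟨⟨0, hd⟩⟩
  have hrank : a < Module.finrank ℝ (Space d) := by simpa using had
  have hfm : Measurable fun x : Space d => ENNReal.ofReal (σ ^ 2 * ‖x‖ ^ (-a)) :=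
    ((measurable_norm.pow_const _).const_mul _).ennreal_ofReal
  have hpm : Measurable fun x : Space d => ENNReal.ofReal (‖x‖ ^ (-a)) :=
    (measurable_norm.pow_const _).ennreal_ofReal
  have hmk : ∀ x, mollifiedKernel ((NoiseKernel.riesz a : NoiseKernel d).cov σ) 1 x =
      ENNReal.ofReal (σ ^ 2) * ∫⁻ y, gaussE d 1 (x - y) * ENNReal.ofReal (‖y‖ ^ (-a)) := by
    intro x
    rw [NoiseKernel.cov, mollifiedKernel_withDensity hfm, ← lintegral_const_mul _ (by fun_prop)]
    congr 1; ext y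
    rw [ENNReal.ofReal_mul (by positivity)]
    ring
  apply regularCov_of_scaling
  · unfold NoiseKernel.cov
    infer_instance
  · exact h0
  · exact h2
  · intro ε x hε
    apply mollifiedKernel_withDensity_scale hfm _ hε
    intro ε y hε
    rw [norm_smul, Real.norm_of_nonneg hε.le, Real.mul_rpow hε.le (norm_nonneg _),
      ← ENNReal.ofReal_mul (by positivity)]
    congr 1; ring
  · obtain ⟨C, hC, h⟩ := exists_lintegral_mul_norm_rpow_le (μ := (volume : Measure (Space d)))
      (measurable_gaussE 1) h0.le hrank gaussE_one_le_one (lintegral_gaussE one_pos).le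
    refine ⟨σ ^ 2 * C, by positivity, fun x => ?_⟩
    rw [hmk, ENNReal.ofReal_mul (by positivity)]
    gcongr
    exact h x
  · intro η hη
    obtain ⟨R, hR⟩ := lintegral_mul_norm_rpow_decay (μ := (volume : Measure (Space d)))
      (measurable_gaussE 1) h0 hrank (lintegral_gaussE one_pos).le (fun η hη => gaussE_one_decay hη)
      (η := η / σ ^ 2) (by positivity)
    refine ⟨R, fun x hx => ?_⟩
    rw [hmk]
    calc _ ≤ ENNReal.ofReal (σ ^ 2) * ENNReal.ofReal (η / σ ^ 2) := by gcongr; exact hR x hx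
      _ = _ := by rw [← ENNReal.ofReal_mul (by positivity)]; congr 1; field_simp
  · rw [hmk]
    refine ENNReal.mul_pos (by simpa using hσ.ne') (lintegral_mul_norm_rpow_pos (measurable_gaussE 1)
      (gaussE_pos one_pos) _).ne'

/-! ### Fractional noise -/

/-- The one-dimensional standard Gaussian density. -/
def gaussReal (t : ℝ) : ℝ := Real.exp (-t ^ 2 / 2) / (2 * Real.pi) ^ (1 / 2 : ℝ)

theorem gaussReal_pos (t : ℝ) : 0 < gaussReal t := by unfold gaussReal; positivity

theorem continuous_gaussReal : Continuous gaussReal := by unfold gaussReal; fun_prop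

theorem gaussReal_le (t : ℝ) : gaussReal t ≤ Real.exp (-t ^ 2 / 2) := by
  apply div_le_self (Real.exp_pos _).le
  apply Real.one_le_rpow _ (by positivity)
  linarith [Real.pi_gt_three]

theorem gaussReal_eq_gaussianPDFReal : gaussReal = ProbabilityTheory.gaussianPDFReal 0 1 := by
  ext t
  simp only [gaussReal, ProbabilityTheory.gaussianPDFReal, Real.sqrt_eq_rpow, sub_zero,
    NNReal.coe_one, mul_one]
  rw [div_eq_inv_mul]

theorem lintegral_gaussReal : ∫⁻ t, ENNReal.ofReal (gaussReal t) = 1 := by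
  rw [gaussReal_eq_gaussianPDFReal]
  exact ProbabilityTheory.lintegral_gaussianPDFReal_eq_one 0 one_ne_zero

theorem gaussianKernel_one_eq_prod (x : Space d) :
    gaussianKernel d 1 x = ∏ i, gaussReal (x i) := by
  unfold gaussianKernel gaussReal
  rw [Finset.prod_div_distrib, ← Real.exp_sum, Finset.prod_const, Finset.card_univ,
    Fintype.card_fin, ← Real.rpow_natCast ((2 * Real.pi) ^ (1 / 2 : ℝ)), ← Real.rpow_mul (by positivity),
    EuclideanSpace.norm_sq_eq]
  congr 2
  · rw [← Finset.sum_div, Finset.sum_neg_distrib]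
    simp
  · simp
  · ring

/-- The mollification of `|t|^{-a}` in dimension one. -/
def mollifiedPower (a t : ℝ) : ℝ≥0∞ :=
  ∫⁻ s, ENNReal.ofReal (gaussReal (t - s)) * ENNReal.ofReal (‖s‖ ^ (-a))

theorem exists_mollifiedPower_le {a : ℝ} (h0 : 0 < a) (h1 : a < 1) :
    ∃ C : ℝ, 0 < C ∧ ∀ t, mollifiedPower a t ≤ ENNReal.ofReal C := by
  refine exists_lintegral_mul_norm_rpow_le (μ := (volume : Measure ℝ))
    (G := fun t => ENNReal.ofReal (gaussReal t)) continuous_gaussReal.measurable.ennreal_ofReal h0.le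
    (by simpa using h1) (fun t => ?_) lintegral_gaussReal.le
  rw [ENNReal.ofReal_le_one]
  refine (gaussReal_le t).trans (Real.exp_le_one_iff.2 ?_)
  rw [neg_div, neg_nonpos]
  positivity

theorem mollifiedPower_decay {a : ℝ} (h0 : 0 < a) (h1 : a < 1) {η : ℝ} (hη : 0 < η) :
    ∃ R : ℝ, ∀ t : ℝ, R < ‖t‖ → mollifiedPower a t ≤ ENNReal.ofReal η := by
  refine lintegral_mul_norm_rpow_decay (μ := (volume : Measure ℝ))
    (G := fun t => ENNReal.ofReal (gaussReal t)) continuous_gaussReal.measurable.ennreal_ofReal h0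
    (by simpa using h1) lintegral_gaussReal.le (fun η hη => ?_) hη
  obtain ⟨R, hR⟩ := exists_exp_neg_sq_le hη
  refine ⟨R, fun t ht => ENNReal.ofReal_le_ofReal ((gaussReal_le t).trans ?_)⟩
  have := hR ‖t‖ ht
  rwa [Real.norm_eq_abs, sq_abs] at this

theorem mollifiedPower_pos (a t : ℝ) : 0 < mollifiedPower a t :=
  lintegral_mul_norm_rpow_pos (μ := (volume : Measure ℝ))
    (G := fun t => ENNReal.ofReal (gaussReal t)) continuous_gaussReal.measurable.ennreal_ofReal
    (fun t => ENNReal.ofReal_pos.2 (gaussReal_pos t)) t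

theorem lintegral_ofReal_prod {f : Fin d → ℝ → ℝ} (hf : ∀ i, Integrable (f i))
    (h0 : ∀ i t, 0 ≤ f i t) :
    ∫⁻ y : Space d, ENNReal.ofReal (∏ i, f i (y i)) = ∏ i, ∫⁻ t, ENNReal.ofReal (f i t) := by
  have h1 : ∫⁻ y : Space d, ENNReal.ofReal (∏ i, f i (y i)) =
      ∫⁻ y : Fin d → ℝ, ENNReal.ofReal (∏ i, f i (y i)) :=
    (PiLp.volume_preserving_ofLp (Fin d)).lintegral_comp_emb
      (MeasurableEquiv.toLp 2 (Fin d → ℝ)).symm.measurableEmbedding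
      (fun y : Fin d → ℝ => ENNReal.ofReal (∏ i, f i (y i)))
  have hi : Integrable (fun y : Fin d → ℝ => ∏ i, f i (y i)) volume := Integrable.fintype_prod hf
  rw [h1, ← ofReal_integral_eq_lintegral_ofReal hi
    (ae_of_all _ fun y => Finset.prod_nonneg fun i _ => h0 i _),
    integral_fintype_prod_volume_eq_prod,
    ENNReal.ofReal_prod_of_nonneg (fun i _ => integral_nonneg (h0 i))]
  congr 1; ext i
  rw [ofReal_integral_eq_lintegral_ofReal (hf i) (ae_of_all _ (h0 i))]

/-- At scale `1` both the kernel and the Gaussian factor over the coordinates, so the mollification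
is a product of one-dimensional Riesz mollifications. It decays because a large `x` has a large
coordinate, whose factor is small while the others are bounded. -/
theorem regularCov_fractional {σ : ℝ} {w : Fin d → ℝ} (hσ : 0 < σ) (hw : ∀ i, 0 < w i ∧ w i < 1)
    (h0 : 0 < ∑ i, w i) (h2 : ∑ i, w i < 2) :
    ∃ A, RegularCov ((NoiseKernel.fractional w : NoiseKernel d).cov σ) (∑ i, w i) A := by
  have hfm : Measurable fun x : Space d => ENNReal.ofReal (σ ^ 2 * ∏ i, |x i| ^ (-w i)) := by
    fun_prop
  choose C hC hCle using fun i => exists_mollifiedPower_le (hw i).1 (hw i).2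
  have hint : ∀ (x : Space d) (i : Fin d),
      Integrable fun t : ℝ => gaussReal (x i - t) * ‖t‖ ^ (-w i) := by
    intro x i
    have hg := continuous_gaussReal.measurable
    refine ⟨Measurable.aestronglyMeasurable (by fun_prop), ?_⟩
    rw [hasFiniteIntegral_iff_ofReal (ae_of_all _ fun t =>
      mul_nonneg (gaussReal_pos _).le (by positivity))]
    refine lt_of_le_of_lt (le_trans (le_of_eq ?_) (hCle i (x i))) ENNReal.ofReal_lt_top
    unfold mollifiedPower
    congr 1; ext t
    rw [ENNReal.ofReal_mul (gaussReal_pos _).le]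
  have hmk : ∀ x, mollifiedKernel ((NoiseKernel.fractional w : NoiseKernel d).cov σ) 1 x =
      ENNReal.ofReal (σ ^ 2) * ∏ i, mollifiedPower (w i) (x i) := by
    intro x
    rw [NoiseKernel.cov, mollifiedKernel_withDensity hfm]
    have e1 : ∀ y : Space d, gaussE d 1 (x - y) * ENNReal.ofReal (σ ^ 2 * ∏ i, |y i| ^ (-w i)) =
        ENNReal.ofReal (σ ^ 2) *
          ENNReal.ofReal (∏ i, (fun i t => gaussReal (x i - t) * ‖t‖ ^ (-w i)) i (y i)) := by
      intro y
      rw [gaussE, gaussianKernel_one_eq_prod, ← ENNReal.ofReal_mul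
        (Finset.prod_nonneg fun i _ => (gaussReal_pos _).le), ← ENNReal.ofReal_mul (by positivity)]
      congr 1
      rw [Finset.prod_mul_distrib]
      simp only [PiLp.sub_apply, Real.norm_eq_abs]
      ring
    simp_rw [e1]
    rw [lintegral_const_mul' _ _ ENNReal.ofReal_ne_top, lintegral_ofReal_prod (hint x)
      (fun i t => mul_nonneg (gaussReal_pos _).le (by positivity))]
    congr 1
    apply Finset.prod_congr rfl
    intro i _
    unfold mollifiedPower
    congr 1; ext t
    rw [ENNReal.ofReal_mul (gaussReal_pos _).le]
  apply regularCov_of_scaling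
  · unfold NoiseKernel.cov
    infer_instance
  · exact h0
  · exact h2
  · intro ε x hε
    apply mollifiedKernel_withDensity_scale hfm _ hε
    intro ε y hε
    rw [← ENNReal.ofReal_mul (by positivity)]
    congr 1
    have e1 : ∀ i, |(ε • y) i| ^ (-w i) = ε ^ (-w i) * |y i| ^ (-w i) := by
      intro i
      rw [PiLp.smul_apply, smul_eq_mul, abs_mul, abs_of_pos hε,
        Real.mul_rpow hε.le (abs_nonneg _)]
    simp_rw [e1]
    rw [Finset.prod_mul_distrib, ← Real.rpow_sum_of_pos hε, Finset.sum_neg_distrib]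
    ring
  · refine ⟨σ ^ 2 * ∏ i, C i, mul_pos (by positivity) (Finset.prod_pos fun i _ => hC i),
      fun x => ?_⟩
    rw [hmk, ENNReal.ofReal_mul (by positivity), ENNReal.ofReal_prod_of_nonneg fun i _ => (hC i).le]
    gcongr with i
    exact hCle i _
  · intro η hη
    -- A common bound for all factors, made at least `1` so that the product over the remaining
    -- coordinates is at most `B ^ d`.
    set B : ℝ := 1 + ∑ i, C i with hB
    have hB1 : 1 ≤ B := by
      rw [hB]
      linarith [Finset.sum_nonneg fun i (_ : i ∈ Finset.univ) => (hC i).le]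
    have hCB : ∀ i, C i ≤ B := fun i => by
      have := Finset.single_le_sum (f := C) (fun i _ => (hC i).le) (Finset.mem_univ i)
      linarith
    choose R hR using fun i => mollifiedPower_decay (hw i).1 (hw i).2
      (η := η / (σ ^ 2 * B ^ d)) (by positivity)
    set S : ℝ := ∑ i, |R i| with hS
    have hRS : ∀ i, R i ≤ S := fun i => (le_abs_self _).trans
      (Finset.single_le_sum (f := fun i => |R i|) (fun i _ => abs_nonneg _) (Finset.mem_univ i))
    have hS0 : 0 ≤ S := Finset.sum_nonneg fun i _ => abs_nonneg _
    -- If all coordinates were at most `S` in absolute value, the Euclidean norm would be at most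
    -- `√d S`.
    refine ⟨Real.sqrt d * S, fun x hx => ?_⟩
    obtain ⟨i, hi⟩ : ∃ i, S < ‖x i‖ := by
      by_contra! hcon
      refine absurd hx (not_lt.2 ?_)
      rw [EuclideanSpace.norm_eq]
      calc Real.sqrt (∑ i, ‖x i‖ ^ 2) ≤ Real.sqrt (∑ _i : Fin d, S ^ 2) := by
            gcongr with i
            exact hcon i
        _ = Real.sqrt d * S := by
            rw [Finset.sum_const, Finset.card_univ, Fintype.card_fin, nsmul_eq_mul,
              Real.sqrt_mul (by positivity), Real.sqrt_sq hS0]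
    rw [hmk, ← Finset.mul_prod_erase _ _ (Finset.mem_univ i)]
    calc _ ≤ ENNReal.ofReal (σ ^ 2) * (ENNReal.ofReal (η / (σ ^ 2 * B ^ d)) *
          ∏ _j ∈ Finset.univ.erase i, ENNReal.ofReal B) := by
          gcongr with j
          · exact hR i (x i) ((hRS i).trans_lt hi)
          · exact (hCle j _).trans (ENNReal.ofReal_le_ofReal (hCB j))
      _ ≤ ENNReal.ofReal (σ ^ 2) * (ENNReal.ofReal (η / (σ ^ 2 * B ^ d)) *
          ENNReal.ofReal (B ^ d)) := by
          gcongr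
          rw [Finset.prod_const, ← ENNReal.ofReal_pow (by linarith)]
          apply ENNReal.ofReal_le_ofReal
          apply pow_le_pow_right₀ hB1
          refine (Finset.card_le_card (Finset.erase_subset _ _)).trans ?_
          simp
      _ = _ := by
          rw [← ENNReal.ofReal_mul (by positivity), ← ENNReal.ofReal_mul (by positivity)]
          congr 1
          field_simp
  · rw [hmk]
    refine ENNReal.mul_pos (by simpa using hσ.ne') (Finset.prod_ne_zero_iff.2 fun i _ => ?_)
    exact (mollifiedPower_pos _ _).ne'

theorem NoiseKernel.exists_regularCov {σ : ℝ} (hσ : 0 < σ) (k : NoiseKernel d) (hk : k.Admissible)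
    (h0 : 0 < k.exponent) (h2 : k.exponent < 2) : ∃ A, RegularCov (k.cov σ) k.exponent A := by
  cases k with
  | white => exact regularCov_white hσ h0 h2
  | riesz a => exact regularCov_riesz hσ hk.1 hk.2 h2
  | fractional w => exact regularCov_fractional hσ hk h0 h2

end Kernels

/-! ### The limit of the variational problems -/

theorem sub_ae_eq_trans_sub {d : ℕ} {u v : L2 d} {f fstar : Space d → ℝ}
    (hf : f =ᵐ[volume] v) (hs : fstar =ᵐ[volume] u) (z : Space d) :
    (fun x => f (x - -z) - fstar x) =ᵐ[volume] (trans z v - u : L2 d) := by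
  have hq : (fun x => f (x + z)) =ᵐ[volume] fun x => v (x + z) :=
    (measurePreserving_add_right volume z).quasiMeasurePreserving.ae_eq_comp hf
  filter_upwards [hq, hs, coeFn_trans z v, Lp.coeFn_sub (trans z v) u] with x h1 h2 h3 h4
  rw [h4, Pi.sub_apply, h3, ← h1, h2, sub_neg_eq_add]

namespace RegularCov

variable {d : ℕ} {γ : Measure (Space d)} {w A κ : ℝ}

/-- The variational constant of the kernel `γ` mollified at the scale `ε`, as a real number. -/
def supEn (κ : ℝ) (γ : Measure (Space d)) (ε : ℝ) : ℝ := sSup (energies κ (scaledCov γ ε))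

theorem energies_nonempty (hγ : RegularCov γ w A) (hκ : 0 < κ) (ε : ℝ) :
    (energies κ (scaledCov γ ε)).Nonempty := by
  obtain ⟨u, g, h, h1, -⟩ := hγ.exists_En_pos hκ ε
  exact ⟨_, u, g, h, h1, rfl⟩

theorem isLUB_supEn (hγ : RegularCov γ w A) (hκ : 0 < κ) {ε : ℝ} (hε : 0 ≤ ε) :
    IsLUB (energies κ (scaledCov γ ε)) (supEn κ γ ε) :=
  isLUB_csSup (hγ.energies_nonempty hκ ε) ((hγ.tame_scaledCov hε).bddAbove_energies hκ)

theorem supEn_pos (hγ : RegularCov γ w A) (hκ : 0 < κ) {ε : ℝ} (hε : 0 ≤ ε) :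
    0 < supEn κ γ ε := by
  obtain ⟨u, g, h, h1, h0⟩ := hγ.exists_En_pos hκ ε
  exact h0.trans_le ((hγ.isLUB_supEn hκ hε).1 ⟨u, g, h, h1, rfl⟩)

theorem varConst_scaledCov (hγ : RegularCov γ w A) (hκ : 0 < κ) {ε : ℝ} (hε : 0 ≤ ε) :
    varConst κ (scaledCov γ ε) = (supEn κ γ ε : EReal) :=
  (hγ.tame_scaledCov hε).varConst_eq (hγ.energies_nonempty hκ ε) (hγ.isLUB_supEn hκ hε)

theorem exists_isMaximizer (hγ : RegularCov γ w A) (hκ : 0 < κ) {ε : ℝ} (hε : 0 ≤ ε) :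
    ∃ f, IsMaximizer κ (scaledCov γ ε) f :=
  (hγ.tame_scaledCov hε).exists_isMaximizer hκ (hγ.supEn_pos hκ hε) (hγ.energies_nonempty hκ ε)
    (hγ.isLUB_supEn hκ hε)

theorem exists_norm_grad_le (hγ : RegularCov γ w A) (hκ : 0 < κ) :
    ∃ R : ℝ, 1 ≤ R ∧ ∀ (u : L2 d) (g : V2 d), HasGrad u g → ‖u‖ = 1 → ∀ ε,
      0 ≤ En κ (scaledCov γ ε) u g → ‖g‖ ≤ R := by
  obtain ⟨C, hC, h⟩ := hγ.exists_interaction_scaledCov_le (half_pos hκ)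
  refine ⟨1 + 2 * C / κ, by linarith [show 0 ≤ 2 * C / κ by positivity], fun u g hu h1 ε h0 => ?_⟩
  have hI := ENNReal.toReal_le_of_le_ofReal (by positivity) (h u g hu ε)
  rw [h1] at hI
  unfold En at h0
  have hg : ‖g‖ ^ 2 ≤ 2 * C / κ := by
    rw [le_div_iff₀ hκ]
    nlinarith
  have := norm_nonneg g
  nlinarith

theorem En_scaledCov_le (hγ : RegularCov γ w A) {R : ℝ} (hR : 1 ≤ R)
    {u : L2 d} {g : V2 d} (hu : HasGrad u g) (h1 : ‖u‖ = 1) (hg : ‖g‖ ≤ R) {ε : ℝ} (hε : 0 < ε)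
    (hε1 : ε ≤ 1) :
    En κ (scaledCov γ 0) u g ≤ En κ (scaledCov γ ε) u g + |oscConst d w A R| * ε ^ (1 - w / 2) ∧
      En κ (scaledCov γ ε) u g ≤
        En κ (scaledCov γ 0) u g + |oscConst d w A R| * ε ^ (1 - w / 2) := by
  obtain ⟨ha, hb⟩ := hγ.interaction_scaledCov_le hu (h1.trans_le hR) hg hε hε.le hε1 (ε := 0)
  rw [← scaledCov_of_pos γ hε] at ha hb
  have hp : 0 ≤ ε ^ (1 - w / 2) := by positivity
  have hle : ENNReal.ofReal (oscConst d w A R * ε ^ (1 - w / 2)) ≤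
      ENNReal.ofReal (|oscConst d w A R| * ε ^ (1 - w / 2)) :=
    ENNReal.ofReal_le_ofReal (mul_le_mul_of_nonneg_right (le_abs_self _) hp)
  have key : ∀ ε₁ ε₂ : ℝ, 0 ≤ ε₂ → interaction (scaledCov γ ε₁) u ≤ interaction (scaledCov γ ε₂) u +
        ENNReal.ofReal (oscConst d w A R * ε ^ (1 - w / 2)) →
      (interaction (scaledCov γ ε₁) u).toReal ≤ (interaction (scaledCov γ ε₂) u).toReal +
        |oscConst d w A R| * ε ^ (1 - w / 2) := by
    intro ε₁ ε₂ h₂ h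
    have hf := (hγ.tame_scaledCov h₂).interaction_ne_top hu
    have := ENNReal.toReal_mono (by finiteness) (h.trans (add_le_add_right hle _))
    rwa [ENNReal.toReal_add hf ENNReal.ofReal_ne_top,
      ENNReal.toReal_ofReal (by positivity)] at this
  unfold En
  constructor
  · linarith [key 0 ε hε.le ha]
  · linarith [key ε 0 le_rfl hb]

/-- Pairs of negative energy are irrelevant because both suprema are positive. The other pairs have
gradients bounded independently of the scale, so a single oscillation constant covers them all. -/
theorem abs_supEn_sub_le (hγ : RegularCov γ w A) (hκ : 0 < κ) :
    ∃ C : ℝ, 0 ≤ C ∧ (∀ ε, 0 < ε → ε ≤ 1 →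
      |supEn κ γ ε - supEn κ γ 0| ≤ C * ε ^ (1 - w / 2)) ∧
      ∀ (u : L2 d) (g : V2 d), HasGrad u g → ‖u‖ = 1 → ∀ ε, 0 < ε → ε ≤ 1 →
        0 ≤ En κ (scaledCov γ ε) u g →
        En κ (scaledCov γ ε) u g ≤ En κ (scaledCov γ 0) u g + C * ε ^ (1 - w / 2) := by
  obtain ⟨R, hR, hg⟩ := hγ.exists_norm_grad_le hκ
  refine ⟨|oscConst d w A R|, abs_nonneg _, fun ε hε hε1 => ?_, fun u g hu h1 ε hε hε1 h0 =>
    (hγ.En_scaledCov_le hR hu h1 (hg u g hu h1 ε h0) hε hε1).2⟩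
  have hp : 0 ≤ |oscConst d w A R| * ε ^ (1 - w / 2) := by positivity
  rw [abs_sub_le_iff, sub_le_iff_le_add', sub_le_iff_le_add']
  constructor
  · refine (hγ.isLUB_supEn hκ hε.le).2 ?_
    rintro e ⟨u, g, hu, h1, rfl⟩
    rcases lt_or_ge (En κ (scaledCov γ ε) u g) 0 with h | h
    · linarith [hγ.supEn_pos hκ le_rfl]
    · have hm := (hγ.isLUB_supEn hκ le_rfl).1 ⟨u, g, hu, h1, rfl⟩
      linarith [(hγ.En_scaledCov_le (κ := κ) hR hu h1 (hg u g hu h1 ε h) hε hε1).2]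
  · refine (hγ.isLUB_supEn hκ le_rfl).2 ?_
    rintro e ⟨u, g, hu, h1, rfl⟩
    rcases lt_or_ge (En κ (scaledCov γ 0) u g) 0 with h | h
    · linarith [hγ.supEn_pos hκ hε.le]
    · have hm := (hγ.isLUB_supEn hκ hε.le).1 ⟨u, g, hu, h1, rfl⟩
      linarith [(hγ.En_scaledCov_le (κ := κ) hR hu h1 (hg u g hu h1 0 h) hε hε1).1]

theorem tendsto_const_mul_rpow (hγ : RegularCov γ w A) (C : ℝ) :
    Tendsto (fun ε : ℝ => C * ε ^ (1 - w / 2)) (𝓝[>] 0) (𝓝 0) := by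
  have hθ : 0 < 1 - w / 2 := by linarith [hγ.w_lt]
  have h := ((Real.continuous_rpow_const hθ.le).tendsto 0).const_mul C
  rw [Real.zero_rpow hθ.ne', mul_zero] at h
  exact h.mono_left nhdsWithin_le_nhds

theorem tendsto_supEn (hγ : RegularCov γ w A) (hκ : 0 < κ) :
    Tendsto (supEn κ γ) (𝓝[>] 0) (𝓝 (supEn κ γ 0)) := by
  obtain ⟨C, -, hC, -⟩ := hγ.abs_supEn_sub_le hκ
  rw [tendsto_iff_norm_sub_tendsto_zero]
  refine squeeze_zero' (Eventually.of_forall fun _ => norm_nonneg _) ?_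
    (hγ.tendsto_const_mul_rpow C)
  filter_upwards [Ioc_mem_nhdsGT one_pos] with ε hε using hC ε hε.1 hε.2

/-- Evaluated at scale zero, a maximizer at scale `ε n` loses only `O((ε n)^{1-w/2})`, so maximizers
along `ε n → 0` form a maximizing sequence of the limit problem. -/
theorem tendsto_En_scaledCov_zero (hγ : RegularCov γ w A) (hκ : 0 < κ) {ε : ℕ → ℝ}
    (hε : Tendsto ε atTop (𝓝[>] 0)) {u : ℕ → L2 d} {g : ℕ → V2 d}
    (hu : ∀ n, HasGrad (u n) (g n)) (h1 : ∀ n, ‖u n‖ = 1)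
    (hE : ∀ n, En κ (scaledCov γ (ε n)) (u n) (g n) = supEn κ γ (ε n)) :
    Tendsto (fun n => En κ (scaledCov γ 0) (u n) (g n)) atTop (𝓝 (supEn κ γ 0)) := by
  obtain ⟨C, -, -, hC⟩ := hγ.abs_supEn_sub_le hκ
  have hlow := ((hγ.tendsto_supEn hκ).sub (hγ.tendsto_const_mul_rpow C)).comp hε
  rw [sub_zero] at hlow
  refine tendsto_of_tendsto_of_tendsto_of_le_of_le' hlow tendsto_const_nhds ?_
    (Eventually.of_forall fun n => (hγ.isLUB_supEn hκ le_rfl).1 ⟨u n, g n, hu n, h1 n, rfl⟩)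
  filter_upwards [hε (Ioc_mem_nhdsGT one_pos)] with n hn
  have h0 : 0 ≤ En κ (scaledCov γ (ε n)) (u n) (g n) := by
    rw [hE]
    exact (hγ.supEn_pos hκ hn.1.le).le
  have := hC (u n) (g n) (hu n) (h1 n) (ε n) hn.1 hn.2 h0
  rw [hE] at this
  simp only [Function.comp_apply]
  linarith

/-- Maximizers of the mollified problems converge in `H¹`, along a subsequence and after
translation, to a maximizer of the limit problem. -/
theorem exists_tendsto_isMaximizer (hγ : RegularCov γ w A) (hκ : 0 < κ) {ε : ℕ → ℝ}
    (hpos : ∀ n, 0 < ε n) (hε : Tendsto ε atTop (𝓝[>] 0)) {F : ℕ → Space d → ℝ}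
    (hF : ∀ n, IsMaximizer κ (scaledCov γ (ε n)) (F n)) :
    ∃ φ : ℕ → ℕ, StrictMono φ ∧ ∃ (z : ℕ → Space d) (fstar : Space d → ℝ),
      IsMaximizer κ γ fstar ∧
      Tendsto (fun n => h1Norm fun x => F (φ n) (x - z n) - fstar x) atTop (𝓝 0) := by
  choose v h hv hFv using fun n => (hF n).1.exists_hasGrad
  have hmax := fun n => ((hγ.tame_scaledCov (hpos n).le).isMaximizer_iff
    (hγ.varConst_scaledCov hκ (hpos n).le) (hv n) (hFv n)).1 (hF n)
  have hT := hγ.tame_scaledCov le_rfl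
  obtain ⟨φ, z, u, g, hφ, hu, hu1, hEu, htu, htg⟩ := hT.exists_maximizer_of_maximizing hκ
    (hγ.supEn_pos hκ le_rfl)
    (fun u g hu h1 => (hγ.isLUB_supEn hκ le_rfl).1 ⟨u, g, hu, h1, rfl⟩) hv (fun n => (hmax n).1)
    (hγ.tendsto_En_scaledCov_zero hκ hε hv (fun n => (hmax n).1) fun n => (hmax n).2)
  -- The sign changes because `trans z` shifts by `x ↦ x + z` while the conclusion is written with
  -- `x - z n`.
  refine ⟨φ, hφ, fun n => -z n, u, ?_, ?_⟩
  · have := (hT.isMaximizer_iff (hγ.varConst_scaledCov hκ le_rfl) hu (ae_eq_refl _)).2 ⟨hu1, hEu⟩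
    rwa [scaledCov_zero] at this
  · have hn : ∀ n, h1Norm (fun x => F (φ n) (x - -z n) - u x) =
        Real.sqrt (‖trans (z n) (v (φ n)) - u‖ ^ 2 + ‖trans (z n) (h (φ n)) - g‖ ^ 2) := fun n =>
      (((hv (φ n)).trans (z n)).sub hu).h1Norm_eq
        (sub_ae_eq_trans_sub (hFv (φ n)) (ae_eq_refl _) (z n))
    simp only [hn]
    have h1 := tendsto_iff_norm_sub_tendsto_zero.1 htu
    have h2 := tendsto_iff_norm_sub_tendsto_zero.1 htg
    have h3 := ((h1.pow 2).add (h2.pow 2)).sqrt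
    simpa using h3

end RegularCov

theorem tendsto_const_mul_nhdsGT_zero {a : ℝ} (ha : 0 < a) :
    Tendsto (fun c : ℝ => a * c) (𝓝[>] 0) (𝓝[>] 0) := by
  refine tendsto_nhdsWithin_iff.2 ⟨?_, ?_⟩
  · have h : Tendsto (fun c : ℝ => a * c) (𝓝 0) (𝓝 (a * 0)) := tendsto_id.const_mul a
    rw [mul_zero] at h
    exact h.mono_left nhdsWithin_le_nhds
  · filter_upwards [self_mem_nhdsWithin] with c hc using mul_pos ha hc

end

end PAM

/-! ### The main theorem -/

theorem proposition2p4 (d : ℕ) (κ σ : ℝ) (hκ : 0 < κ) (hσ : 0 < σ)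
    (k : PAM.NoiseKernel d) (hk : k.Admissible)
    (hω₀ : 0 < k.exponent) (hω₂ : k.exponent < 2) :
    (∀ p c : ℝ, 0 < p → 0 < c →
      0 < PAM.varConst κ (k.covAt σ p c) ∧
      PAM.varConst κ (k.covAt σ p c) < ⊤ ∧
      ∃ f : PAM.Space d → ℝ, PAM.IsMaximizer κ (k.covAt σ p c) f) ∧
    (∀ p : ℝ, 0 < p →
      PAM.varConst κ (k.cov σ) < ⊤ ∧
      Tendsto (fun c : ℝ => PAM.varConst κ (k.covAt σ p c)) (𝓝[>] 0)
        (𝓝 (PAM.varConst κ (k.cov σ)))) ∧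
    (∀ p : ℝ, 0 < p → ∀ F : ℝ → PAM.Space d → ℝ,
      (∀ c : ℝ, 0 < c → PAM.IsMaximizer κ (k.covAt σ p c) (F c)) →
      ∀ c : ℕ → ℝ, (∀ n, 0 < c n) → Tendsto c atTop (𝓝 0) →
        ∃ φ : ℕ → ℕ, StrictMono φ ∧
          ∃ (z : ℕ → PAM.Space d) (fstar : PAM.Space d → ℝ),
            PAM.IsMaximizer κ (k.cov σ) fstar ∧
            Tendsto (fun n => PAM.h1Norm fun x => F (c (φ n)) (x - z n) - fstar x)
              atTop (𝓝 0)) := by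
  obtain ⟨A, hγ⟩ := PAM.NoiseKernel.exists_regularCov hσ k hk hω₀ hω₂
  -- The parameter `p` matters only through this positive factor of the mollification scale, so
  -- every claim is one about a scale tending to zero or fixed.
  have hq : ∀ p : ℝ, 0 < p → 0 < p ^ (1 / (2 - k.exponent)) := fun p hp => by positivity
  have hcov : ∀ p c : ℝ, 0 < p → 0 < c →
      k.covAt σ p c = PAM.scaledCov (k.cov σ) (p ^ (1 / (2 - k.exponent)) * c) :=
    fun p c hp hc => (PAM.scaledCov_of_pos _ (mul_pos (hq p hp) hc)).symm
  have h0 := hγ.varConst_scaledCov hκ le_rfl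
  rw [PAM.scaledCov_zero] at h0
  refine ⟨fun p c hp hc => ?_, fun p hp => ⟨?_, ?_⟩, fun p hp F hF c hc hc0 => ?_⟩
  · have hε := (mul_pos (hq p hp) hc).le
    rw [hcov p c hp hc, hγ.varConst_scaledCov hκ hε]
    exact ⟨EReal.coe_pos.2 (hγ.supEn_pos hκ hε), EReal.coe_lt_top _, hγ.exists_isMaximizer hκ hε⟩
  · rw [h0]
    exact EReal.coe_lt_top _
  · rw [h0]
    refine Tendsto.congr' ?_ ((continuous_coe_real_ereal.tendsto _).comp
      ((hγ.tendsto_supEn hκ).comp (PAM.tendsto_const_mul_nhdsGT_zero (hq p hp))))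
    filter_upwards [self_mem_nhdsWithin] with c hc
    rw [hcov p c hp hc, hγ.varConst_scaledCov hκ (mul_pos (hq p hp) hc).le]
    rfl
  · have hc' : Tendsto c atTop (𝓝[>] 0) :=
      tendsto_nhdsWithin_iff.2 ⟨hc0, Eventually.of_forall hc⟩
    exact hγ.exists_tendsto_isMaximizer hκ (F := fun n => F (c n))
      (fun n => mul_pos (hq p hp) (hc n))
      ((PAM.tendsto_const_mul_nhdsGT_zero (hq p hp)).comp hc')
      fun n => hcov p (c n) hp (hc n) ▸ hF (c n) (hc n)
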